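/- **Setting.** Let $\mathcal W$ (contexts) and $\mathcal S$ (states) be measurable spaces, $\mathcal A$ a finite non-empty action set, $H\ge 1$ a horizon, $s_1\in\mathcal S$ a fixed initial state, $q$ a probability distribution on $\mathcal W$, and $ds$ a $\sigma$-finite reference measure on $\mathcal S$. In each episode a context $w\sim q$ is drawn, and the agent plays the $H$-step MDP $\mathcal M(w)$ with transition densities $P_h(s'|s,a,w)$ and deterministic rewards $r_h(s,a,w)\in[0,1]$ from $s_1$. A policy $\pi$ assigns to each step and state a distribution on $\mathcal A$; $V^\pi_{\mathcal M(w)}$ is its expected total reward in $\mathcal M(w)$, and $\pi_w^*$ maximizes $V^\pi_{\mathcal M(w)}$. *Model I.* There are known features $\phi_h,\psi_h:\mathcal S\times\mathcal A\times\mathcal W\to\mathbb R^d$ and unknown weights $\mu_h:\mathcal S\to\mathbb R^d$, $\eta_h\in\mathbb R^d$ with $$P_h(s'|s,a,w)=\langle\phi_h(s,a,w),\mu_h(s')\rangle,\qquad r_h(s,a,w)=\langle\psi_h(s,a,w),\eta_h\rangle,$$ $\|\phi_h\|_2\le1$, $\|\psi_h\|_2\le1$, $\|\eta_h\|_2\le\sqrt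 d$, and $\|\int\mu_h(s)g(s)\,ds\|_2\le\sqrt d$ for every $g:\mathcal S\to[0,1]$. A finite class $\Psi_1$ of functions $\mathcal S\to\mathbb R^d$ is given that contains every $\mu_h$, and each $m\in\Psi_1$ is admissible: for every $h$, $\langle\phi_h(s,a,w),m(\cdot)\rangle$ is a probability density for all $(s,a,w)$, and $\|\int m(s)g(s)\,ds\|_2\le\sqrt d$ for every $g:\mathcal S\to[0,1]$. *Algorithm.* Let $\delta\in(0,1)$, $\gamma_1,\gamma_2>0$, $\lambda_n=\gamma_1d\log(2nH/\delta)$, $\xi_n=\gamma_2d\log(2nH/\delta)$, $\alpha_n=5H\sqrt{2\lambda_nd+4\log(2nH|\Psi_1|/\delta)}$, $\beta_n=\sqrt{d\xi_n}$, and write $\|x\|_B=\sqrt{x^\top Bx}$. In episode $1$ an arbitrary policy is played. In episode $n\ge2$, with data $(w_\tau,(s^\tau_h,a^\tau_h,r^\tau_h,s^\tau_{h+1})_{h\le H})_{\tau<n}$ and $\phi_h^\tau=\phi_h(s_h^\tau,a_h^\tau,w_\tau)$, $\psi_h^\tau=\psi_h(s_h^\tau,a_h^\tau,w_\tau)$,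 put $$\hat\Sigma_h^n=\sum_{\tau<n}\phi_h^\tau(\phi_h^\tau)^\top+\lambda_nI,\quad \hat\Lambda_h^n=\sum_{\tau<n}\psi_h^\tau(\psi_h^\tau)^\top+\xi_nI,\quad \hat\eta_h^n=(\hat\Lambda_h^n)^{-1}\sum_{\tau<n}\psi_h^\tau r_h^\tau,$$ $$\hat\mu_h^n\in\operatorname*{argmax}_{m\in\Psi_1}\sum_{\tau<n}\log\langle\phi_h^\tau,m(s_{h+1}^\tau)\rangle\quad(\log 0=-\infty),$$ $$\hat r_h^n=\max\{0,\min\{1,\langle\hat\eta_h^n,\psi_h\rangle\}\}+\min\{\alpha_n\|\phi_h\|_{(\hat\Sigma_h^n)^{-1}},H\}+\min\{\beta_n\|\psi_h\|_{(\hat\Lambda_h^n)^{-1}},1\}.$$ For every context $w$, the policy $\pi_w^n$ maximizes over $\pi$ the truncated value $\bar{\bar V}^\pi_1(s_1)$, defined by $\bar{\bar V}^\pi_{H+1}=0$ and $$\bar{\bar V}^\pi_h(s)=\mathbb E_{a\sim\pi_h(s)}\min\Big\{3H,\ \hat r_h^n(s,a,w)+\int\langle\phi_h(s,a,w),\hat\mu_h^n(s')\rangle\,\bar{\bar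 V}^\pi_{h+1}(s')\,ds'\Big\}.$$ Then $w_n\sim q$ is drawn and $\pi^n_{w_n}$ is executed. Ties are broken arbitrarily (measurably in data, context and state). **Theorem.** There is an absolute constant $\gamma_0>0$ such that for all constants $\gamma_1,\gamma_2\ge\gamma_0$ the following holds in every such setting and for every $\delta\in(0,1)$. (1) For every $N\ge1$, with probability at least $1-3\delta/2$, $$\frac1N\sum_{n=1}^N\mathbb E_{w\sim q}\big[V^{\pi^*_w}_{\mathcal M(w)}-V^{\pi^n_w}_{\mathcal M(w)}\big]\le\Big(42H\sqrt{2d\lambda_N+4\log(2HN|\Psi_1|/\delta)}+6\sqrt{d\xi_N}\Big)\,H\sqrt{\frac{2d}N}\,\sqrt{\log\Big(1+\frac N{d\lambda}\Big)},$$ where $\lambda=\min\{\lambda_1,\xi_1\}$. (2) Consequently $\tilde{\mathcal O}\big(H^4d^3\log(|\Psi_1|/\delta)/\epsilon^2\big)$ episodes suffice for an average gap below $\epsilon$: there is a constant $C>0$, depending only on $\gamma_1,\gamma_2$, such that for every $\epsilon>0$, with $X=H^4d^3\log(|\Psi_1|/\delta)/\epsilon^2$, and every $N\ge1$ with $N\ge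 C\,X\log^2(2+X)$, with probability at least $1-3\delta/2$ the average gap on the left-hand side of (1) is less than $\epsilon$. -/

import Mathlib

open MeasureTheory ProbabilityTheory
open scoped ENNReal

noncomputable section

namespace CMDPModelI

/-- `ℝ^d` with the Euclidean norm. -/
abbrev Vec (d : ℕ) : Type := EuclideanSpace ℝ (Fin d)

/-- A (Markov, possibly stochastic) policy of horizon `H`: at each step a Markov kernel from states
to actions. The steps `1, …, H` are numbered `0, …, H - 1`. -/
structure Policy (H : ℕ) (S A : Type*) [MeasurableSpace S] [MeasurableSpace A] where
  kernel : Fin H → Kernel S A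
  markov : ∀ h, IsMarkovKernel (kernel h)

/-- A contextual Markov decision process of horizon `H`: initial state `s₁`, context distribution
`q`, context-dependent transition kernels `P h (s, a, w)` and deterministic rewards
`r h (s, a, w) ∈ [0, 1]`. -/
structure CMDP (H : ℕ) (W S A : Type*) [MeasurableSpace W] [MeasurableSpace S]
    [MeasurableSpace A] where
  s₁ : S
  q : Measure W
  q_prob : IsProbabilityMeasure q
  P : Fin H → Kernel (S × A × W) S
  P_markov : ∀ h, IsMarkovKernel (P h)
  r : Fin H → S × A × W → ℝ
  r_measurable : ∀ h, Measurable (r h)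
  r_mem : ∀ h x, r h x ∈ Set.Icc (0 : ℝ) 1

/-- The list of the transitions `(s_h, a_h, s_{h+1})` of an episode. -/
abbrev Traj (H : ℕ) (S A : Type*) : Type _ := Fin H → S × A × S

/-- An episode: its context and its transitions. -/
abbrev Episode (H : ℕ) (W S A : Type*) : Type _ := W × Traj H S A

section Values

variable {W S A : Type*} [MeasurableSpace W] [MeasurableSpace S] [MeasurableSpace A]

/-- The law of the trajectory that starts in `s` and follows, at each step, first the policy and
then the transition kernel: `a ∼ π_h(s)`, `s' ∼ P_h(s, a)`. -/
def trajLaw : (H : ℕ) → (P : Fin H → Kernel (S × A) S) → (π : Fin H → Kernel S A) → S →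
    Measure (Traj H S A)
  | 0, _, _, _ => Measure.dirac Fin.elim0
  | H + 1, P, π, s =>
      (π 0 s).bind fun a =>
        (P 0 (s, a)).bind fun s' =>
          (trajLaw H (fun h => P h.succ) (fun h => π h.succ) s').map fun τ =>
            (Fin.cons (s, a, s') τ : Fin (H + 1) → S × A × S)

/-- The truncated value function `V̿` of a policy for rewards `r`, transition densities `p` with
respect to `ν`, and truncation level `B`:
`Q̿_h(s, a) = min {B, r_h(s, a) + ∫ p_h(s' | s, a) V̿_{h+1}(s') dν(s')}`,
`V̿_h(s) = E_{a ∼ π_h(s)} Q̿_h(s, a)`, and `V̿ = 0` after the last step. -/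
def truncValue (ν : Measure S) (B : ℝ) : (H : ℕ) → (r : Fin H → S → A → ℝ) →
    (p : Fin H → S → A → S → ℝ) → (π : Fin H → Kernel S A) → S → ℝ
  | 0, _, _, _, _ => 0
  | H + 1, r, p, π, s =>
      ∫ a, min B (r 0 s a +
        ∫ s', p 0 s a s' *
          truncValue ν B H (fun h => r h.succ) (fun h => p h.succ) (fun h => π h.succ) s' ∂ν)
        ∂(π 0 s)

variable {H : ℕ}

/-- The transition kernels of the MDP `M(w)`. -/
def CMDP.transAt (M : CMDP H W S A) (w : W) (h : Fin H) : Kernel (S × A) S :=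
  (M.P h).comap (fun x : S × A => (x.1, x.2, w)) (by fun_prop)

/-- The law of the trajectory of an episode with context `w` under the policy `π`. -/
def CMDP.episodeLaw (M : CMDP H W S A) (w : W) (π : Policy H S A) : Measure (Traj H S A) :=
  trajLaw H (M.transAt w) π.kernel M.s₁

/-- The value `V^π_{M(w)}`: expected total reward of `π` in `M(w)` from the initial state. -/
def CMDP.value (M : CMDP H W S A) (w : W) (π : Policy H S A) : ℝ :=
  ∫ τ, ∑ h, M.r h ((τ h).1, (τ h).2.1, w) ∂(M.episodeLaw w π)

/-- The optimal value `max_π V^π_{M(w)}` (the values lie in `[0, H]`). -/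
def CMDP.optValue (M : CMDP H W S A) (w : W) : ℝ :=
  ⨆ π : Policy H S A, M.value w π

end Values

section ModelOne

variable {H d : ℕ} {W S A : Type*} [MeasurableSpace W] [MeasurableSpace S] [MeasurableSpace A]

/-- `m` is an admissible weight function for the feature map `φ`: `⟨φ(s, a, w), m(·)⟩` is a
probability density with respect to `ν` for all `(s, a, w)`, and `‖∫ m g dν‖₂ ≤ √d` for every
`g` with values in `[0, 1]`. -/
structure IsWeight (ν : Measure S) (φ : S × A × W → Vec d) (m : S → Vec d) : Prop where
  measurable : Measurable m
  integrable : Integrable m ν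
  nonneg : ∀ x s', 0 ≤ inner ℝ (φ x) (m s')
  integral_eq_one : ∀ x, ∫ s', inner ℝ (φ x) (m s') ∂ν = 1
  norm_integral_le : ∀ g : S → ℝ, Measurable g → (∀ s, g s ∈ Set.Icc (0 : ℝ) 1) →
    ‖∫ s, g s • m s ∂ν‖ ≤ √(d : ℝ)

/-- The CMDP `M` has varying representation: features `φ`, `ψ` that depend on the context, and
weights `μ`, `η` common to all contexts. `ν` is the reference measure on the states, with respect
to which transition densities are taken. -/
structure IsModelI (M : CMDP H W S A) (ν : Measure S) (φ ψ : Fin H → S × A × W → Vec d)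
    (μ : Fin H → S → Vec d) (η : Fin H → Vec d) : Prop where
  φ_measurable : ∀ h, Measurable (φ h)
  ψ_measurable : ∀ h, Measurable (ψ h)
  φ_norm_le : ∀ h x, ‖φ h x‖ ≤ 1
  ψ_norm_le : ∀ h x, ‖ψ h x‖ ≤ 1
  weight : ∀ h, IsWeight ν (φ h) (μ h)
  trans_eq : ∀ h x, M.P h x = ν.withDensity fun s' => ENNReal.ofReal (inner ℝ (φ h x) (μ h s'))
  reward_eq : ∀ h x, M.r h x = inner ℝ (ψ h x) (η h)
  η_norm_le : ∀ h, ‖η h‖ ≤ √(d : ℝ)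

/-- The finite model class `Ψ` consists of admissible weight functions and contains the true
`μ_h` for every step `h`. -/
structure IsModelClass (ν : Measure S) (φ : Fin H → S × A × W → Vec d) (μ : Fin H → S → Vec d)
    (Ψ : Finset (S → Vec d)) : Prop where
  admissible : ∀ m ∈ Ψ, ∀ h, IsWeight ν (φ h) m
  realizable : ∀ h, μ h ∈ Ψ

end ModelOne

section Parameters

/-- The regularizer `γ d log(2 n H / δ)`: `λ_n` for `γ = γ₁` and `ξ_n` for `γ = γ₂`. -/
def reg (γ : ℝ) (d H : ℕ) (δ : ℝ) (n : ℕ) : ℝ :=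
  γ * d * Real.log (2 * n * H / δ)

/-- `α_n = 5 H √(2 λ_n d + 4 log(2 n H K / δ))`, where `K` is the size of the model class. -/
def alpha (γ₁ : ℝ) (d H K : ℕ) (δ : ℝ) (n : ℕ) : ℝ :=
  5 * H * √(2 * reg γ₁ d H δ n * d + 4 * Real.log (2 * n * H * K / δ))

/-- `β_n = √(d ξ_n)`. -/
def beta (γ₂ : ℝ) (d H : ℕ) (δ : ℝ) (n : ℕ) : ℝ :=
  √(d * reg γ₂ d H δ n)

/-- The regularized Gram matrix `∑_τ v_τ v_τᵀ + c I`. -/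
def gram {n d : ℕ} (v : Fin n → Vec d) (c : ℝ) : Matrix (Fin d) (Fin d) ℝ :=
  ∑ τ, Matrix.vecMulVec (v τ).ofLp (v τ).ofLp + c • (1 : Matrix (Fin d) (Fin d) ℝ)

/-- `‖x‖_B = √(xᵀ B x)`. -/
def matNorm {d : ℕ} (B : Matrix (Fin d) (Fin d) ℝ) (x : Vec d) : ℝ :=
  √(x.ofLp ⬝ᵥ B.mulVec x.ofLp)

end Parameters

section Algorithm

variable {H d : ℕ} {W S A : Type*} [MeasurableSpace W] [MeasurableSpace S] [MeasurableSpace A]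

/-- `(s_h, a_h, w)` of an episode. -/
def visit (e : Episode H W S A) (h : Fin H) : S × A × W :=
  ((e.2 h).1, (e.2 h).2.1, e.1)

/-- The log-likelihood `∑_{(s,a,s',w)} log ⟨φ_h(s,a,w), m(s')⟩` of `m` on the data of step `h`;
it takes values in `[-∞, ∞)`, with `log 0 = -∞`. -/
def logLik (φ : Fin H → S × A × W → Vec d) {i : ℕ} (D : Fin i → Episode H W S A) (h : Fin H)
    (m : S → Vec d) : EReal :=
  ∑ τ, ENNReal.log (ENNReal.ofReal (inner ℝ (φ h (visit (D τ) h)) (m ((D τ).2 h).2.2)))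

/-- `‖v_h(x)‖` in the norm of the inverse regularized Gram matrix of the feature map `v` along the
data `D`, for the regularizer `c`. -/
def featNorm (v : Fin H → S × A × W → Vec d) (c : ℝ) {i : ℕ} (D : Fin i → Episode H W S A)
    (h : Fin H) (x : S × A × W) : ℝ :=
  matNorm (gram (fun τ => v h (visit (D τ) h)) c)⁻¹ (v h x)

/-- Ridge-regression estimate `η̂_h` of the reward weights, with regularizer `c`; the observed
reward is `r_h(s_h, a_h, w)`. -/
def ridge (M : CMDP H W S A) (ψ : Fin H → S × A × W → Vec d) (c : ℝ) {i : ℕ}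
    (D : Fin i → Episode H W S A) (h : Fin H) : Vec d :=
  WithLp.toLp 2 ((gram (fun τ => ψ h (visit (D τ) h)) c)⁻¹.mulVec
    (∑ τ, M.r h (visit (D τ) h) • (ψ h (visit (D τ) h)).ofLp))

/-- The optimistic reward `r̂ = f̂ + b̂ + ĉ` of episode `n = i + 1`, computed from the data `D` of
the first `i` episodes. Here `f̂` is the ridge estimate clipped to `[0, 1]`,
`b̂ = min {α_n ‖φ‖, H}` and `ĉ = min {β_n ‖ψ‖, 1}`, in the norms of the inverse Gram matrices. -/
def optReward (M : CMDP H W S A) (φ ψ : Fin H → S × A × W → Vec d) (K : ℕ) (γ₁ γ₂ δ : ℝ)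
    {i : ℕ} (D : Fin i → Episode H W S A) (h : Fin H) (x : S × A × W) : ℝ :=
  max 0 (min 1 (inner ℝ (ridge M ψ (reg γ₂ d H δ (i + 1)) D h) (ψ h x)))
    + min (alpha γ₁ d H K δ (i + 1) * featNorm φ (reg γ₁ d H δ (i + 1)) D h x) H
    + min (beta γ₂ d H δ (i + 1) * featNorm ψ (reg γ₂ d H δ (i + 1)) D h x) 1

/-- What a learner does: before episode `i + 1` it computes from the data of the first `i`
episodes a weight estimate `μ̂_h` for each step and a policy for each context. The policy depends
measurably on the data, the context and the state. -/
structure Learner (H d : ℕ) (W S A : Type*) [MeasurableSpace W] [MeasurableSpace S]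
    [MeasurableSpace A] where
  muHat : (i : ℕ) → (Fin i → Episode H W S A) → Fin H → S → Vec d
  kernel : (i : ℕ) → Fin H → Kernel (((Fin i → Episode H W S A) × W) × S) A
  markov : ∀ i h, IsMarkovKernel (kernel i h)

/-- The policy `π^{i+1}_w` that is chosen on the data `D` for the context `w`. -/
def Learner.policy (L : Learner H d W S A) (i : ℕ) (D : Fin i → Episode H W S A) (w : W) :
    Policy H S A where
  kernel h := (L.kernel i h).comap (fun s : S => ((D, w), s)) (by fun_prop)
  markov h := by
    have := L.markov i h
    infer_instance

/-- The truncated value `V̿^π` of the estimated MDP for the context `w` in episode `i + 1`: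
optimistic reward, transition density `⟨φ_h(s, a, w), m_h(s')⟩`, truncation level `3 H`. -/
def plannedValue (M : CMDP H W S A) (ν : Measure S) (φ ψ : Fin H → S × A × W → Vec d) (K : ℕ)
    (γ₁ γ₂ δ : ℝ) {i : ℕ} (D : Fin i → Episode H W S A) (m : Fin H → S → Vec d) (w : W)
    (π : Policy H S A) : ℝ :=
  truncValue ν (3 * H) H (fun h s a => optReward M φ ψ K γ₁ γ₂ δ D h (s, a, w))
    (fun h s a s' => inner ℝ (φ h (s, a, w)) (m h s')) π.kernel M.s₁

/-- The learner runs the model-based UCB algorithm: the policy of the first episode is arbitrary;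
in every later episode `μ̂_h` is a maximum likelihood estimate over the model class, and the policy
for each context maximizes the truncated value of the estimated optimistic MDP. Ties are broken
arbitrarily. -/
structure Learner.RunsUCB (L : Learner H d W S A) (M : CMDP H W S A) (ν : Measure S)
    (φ ψ : Fin H → S × A × W → Vec d) (Ψ : Finset (S → Vec d)) (γ₁ γ₂ δ : ℝ) : Prop where
  mle_mem : ∀ i, 1 ≤ i → ∀ D h, L.muHat i D h ∈ Ψ
  mle_max : ∀ i, 1 ≤ i → ∀ D h, ∀ m ∈ Ψ, logLik φ D h m ≤ logLik φ D h (L.muHat i D h)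
  planning : ∀ i, 1 ≤ i → ∀ D w, ∀ π : Policy H S A,
    plannedValue M ν φ ψ Ψ.card γ₁ γ₂ δ D (L.muHat i D) w π ≤
      plannedValue M ν φ ψ Ψ.card γ₁ γ₂ δ D (L.muHat i D) w (L.policy i D w)

/-- The law of the first `n` episodes: in each episode the context is drawn from `q`,
independently of the past, and the chosen policy is executed in the MDP of that context. -/
def Learner.runLaw (L : Learner H d W S A) (M : CMDP H W S A) :
    (n : ℕ) → Measure (Fin n → Episode H W S A)
  | 0 => Measure.dirac Fin.elim0
  | n + 1 =>
      (L.runLaw M n).bind fun D =>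
        M.q.bind fun w =>
          (M.episodeLaw w (L.policy n D w)).map fun τ =>
            (Fin.snoc D (w, τ) : Fin (n + 1) → Episode H W S A)

/-- The average sub-optimality gap `(1/N) ∑_{n ≤ N} E_{w ∼ q} [V^{π*_w}_{M(w)} - V^{π^n_w}_{M(w)}]`
of the policies chosen along the run `x`. -/
def Learner.avgGap (L : Learner H d W S A) (M : CMDP H W S A) {N : ℕ}
    (x : Fin N → Episode H W S A) : ℝ :=
  (1 / N : ℝ) * ∑ i : Fin N,
    ∫ w, (M.optValue w -
      M.value w (L.policy i (fun j : Fin i => x (j.castLE i.isLt.le)) w)) ∂M.q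

end Algorithm

end CMDPModelI

end

/-
A maximum likelihood estimate explains the data at least as well as the true model, while for every
model `m` in the class the square root of the likelihood ratio of `m` against the truth, multiplied
by the exponential of the accumulated squared Hellinger distances, is a supermartingale. A union
bound over the class therefore bounds the accumulated Hellinger error of the estimate by a
logarithm. The Hellinger error of a linear model controls a quadratic form in the regularized Gram
matrix, so the error of the estimated transitions at a state action pair is a multiple of the
elliptic norm of its feature, which is the exploration bonus. Hence the truncated planned value is
optimistic, and the gap of an episode is at most the expected sum of bonuses along its trajectory
under the true dynamics. By Cauchy–Schwarz it remains to bound the sum of the conditional means of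
the squared elliptic norms: a second exponential supermartingale compares it with the sum of the
observed squared norms, and the elliptical potential lemma bounds the latter.

The sample complexity bound inverts `N ≥ C X log² (2 + X)`: writing `N = t X log² (2 + X)`, the
squared regret bound grows with `t` only like `(1 + log t)² / t`.
-/

namespace CMDPModelI

section History

variable {E : Type*} {n : ℕ}

/-- The part `x₀, …, x_{i-1}` of a sequence that is known before round `i`. -/
def history (x : Fin n → E) (i : Fin n) : Fin i → E :=
  Fin.take i i.isLt.le x

lemma history_snoc_castSucc (x : Fin n → E) (e : E) (i : Fin n) :
    history (Fin.snoc x e : Fin (n + 1) → E) i.castSucc = history x i :=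
  funext fun j => Fin.snoc_castSucc (α := fun _ => E) e x (j.castLE i.isLt.le)

lemma history_snoc_last (x : Fin n → E) (e : E) :
    history (Fin.snoc x e : Fin (n + 1) → E) (Fin.last n) = x :=
  funext fun j => Fin.snoc_castSucc (α := fun _ => E) e x j

lemma measurable_history [MeasurableSpace E] (i : Fin n) :
    Measurable fun x : Fin n → E => history x i := by
  unfold history Fin.take
  fun_prop

end History

section MatrixNorm

open Matrix

variable {d : ℕ} {B B' : Matrix (Fin d) (Fin d) ℝ}

lemma matNorm_nonneg (B : Matrix (Fin d) (Fin d) ℝ) (x : Vec d) : 0 ≤ matNorm B x :=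
  Real.sqrt_nonneg _

lemma matNorm_sq (hB : B.PosSemidef) (x : Vec d) : matNorm B x ^ 2 = x.ofLp ⬝ᵥ B *ᵥ x.ofLp :=
  Real.sq_sqrt (by simpa using hB.dotProduct_mulVec_nonneg x.ofLp)

lemma dotProduct_mulVec_sq_le (hB : B.PosSemidef) (x y : Fin d → ℝ) :
    (x ⬝ᵥ B *ᵥ y) ^ 2 ≤ (x ⬝ᵥ B *ᵥ x) * (y ⬝ᵥ B *ᵥ y) := by
  have hsymm : y ⬝ᵥ B *ᵥ x = x ⬝ᵥ B *ᵥ y := by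
    have hBT : Bᵀ = B := by simpa using hB.isHermitian.eq
    rw [dotProduct_mulVec, ← mulVec_transpose, hBT, dotProduct_comm]
  have h := LinearMap.BilinForm.apply_mul_apply_le_of_forall_zero_le (toBilin' B)
    (fun z => by simpa [toBilin'_apply'] using hB.dotProduct_mulVec_nonneg z) x y
  simpa only [toBilin'_apply', hsymm, ← sq] using h

lemma mulVec_inv_mulVec (hB : B.PosDef) (x : Fin d → ℝ) : B *ᵥ B⁻¹ *ᵥ x = x := by
  rw [mulVec_mulVec, mul_nonsing_inv _ hB.det_pos.ne'.isUnit, one_mulVec]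

lemma matNorm_toLp_inv_mulVec (hB : B.PosDef) (x : Vec d) :
    matNorm B (WithLp.toLp 2 (B⁻¹ *ᵥ x.ofLp)) = matNorm B⁻¹ x := by
  rw [matNorm, matNorm, mulVec_inv_mulVec hB, dotProduct_comm]

lemma abs_inner_le_matNorm_inv_mul (hB : B.PosDef) (x y : Vec d) :
    |inner ℝ x y| ≤ matNorm B⁻¹ x * matNorm B y := by
  have hxy : inner ℝ x y = y.ofLp ⬝ᵥ B *ᵥ B⁻¹ *ᵥ x.ofLp := by
    rw [mulVec_inv_mulVec hB, EuclideanSpace.inner_eq_star_dotProduct, star_trivial]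
  refine abs_le_of_sq_le_sq ?_ (mul_nonneg (matNorm_nonneg _ _) (matNorm_nonneg _ _))
  rw [← matNorm_toLp_inv_mulVec hB, mul_comm, mul_pow, matNorm_sq hB.posSemidef,
    matNorm_sq hB.posSemidef, hxy]
  exact dotProduct_mulVec_sq_le hB.posSemidef _ _

lemma matNorm_mono (h : (B' - B).PosSemidef) (x : Vec d) : matNorm B x ≤ matNorm B' x := by
  have := h.dotProduct_mulVec_nonneg x.ofLp
  rw [star_trivial, sub_mulVec, dotProduct_sub, sub_nonneg] at this
  exact Real.sqrt_le_sqrt this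

lemma matNorm_inv_sq_eq_inner (hB : B.PosDef) (x : Vec d) :
    matNorm B⁻¹ x ^ 2 = inner ℝ x (WithLp.toLp 2 (B⁻¹ *ᵥ x.ofLp)) := by
  rw [matNorm_sq hB.inv.posSemidef, EuclideanSpace.inner_eq_star_dotProduct, star_trivial,
    dotProduct_comm]

lemma matNorm_inv_anti (hB : B.PosDef) (hB' : B'.PosDef) (h : (B' - B).PosSemidef) (x : Vec d) :
    matNorm B'⁻¹ x ≤ matNorm B⁻¹ x := by
  have hsq : matNorm B'⁻¹ x ^ 2 ≤ matNorm B⁻¹ x * matNorm B'⁻¹ x := by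
    set u : Vec d := WithLp.toLp 2 (B'⁻¹ *ᵥ x.ofLp) with hu
    calc matNorm B'⁻¹ x ^ 2 = inner ℝ x u := matNorm_inv_sq_eq_inner hB' x
      _ ≤ matNorm B⁻¹ x * matNorm B u :=
        (le_abs_self _).trans (abs_inner_le_matNorm_inv_mul hB x u)
      _ ≤ matNorm B⁻¹ x * matNorm B' u := by
        gcongr
        · exact matNorm_nonneg _ _
        · exact matNorm_mono h u
      _ = matNorm B⁻¹ x * matNorm B'⁻¹ x := by rw [hu, matNorm_toLp_inv_mulVec hB']
  rcases (matNorm_nonneg B'⁻¹ x).eq_or_lt with h0 | hpos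
  · exact h0 ▸ matNorm_nonneg _ _
  · exact le_of_mul_le_mul_right (by rwa [← sq]) hpos

lemma posDef_smul_one {c : ℝ} (hc : 0 < c) : (c • (1 : Matrix (Fin d) (Fin d) ℝ)).PosDef :=
  PosDef.one.smul hc

lemma matNorm_smul_one_inv {c : ℝ} (hc : 0 < c) (x : Vec d) :
    matNorm (c • (1 : Matrix (Fin d) (Fin d) ℝ))⁻¹ x = ‖x‖ / √c := by
  have hinv : (c • (1 : Matrix (Fin d) (Fin d) ℝ))⁻¹ = c⁻¹ • 1 :=
    inv_eq_left_inv (by simp [hc.ne'])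
  rw [matNorm, hinv, smul_mulVec, one_mulVec, dotProduct_smul, smul_eq_mul,
    Real.sqrt_mul (inv_nonneg.2 hc.le), Real.sqrt_inv, EuclideanSpace.norm_eq, dotProduct,
    inv_mul_eq_div]
  simp only [Real.norm_eq_abs, sq_abs, ← sq]

lemma det_add_vecMulVec_self (hB : B.PosDef) (x : Vec d) :
    (B + vecMulVec x.ofLp x.ofLp).det = B.det * (1 + matNorm B⁻¹ x ^ 2) := by
  have hdot : x.ofLp ᵥ* B⁻¹ ⬝ᵥ x.ofLp = x.ofLp ⬝ᵥ B⁻¹ *ᵥ x.ofLp := (dotProduct_mulVec _ _ _).symm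
  rw [vecMulVec_eq Unit, det_add_replicateCol_mul_replicateRow hB.det_pos.ne'.isUnit,
    matNorm_sq hB.inv.posSemidef, ← hdot, det_unique (n := Unit),
    Matrix.add_apply, one_apply_eq, ← replicateRow_vecMul]
  rfl

lemma log_det_le (hB : B.PosDef) (hd : 0 < d) :
    Real.log B.det ≤ d * Real.log (B.trace / d) := by
  have hd' : (0 : ℝ) < d := Nat.cast_pos.2 hd
  have hpos : ∀ i, 0 < hB.isHermitian.eigenvalues i := hB.eigenvalues_pos
  have hdet : B.det = ∏ i, hB.isHermitian.eigenvalues i := by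
    simpa using hB.isHermitian.det_eq_prod_eigenvalues
  have htrace : B.trace = ∑ i, hB.isHermitian.eigenvalues i := by
    simpa using hB.isHermitian.trace_eq_sum_eigenvalues
  have hjensen := strictConcaveOn_log_Ioi.concaveOn.le_map_sum (t := Finset.univ)
    (w := fun _ : Fin d => (d : ℝ)⁻¹) (p := hB.isHermitian.eigenvalues)
    (fun _ _ => by positivity) (by simp [hd'.ne']) (fun i _ => hpos i)
  simp only [smul_eq_mul, ← Finset.mul_sum, ← htrace] at hjensen
  rw [hdet, Real.log_prod fun i _ => (hpos i).ne', ← inv_mul_le_iff₀ hd', div_eq_inv_mul]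
  exact hjensen

end MatrixNorm

section Gram

open Matrix

variable {n d : ℕ} {c : ℝ}

lemma vecMulVec_self_posSemidef (x : Vec d) : (vecMulVec x.ofLp x.ofLp).PosSemidef := by
  simpa using posSemidef_vecMulVec_self_star x.ofLp

lemma gram_sub_smul_one_posSemidef (v : Fin n → Vec d) (c : ℝ) : (gram v c - c • 1).PosSemidef := by
  rw [gram, add_sub_cancel_right]
  exact posSemidef_sum _ fun τ _ => vecMulVec_self_posSemidef (v τ)

lemma gram_posDef (v : Fin n → Vec d) (hc : 0 < c) : (gram v c).PosDef := by
  simpa using PosDef.posSemidef_add (gram_sub_smul_one_posSemidef v c) (posDef_smul_one hc)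

lemma gram_mulVec (v : Fin n → Vec d) (c : ℝ) (y : Vec d) :
    gram v c *ᵥ y.ofLp = ∑ τ, inner ℝ (v τ) y • (v τ).ofLp + c • y.ofLp := by
  simp only [gram, add_mulVec, sum_mulVec, smul_mulVec, one_mulVec, vecMulVec_mulVec,
    EuclideanSpace.inner_eq_star_dotProduct, star_trivial, op_smul_eq_smul, dotProduct_comm]

lemma matNorm_gram_sq (v : Fin n → Vec d) (hc : 0 < c) (y : Vec d) :
    matNorm (gram v c) y ^ 2 = c * ‖y‖ ^ 2 + ∑ τ, inner ℝ (v τ) y ^ 2 := by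
  have hdot : ∀ a b : Vec d, a.ofLp ⬝ᵥ b.ofLp = inner ℝ b a := fun a b => by
    rw [EuclideanSpace.inner_eq_star_dotProduct, star_trivial]
  rw [matNorm_sq (gram_posDef v hc).posSemidef, gram_mulVec, dotProduct_add, dotProduct_sum,
    add_comm]
  simp only [dotProduct_smul]
  simp only [hdot, smul_eq_mul, real_inner_self_eq_norm_sq, real_inner_comm y, ← sq]

lemma matNorm_gram_inv_le (v : Fin n → Vec d) (hc : 0 < c) (x : Vec d) :
    matNorm (gram v c)⁻¹ x ≤ ‖x‖ / √c :=
  (matNorm_inv_anti (posDef_smul_one hc) (gram_posDef v hc) (gram_sub_smul_one_posSemidef v c)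
    x).trans_eq (matNorm_smul_one_inv hc x)

lemma matNorm_gram_inv_anti (v : Fin n → Vec d) {c' : ℝ} (hc : 0 < c) (h : c ≤ c') (x : Vec d) :
    matNorm (gram v c')⁻¹ x ≤ matNorm (gram v c)⁻¹ x := by
  refine matNorm_inv_anti (gram_posDef v hc) (gram_posDef v (hc.trans_le h)) ?_ x
  rw [gram, gram, add_sub_add_left_eq_sub, ← sub_smul]
  exact PosSemidef.one.smul (sub_nonneg.2 h)

lemma abs_inner_le_mul_matNorm_gram_inv (v : Fin n → Vec d) (hc : 0 < c) (x y : Vec d) {R : ℝ}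
    (hR : 0 ≤ R) (hy : c * ‖y‖ ^ 2 + ∑ τ, inner ℝ (v τ) y ^ 2 ≤ R ^ 2) :
    |inner ℝ x y| ≤ R * matNorm (gram v c)⁻¹ x := by
  have hyR : matNorm (gram v c) y ≤ R :=
    le_of_sq_le_sq ((matNorm_gram_sq v hc y).trans_le hy) hR
  rw [mul_comm]
  exact (abs_inner_le_matNorm_inv_mul (gram_posDef v hc) x y).trans
    (mul_le_mul_of_nonneg_left hyR (matNorm_nonneg _ _))

lemma abs_inner_ridge_sub_le (v : Fin n → Vec d) (hc : 0 < c) (η x : Vec d) :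
    |inner ℝ (WithLp.toLp 2 ((gram v c)⁻¹ *ᵥ ∑ τ, inner ℝ (v τ) η • (v τ).ofLp)) x - inner ℝ x η|
      ≤ √c * ‖η‖ * matNorm (gram v c)⁻¹ x := by
  have hG := gram_posDef v hc
  set u : Vec d := WithLp.toLp 2 ((gram v c)⁻¹ *ᵥ η.ofLp) with hu
  -- `G⁻¹ (∑ v vᵀ) η = η - c G⁻¹ η`, so the estimation error is the bias of the regularizer.
  have hbias : WithLp.toLp 2 ((gram v c)⁻¹ *ᵥ ∑ τ, inner ℝ (v τ) η • (v τ).ofLp) = η - c • u := by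
    rw [eq_sub_of_add_eq (gram_mulVec v c η).symm, mulVec_sub, mulVec_mulVec,
      nonsing_inv_mul _ hG.det_pos.ne'.isUnit, one_mulVec, mulVec_smul]
    rfl
  have hcauchy : |inner ℝ x u| ≤ matNorm (gram v c)⁻¹ x * matNorm (gram v c)⁻¹ η :=
    (abs_inner_le_matNorm_inv_mul hG x u).trans_eq (by rw [hu, matNorm_toLp_inv_mulVec hG])
  have hx := matNorm_nonneg (gram v c)⁻¹ x
  calc |inner ℝ (WithLp.toLp 2 ((gram v c)⁻¹ *ᵥ ∑ τ, inner ℝ (v τ) η • (v τ).ofLp)) x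
        - inner ℝ x η|
      = c * |inner ℝ x u| := by
        rw [hbias, real_inner_comm, inner_sub_right, sub_sub_cancel_left, abs_neg,
          real_inner_smul_right, abs_mul, abs_of_pos hc]
    _ ≤ c * (matNorm (gram v c)⁻¹ x * (‖η‖ / √c)) := by
        gcongr
        exact hcauchy.trans (mul_le_mul_of_nonneg_left (matNorm_gram_inv_le v hc η) hx)
    _ = √c * ‖η‖ * matNorm (gram v c)⁻¹ x := by
        field_simp
        rw [Real.sq_sqrt hc.le]
        ring

lemma gram_trace (v : Fin n → Vec d) (c : ℝ) :
    (gram v c).trace = ∑ τ, ‖v τ‖ ^ 2 + d * c := by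
  simp only [EuclideanSpace.real_norm_sq_eq]
  simp [gram, trace_add, trace_sum, trace_vecMulVec, dotProduct, sq, mul_comm]

lemma log_det_gram_le (v : Fin n → Vec d) (hc : 0 < c) (hd : 0 < d) (hv : ∀ τ, ‖v τ‖ ≤ 1) :
    Real.log (gram v c).det ≤ d * Real.log (c * (1 + n / (d * c))) := by
  have hnorm : ∑ τ, ‖v τ‖ ^ 2 ≤ n :=
    (Finset.sum_le_sum fun τ _ => pow_le_one₀ (norm_nonneg _) (hv τ)).trans_eq (by simp)
  refine (log_det_le (gram_posDef v hc) hd).trans ?_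
  rw [gram_trace]
  gcongr
  calc (∑ τ, ‖v τ‖ ^ 2 + d * c) / d ≤ (n + d * c) / d := by gcongr
    _ = c * (1 + n / (d * c)) := by field_simp; ring

lemma gram_det_succ (v : Fin (n + 1) → Vec d) (hc : 0 < c) :
    (gram v c).det = (gram (history v (Fin.last n)) c).det *
      (1 + matNorm (gram (history v (Fin.last n)) c)⁻¹ (v (Fin.last n)) ^ 2) := by
  have hsplit : gram v c = gram (fun τ : Fin n => v τ.castSucc) c +
      vecMulVec (v (Fin.last n)).ofLp (v (Fin.last n)).ofLp := by
    rw [gram, gram, Fin.sum_univ_castSucc, add_right_comm]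
  rw [hsplit]
  exact det_add_vecMulVec_self (gram_posDef _ hc) _

lemma le_two_mul_log_one_add {x : ℝ} (h0 : 0 ≤ x) (h2 : x ≤ 2) : x ≤ 2 * Real.log (1 + x) := by
  have hlog := Real.le_log_one_add_of_nonneg h0
  have : x / 2 ≤ 2 * x / (x + 2) := by
    rw [div_le_div_iff₀ two_pos (by linarith)]
    nlinarith
  linarith

lemma sum_matNorm_sq_le_log_det (hc : 1 ≤ c) : ∀ {n : ℕ} (v : Fin n → Vec d),
    (∀ τ, ‖v τ‖ ≤ 1) →
    ∑ i, matNorm (gram (history v i) c)⁻¹ (v i) ^ 2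
      ≤ 2 * (Real.log (gram v c).det - d * Real.log c)
  | 0, v, _ => by simp [gram]
  | n + 1, v, hv => by
    have hc0 : 0 < c := one_pos.trans_le hc
    set w : Fin n → Vec d := history v (Fin.last n)
    set z := matNorm (gram w c)⁻¹ (v (Fin.last n))
    have ih : ∑ i : Fin n, matNorm (gram (history v i.castSucc) c)⁻¹ (v i.castSucc) ^ 2
        ≤ 2 * (Real.log (gram w c).det - d * Real.log c) :=
      sum_matNorm_sq_le_log_det hc w fun τ => hv _
    have hz : z ≤ 1 := (matNorm_gram_inv_le w hc0 _).trans
      (div_le_one_of_le₀ ((hv _).trans (Real.one_le_sqrt.2 hc)) (Real.sqrt_nonneg c))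
    have hz2 : z ^ 2 ≤ 1 := pow_le_one₀ (matNorm_nonneg _ _) hz
    have hlog : z ^ 2 ≤ 2 * Real.log (1 + z ^ 2) :=
      le_two_mul_log_one_add (sq_nonneg z) (by linarith)
    rw [Fin.sum_univ_castSucc, gram_det_succ v hc0,
      Real.log_mul (gram_posDef w hc0).det_pos.ne' (by positivity)]
    linarith

lemma elliptical_potential_le (hc : 1 ≤ c) (hd : 0 < d) (v : Fin n → Vec d) (hv : ∀ τ, ‖v τ‖ ≤ 1) :
    ∑ i, matNorm (gram (history v i) c)⁻¹ (v i) ^ 2 ≤ 2 * d * Real.log (1 + n / (d * c)) := by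
  have hc0 : 0 < c := one_pos.trans_le hc
  have hsum := sum_matNorm_sq_le_log_det hc v hv
  have hdet := log_det_gram_le v hc0 hd hv
  rw [Real.log_mul hc0.ne' (by positivity)] at hdet
  linarith

lemma continuous_gram (c : ℝ) : Continuous fun v : Fin n → Vec d => gram v c := by
  refine Continuous.add (continuous_finsetSum _ fun τ _ => ?_) continuous_const
  refine continuous_matrix fun i j => ?_
  simp only [vecMulVec_apply]
  fun_prop

lemma measurable_matNorm_gram_inv (c : ℝ) :
    Measurable fun p : (Fin n → Vec d) × Vec d => matNorm (gram p.1 c)⁻¹ p.2 := by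
  have hdet : Continuous fun p : (Fin n → Vec d) × Vec d => (gram p.1 c).det :=
    ((continuous_gram c).comp continuous_fst).matrix_det
  have hadj : Continuous fun p : (Fin n → Vec d) × Vec d =>
      p.2.ofLp ⬝ᵥ (gram p.1 c).adjugate *ᵥ p.2.ofLp :=
    Continuous.dotProduct (by fun_prop)
      (((continuous_gram c).comp continuous_fst).matrix_adjugate.matrix_mulVec (by fun_prop))
  simp only [matNorm, inv_def, smul_mulVec, dotProduct_smul, smul_eq_mul, Ring.inverse_eq_inv']
  exact (hdet.measurable.inv.mul hadj.measurable).sqrt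

end Gram

section Kernels

variable {X Y Z : Type*} [MeasurableSpace X] [MeasurableSpace Y] [MeasurableSpace Z]

lemma bind_map_eq_map_compProd (μ : Measure X) [SFinite μ] (κ : Kernel X Y) [IsSFiniteKernel κ]
    {f : X × Y → Z} (hf : Measurable f) :
    (μ.bind fun x => (κ x).map fun y => f (x, y)) = (μ ⊗ₘ κ).map f := by
  have hmap : ∀ x, (κ x).map (fun y => f (x, y)) = ((Kernel.id ×ₖ κ).map f) x := fun x => by
    rw [Kernel.map_apply _ hf, Kernel.prod_apply, Kernel.id_apply, Measure.dirac_prod,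
      Measure.map_map hf measurable_prodMk_left]
    rfl
  simp_rw [hmap]
  rw [Measure.compProd_eq_comp_prod]
  exact (Measure.map_comp μ _ hf).symm

end Kernels

section Fin

variable {X E : Type*} [MeasurableSpace X] [MeasurableSpace E] {n : ℕ}

lemma measurable_fin_cons {f : X → E} {g : X → Fin n → E} (hf : Measurable f) (hg : Measurable g) :
    Measurable fun x => (Fin.cons (f x) (g x) : Fin (n + 1) → E) :=
  measurable_pi_iff.2 <| Fin.cases hf (measurable_pi_iff.1 hg)

lemma measurable_fin_snoc {f : X → Fin n → E} {g : X → E} (hf : Measurable f) (hg : Measurable g) :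
    Measurable fun x => (Fin.snoc (f x) (g x) : Fin (n + 1) → E) := by
  refine measurable_pi_iff.2 <| Fin.lastCases ?_ fun i => ?_
  · simpa only [Fin.snoc_last] using hg
  · simpa only [Fin.snoc_castSucc] using measurable_pi_iff.1 hf i

end Fin

lemma abs_sum_traj_le {S A : Type*} {H : ℕ} {f : Fin H → S → A → ℝ} {C : ℝ}
    (hC : ∀ h s a, |f h s a| ≤ C) (τ : Traj H S A) : |∑ h, f h (τ h).1 (τ h).2.1| ≤ H * C :=
  (Finset.abs_sum_le_sum_abs _ _).trans <|
    (Finset.sum_le_sum fun h _ => hC h _ _).trans_eq (by simp)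

section Trajectories

variable {X S A : Type*} [MeasurableSpace X] [MeasurableSpace S] [MeasurableSpace A]

lemma trajLaw_succ {H : ℕ} (P : Fin (H + 1) → Kernel (S × A) S) (π : Fin (H + 1) → Kernel S A)
    [∀ h, IsMarkovKernel (P h)] [∀ h, IsMarkovKernel (π h)] (T : Kernel S (Traj H S A))
    [IsMarkovKernel T] (hT : ∀ s, T s = trajLaw H (fun h => P h.succ) (fun h => π h.succ) s)
    (s : S) :
    trajLaw (H + 1) P π s = (π 0 s ⊗ₘ ((P 0).sectR s ⊗ₖ T.prodMkLeft A)).map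
      fun p => (Fin.cons (s, p.1, p.2.1) p.2.2 : Fin (H + 1) → S × A × S) := by
  have hcons : Measurable fun p : A × S × Traj H S A =>
      (Fin.cons (s, p.1, p.2.1) p.2.2 : Fin (H + 1) → S × A × S) :=
    measurable_fin_cons (by fun_prop) (by fun_prop)
  rw [trajLaw, ← bind_map_eq_map_compProd _ _ hcons]
  refine congrArg _ (funext fun a => ?_)
  rw [Kernel.compProd_apply_eq_compProd_sectR]
  simp_rw [← hT]
  exact bind_map_eq_map_compProd (P 0 (s, a)) T
    (f := fun p => (Fin.cons (s, a, p.1) p.2 : Fin (H + 1) → S × A × S))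
    (measurable_fin_cons (by fun_prop) (by fun_prop))

/-- The law of a trajectory as a kernel: the dynamics and the policy depend measurably on a
parameter, and the source of the kernel is the parameter together with the initial state. -/
noncomputable def trajKernel : (H : ℕ) → (P : Fin H → Kernel (X × S × A) S) →
    (π : Fin H → Kernel (X × S) A) → Kernel (X × S) (Traj H S A)
  | 0, _, _ => Kernel.const _ (Measure.dirac Fin.elim0)
  | H + 1, P, π =>
      (Kernel.id ×ₖ (π 0 ⊗ₖ ((P 0).comap (fun p : (X × S) × A => (p.1.1, p.1.2, p.2))
        (by fun_prop) ⊗ₖ (trajKernel H (fun h => P h.succ) (fun h => π h.succ)).comap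
          (fun p : ((X × S) × A) × S => (p.1.1.1, p.2)) (by fun_prop)))).map
        fun p => (Fin.cons (p.1.2, p.2.1, p.2.2.1) p.2.2.2 : Fin (H + 1) → S × A × S)

variable {H : ℕ}

instance isMarkovKernel_trajKernel : ∀ {H : ℕ} (P : Fin H → Kernel (X × S × A) S)
    (π : Fin H → Kernel (X × S) A) [∀ h, IsMarkovKernel (P h)] [∀ h, IsMarkovKernel (π h)],
    IsMarkovKernel (trajKernel H P π)
  | 0, _, _, _, _ => by unfold trajKernel; infer_instance
  | H + 1, P, π, _, _ => by
    have := isMarkovKernel_trajKernel (fun h => P h.succ) fun h => π h.succ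
    unfold trajKernel
    exact Kernel.IsMarkovKernel.map _ (measurable_fin_cons (by fun_prop) (by fun_prop))

lemma trajKernel_apply : ∀ {H : ℕ} (P : Fin H → Kernel (X × S × A) S)
    (π : Fin H → Kernel (X × S) A) [∀ h, IsMarkovKernel (P h)] [∀ h, IsMarkovKernel (π h)]
    (x : X) (s : S),
    trajKernel H P π (x, s) = trajLaw H (fun h => (P h).sectR x) (fun h => (π h).sectR x) s
  | 0, _, _, _, _, _, _ => rfl
  | H + 1, P, π, _, _, x, s => by
    rw [trajLaw_succ (fun h => (P h).sectR x) (fun h => (π h).sectR x)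
      ((trajKernel H (fun h => P h.succ) fun h => π h.succ).sectR x)
      (fun s' => trajKernel_apply _ _ x s'), trajKernel,
      Kernel.map_apply _ (measurable_fin_cons (by fun_prop) (by fun_prop)), Kernel.prod_apply,
      Kernel.id_apply, Measure.dirac_prod,
      Measure.map_map (measurable_fin_cons (by fun_prop) (by fun_prop)) measurable_prodMk_left,
      Kernel.compProd_apply_eq_compProd_sectR]
    congr 2
    ext1 a
    simp only [Kernel.sectR_apply, Kernel.compProd_apply_eq_compProd_sectR]
    rfl

section

variable (P : Fin H → Kernel (S × A) S) (π : Fin H → Kernel S A) [∀ h, IsMarkovKernel (P h)]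
  [∀ h, IsMarkovKernel (π h)]

lemma measurable_trajLaw : Measurable (trajLaw H P π) := by
  have hker : trajLaw H P π = fun s => trajKernel H (fun h => (P h).prodMkLeft Unit)
      (fun h => (π h).prodMkLeft Unit) ((), s) :=
    funext fun s => (trajKernel_apply (fun h => (P h).prodMkLeft Unit)
      (fun h => (π h).prodMkLeft Unit) () s).symm
  rw [hker]
  exact (Kernel.measurable _).comp measurable_prodMk_left

instance isProbabilityMeasure_trajLaw (s : S) : IsProbabilityMeasure (trajLaw H P π s) := by
  have := (isMarkovKernel_trajKernel (fun h => (P h).prodMkLeft Unit)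
    fun h => (π h).prodMkLeft Unit).isProbabilityMeasure ((), s)
  rwa [trajKernel_apply] at this

/-- `trajLaw` as a kernel in the initial state. -/
noncomputable def trajLawKernel : Kernel S (Traj H S A) where
  toFun := trajLaw H P π
  measurable' := measurable_trajLaw P π

instance : IsMarkovKernel (trajLawKernel P π) := ⟨isProbabilityMeasure_trajLaw P π⟩

end

variable {f : Fin H → S → A → ℝ} {C : ℝ}

lemma lintegral_trajLaw_succ (P : Fin (H + 1) → Kernel (S × A) S) (π : Fin (H + 1) → Kernel S A)
    [∀ h, IsMarkovKernel (P h)] [∀ h, IsMarkovKernel (π h)] (s : S)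
    {F : Traj (H + 1) S A → ℝ≥0∞} (hF : Measurable F) :
    ∫⁻ τ, F τ ∂(trajLaw (H + 1) P π s) = ∫⁻ a, ∫⁻ s', ∫⁻ τ, F (Fin.cons (s, a, s') τ)
      ∂(trajLaw H (fun h => P h.succ) (fun h => π h.succ) s') ∂(P 0 (s, a)) ∂(π 0 s) := by
  have hcons : Measurable fun p : A × S × Traj H S A =>
      (Fin.cons (s, p.1, p.2.1) p.2.2 : Fin (H + 1) → S × A × S) :=
    measurable_fin_cons (by fun_prop) (by fun_prop)
  have hFc : Measurable fun p : A × S × Traj H S A => F (Fin.cons (s, p.1, p.2.1) p.2.2) :=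
    hF.comp hcons
  rw [trajLaw_succ P π (trajLawKernel (fun h => P h.succ) fun h => π h.succ) (fun _ => rfl),
    lintegral_map hF hcons, Measure.lintegral_compProd hFc]
  refine lintegral_congr fun a => ?_
  exact Kernel.lintegral_compProd _ _ _ (hFc.comp measurable_prodMk_left)

lemma integral_trajLaw_succ (P : Fin (H + 1) → Kernel (S × A) S) (π : Fin (H + 1) → Kernel S A)
    [∀ h, IsMarkovKernel (P h)] [∀ h, IsMarkovKernel (π h)] (s : S)
    {F : Traj (H + 1) S A → ℝ} (hF : Measurable F) (hC : ∀ τ, |F τ| ≤ C) :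
    ∫ τ, F τ ∂(trajLaw (H + 1) P π s) = ∫ a, ∫ s', ∫ τ, F (Fin.cons (s, a, s') τ)
      ∂(trajLaw H (fun h => P h.succ) (fun h => π h.succ) s') ∂(P 0 (s, a)) ∂(π 0 s) := by
  have hcons : Measurable fun p : A × S × Traj H S A =>
      (Fin.cons (s, p.1, p.2.1) p.2.2 : Fin (H + 1) → S × A × S) :=
    measurable_fin_cons (by fun_prop) (by fun_prop)
  have hFc : Measurable fun p : A × S × Traj H S A => F (Fin.cons (s, p.1, p.2.1) p.2.2) :=
    hF.comp hcons
  rw [trajLaw_succ P π (trajLawKernel (fun h => P h.succ) fun h => π h.succ) (fun _ => rfl),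
    integral_map hcons.aemeasurable hF.aestronglyMeasurable, Measure.integral_compProd
      (Integrable.of_bound hFc.aestronglyMeasurable C (ae_of_all _ fun _ => hC _))]
  refine integral_congr_ae (ae_of_all _ fun a => ?_)
  exact integral_compProd (Integrable.of_bound
    (hFc.comp measurable_prodMk_left).aestronglyMeasurable C (ae_of_all _ fun _ => hC _))

lemma lintegral_trajLaw_step_le_one : ∀ {H : ℕ} (P : Fin H → Kernel (S × A) S)
    (π : Fin H → Kernel S A) [∀ h, IsMarkovKernel (P h)] [∀ h, IsMarkovKernel (π h)] (s : S)
    (h : Fin H) {f : S × A × S → ℝ≥0∞} (_ : Measurable f)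
    (_ : ∀ s a, ∫⁻ s', f (s, a, s') ∂(P h (s, a)) ≤ 1),
    ∫⁻ τ, f (τ h) ∂(trajLaw H P π s) ≤ 1
  | 0, _, _, _, _, _, h, _, _, _ => h.elim0
  | H + 1, P, π, _, _, s, h, f, hf, hle => by
    rw [lintegral_trajLaw_succ P π s (F := fun τ => f (τ h)) (hf.comp (measurable_pi_apply h))]
    refine lintegral_le_const (ae_of_all _ fun a => ?_)
    cases h using Fin.cases with
    | zero => simpa using hle s a
    | succ j =>
      refine lintegral_le_const (ae_of_all _ fun s' => ?_)
      exact lintegral_trajLaw_step_le_one (fun h => P h.succ) (fun h => π h.succ) s' j hf hle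

/-- The expected sum of `f h (s_h, a_h)` along a trajectory; for the rewards this is the value of
the policy. -/
noncomputable def expSum (P : Fin H → Kernel (S × A) S) (π : Fin H → Kernel S A)
    (f : Fin H → S → A → ℝ) (s : S) : ℝ :=
  ∫ τ, ∑ h, f h (τ h).1 (τ h).2.1 ∂(trajLaw H P π s)

lemma measurable_sum_traj (hf : ∀ h, Measurable (Function.uncurry (f h))) :
    Measurable fun τ : Traj H S A => ∑ h, f h (τ h).1 (τ h).2.1 :=
  Finset.measurable_sum _ fun h _ => (hf h).comp (f := fun τ : Traj H S A => ((τ h).1, (τ h).2.1))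
    (by fun_prop)

section

variable (P : Fin H → Kernel (S × A) S) (π : Fin H → Kernel S A) [∀ h, IsMarkovKernel (P h)]
  [∀ h, IsMarkovKernel (π h)]

lemma integrable_sum_traj (hf : ∀ h, Measurable (Function.uncurry (f h)))
    (hC : ∀ h s a, |f h s a| ≤ C) (s : S) :
    Integrable (fun τ : Traj H S A => ∑ h, f h (τ h).1 (τ h).2.1) (trajLaw H P π s) :=
  Integrable.of_bound (measurable_sum_traj hf).aestronglyMeasurable (H * C)
    (ae_of_all _ (abs_sum_traj_le hC))

lemma abs_expSum_le (hC : ∀ h s a, |f h s a| ≤ C) (s : S) : |expSum P π f s| ≤ H * C := by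
  have h := norm_integral_le_of_norm_le_const (μ := trajLaw H P π s) (ae_of_all _ fun τ =>
    (Real.norm_eq_abs _).trans_le (abs_sum_traj_le hC τ))
  rwa [probReal_univ, mul_one] at h

lemma measurable_expSum (hf : ∀ h, Measurable (Function.uncurry (f h))) :
    Measurable (expSum P π f) :=
  (StronglyMeasurable.integral_kernel_prod_right' (κ := trajLawKernel P π)
    ((measurable_sum_traj hf).comp measurable_snd).stronglyMeasurable).measurable

end

lemma expSum_succ (P : Fin (H + 1) → Kernel (S × A) S) (π : Fin (H + 1) → Kernel S A)
    [∀ h, IsMarkovKernel (P h)] [∀ h, IsMarkovKernel (π h)] {f : Fin (H + 1) → S → A → ℝ}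
    (hf : ∀ h, Measurable (Function.uncurry (f h))) (hC : ∀ h s a, |f h s a| ≤ C) (s : S) :
    expSum P π f s = ∫ a, (f 0 s a + ∫ s', expSum (fun h => P h.succ) (fun h => π h.succ)
      (fun h => f h.succ) s' ∂(P 0 (s, a))) ∂(π 0 s) := by
  have hC' : ∀ (h : Fin H) s a, |f h.succ s a| ≤ C := fun h => hC _
  have htail : ∀ a s', ∫ τ, (f 0 s a + ∑ h : Fin H, f h.succ (τ h).1 (τ h).2.1)
      ∂(trajLaw H (fun h => P h.succ) (fun h => π h.succ) s') =
      f 0 s a + expSum (fun h => P h.succ) (fun h => π h.succ) (fun h => f h.succ) s' :=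
    fun a s' => by
      rw [integral_add (integrable_const _)
        (integrable_sum_traj _ _ (fun h => hf h.succ) hC' s')]
      simp [expSum]
  have hint : ∀ a, Integrable (expSum (fun h => P h.succ) (fun h => π h.succ) fun h => f h.succ)
      (P 0 (s, a)) := fun a =>
    Integrable.of_bound (measurable_expSum _ _ fun h => hf h.succ).aestronglyMeasurable (H * C)
      (ae_of_all _ (abs_expSum_le _ _ hC'))
  rw [expSum, integral_trajLaw_succ P π s (measurable_sum_traj hf) (abs_sum_traj_le hC)]
  refine integral_congr_ae (ae_of_all _ fun a => ?_)
  simp only [Fin.sum_univ_succ, Fin.cons_zero, Fin.cons_succ, htail]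
  rw [integral_add (integrable_const _) (hint a)]
  simp

end Trajectories

section SequentialLaw

variable {E : Type*} [MeasurableSpace E] {κ : (n : ℕ) → Kernel (Fin n → E) E}

/-- The law of the first `n` observations of a process in which the law of each observation given
the past is prescribed by `κ`. -/
noncomputable def seqLaw (κ : (n : ℕ) → Kernel (Fin n → E) E) : (n : ℕ) → Measure (Fin n → E)
  | 0 => Measure.dirac Fin.elim0
  | n + 1 => (seqLaw κ n ⊗ₘ κ n).map fun p => (Fin.snoc p.1 p.2 : Fin (n + 1) → E)

instance isProbabilityMeasure_seqLaw [∀ n, IsMarkovKernel (κ n)] :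
    ∀ n, IsProbabilityMeasure (seqLaw κ n)
  | 0 => by unfold seqLaw; infer_instance
  | n + 1 => by
    have := isProbabilityMeasure_seqLaw n
    unfold seqLaw
    exact Measure.isProbabilityMeasure_map
      (measurable_fin_snoc measurable_fst measurable_snd).aemeasurable

lemma measurable_prod_history {g : (n : ℕ) → (Fin n → E) → E → ℝ≥0∞}
    (hg : ∀ n, Measurable (Function.uncurry (g n))) (N : ℕ) :
    Measurable fun x : Fin N → E => ∏ i : Fin N, g i (history x i) (x i) :=
  Finset.measurable_prod _ fun i _ => (hg i).comp
    (f := fun x : Fin N → E => (history x i, x i))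
    ((measurable_history i).prodMk (measurable_pi_apply i))

lemma ae_seqLaw_forall {p : E → Prop} (hp : MeasurableSet {e | p e})
    (hκ : ∀ n x, ∀ᵐ e ∂(κ n x), p e) : ∀ N, ∀ᵐ x ∂(seqLaw κ N), ∀ i, p (x i)
  | 0 => ae_of_all _ fun _ i => i.elim0
  | N + 1 => by
    have hsnoc : Measurable fun y : (Fin N → E) × E => (Fin.snoc y.1 y.2 : Fin (N + 1) → E) :=
      measurable_fin_snoc measurable_fst measurable_snd
    have hset : MeasurableSet {x : Fin (N + 1) → E | ∀ i, p (x i)} := by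
      simp_rw [Set.ofPred_forall]
      exact MeasurableSet.iInter fun i => measurable_pi_apply i hp
    rw [seqLaw, ae_map_iff hsnoc.aemeasurable hset]
    refine Measure.ae_compProd_of_ae_ae (hsnoc hset) ?_
    filter_upwards [ae_seqLaw_forall hp hκ N] with x hx
    filter_upwards [hκ N x] with e he
    exact Fin.lastCases (by simpa using he) fun i => by simpa using hx i

variable [∀ n, IsMarkovKernel (κ n)]

lemma lintegral_seqLaw_succ (n : ℕ) {F : (Fin (n + 1) → E) → ℝ≥0∞} (hF : Measurable F) :
    ∫⁻ x, F x ∂(seqLaw κ (n + 1)) =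
      ∫⁻ x, ∫⁻ e, F (Fin.snoc x e) ∂(κ n x) ∂(seqLaw κ n) := by
  have hsnoc : Measurable fun p : (Fin n → E) × E => (Fin.snoc p.1 p.2 : Fin (n + 1) → E) :=
    measurable_fin_snoc measurable_fst measurable_snd
  rw [seqLaw, lintegral_map hF hsnoc]
  exact Measure.lintegral_compProd (hF.comp hsnoc)

section Supermartingale

variable {g : (n : ℕ) → (Fin n → E) → E → ℝ≥0∞}

lemma lintegral_prod_history_le_one (hg : ∀ n, Measurable (Function.uncurry (g n)))
    (hle : ∀ n x, ∫⁻ e, g n x e ∂(κ n x) ≤ 1) : ∀ N : ℕ,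
    ∫⁻ x, ∏ i : Fin N, g i (history x i) (x i) ∂(seqLaw κ N) ≤ 1
  | 0 => by simp
  | N + 1 => by
    have hsnoc : ∀ (x : Fin N → E) e,
        ∏ i : Fin (N + 1), g i (history (Fin.snoc x e : Fin (N + 1) → E) i)
          ((Fin.snoc x e : Fin (N + 1) → E) i) =
        (∏ i : Fin N, g i (history x i) (x i)) * g N x e := fun x e => by
      rw [Fin.prod_univ_castSucc]
      simp only [history_snoc_castSucc, history_snoc_last, Fin.snoc_castSucc, Fin.snoc_last]
      rfl
    rw [lintegral_seqLaw_succ N (measurable_prod_history hg (N + 1))]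
    refine (lintegral_mono fun x => ?_).trans (lintegral_prod_history_le_one hg hle N)
    simp only [hsnoc]
    rw [lintegral_const_mul (f := g N x) _ ((hg N).comp measurable_prodMk_left)]
    exact mul_le_of_le_one_right' (hle N x)

lemma measure_prod_history_ge_le (hg : ∀ n, Measurable (Function.uncurry (g n)))
    (hle : ∀ n x, ∫⁻ e, g n x e ∂(κ n x) ≤ 1) (N : ℕ) (t : ℝ) :
    seqLaw κ N {x | ENNReal.ofReal (Real.exp t) ≤ ∏ i : Fin N, g i (history x i) (x i)} ≤
      ENNReal.ofReal (Real.exp (-t)) := by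
  have hmarkov := (mul_meas_ge_le_lintegral (μ := seqLaw κ N) (measurable_prod_history hg N)
    (ENNReal.ofReal (Real.exp t))).trans (lintegral_prod_history_le_one hg hle N)
  rwa [Real.exp_neg, ENNReal.ofReal_inv_of_pos (Real.exp_pos t), ENNReal.le_inv_iff_mul_le,
    mul_comm]

end Supermartingale

lemma exp_neg_le_one_sub_half {x : ℝ} (h0 : 0 ≤ x) (h1 : x ≤ 1) : Real.exp (-x) ≤ 1 - x / 2 := by
  rw [Real.exp_neg, inv_le_iff_one_le_mul₀ (Real.exp_pos _)]
  have hexp := Real.quadratic_le_exp_of_nonneg h0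
  have hhalf : 0 ≤ 1 - x / 2 := by linarith
  nlinarith [mul_le_mul_of_nonneg_left hexp hhalf, mul_nonneg h0 (sub_nonneg.2 h1),
    mul_nonneg (mul_nonneg h0 h0) (sub_nonneg.2 h1)]

lemma lintegral_exp_half_integral_sub_le_one {Ω : Type*} [MeasurableSpace Ω] (P : Measure Ω)
    [IsProbabilityMeasure P] {Z : Ω → ℝ} (hZ : Measurable Z) (hZ01 : ∀ ω, Z ω ∈ Set.Icc 0 1) :
    ∫⁻ ω, ENNReal.ofReal (Real.exp ((∫ ω', Z ω' ∂P) / 2 - Z ω)) ∂P ≤ 1 := by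
  set m := ∫ ω', Z ω' ∂P
  have hint : Integrable Z P := Integrable.of_bound hZ.aestronglyMeasurable 1 <|
    ae_of_all _ fun ω => abs_le.2 ⟨by linarith [(hZ01 ω).1], (hZ01 ω).2⟩
  have hpt : ∀ ω, Real.exp (m / 2 - Z ω) ≤ Real.exp (m / 2) * (1 - Z ω / 2) := fun ω => by
    rw [sub_eq_add_neg, Real.exp_add]
    gcongr
    exact exp_neg_le_one_sub_half (hZ01 ω).1 (hZ01 ω).2
  have hint' : Integrable (fun ω => Real.exp (m / 2) * (1 - Z ω / 2)) P :=
    ((integrable_const _).sub (hint.div_const 2)).const_mul _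
  refine (lintegral_mono fun ω => ENNReal.ofReal_le_ofReal (hpt ω)).trans ?_
  rw [← ofReal_integral_eq_lintegral_ofReal hint' (ae_of_all _ fun ω =>
    (Real.exp_pos _).le.trans (hpt ω)), integral_const_mul,
    integral_sub (integrable_const _) (hint.div_const 2), integral_div, ENNReal.ofReal_le_one]
  have hm : 1 - m / 2 ≤ Real.exp (-(m / 2)) := by linarith [Real.add_one_le_exp (-(m / 2))]
  calc Real.exp (m / 2) * (∫ _, (1 : ℝ) ∂P - m / 2)
      ≤ Real.exp (m / 2) * Real.exp (-(m / 2)) := by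
        gcongr
        simpa using hm
    _ = 1 := by rw [← Real.exp_add, add_neg_cancel, Real.exp_zero]

lemma measure_sum_integral_gt_le {Z : (n : ℕ) → (Fin n → E) → E → ℝ}
    (hZ : ∀ n, Measurable (Function.uncurry (Z n)))
    (hZ01 : ∀ n x e, Z n x e ∈ Set.Icc (0 : ℝ) 1) (N : ℕ) (t : ℝ) :
    seqLaw κ N {x | 2 * (∑ i : Fin N, Z i (history x i) (x i) + t) <
        ∑ i : Fin N, ∫ e, Z i (history x i) e ∂(κ i (history x i))} ≤
      ENNReal.ofReal (Real.exp (-t)) := by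
  have hm : ∀ n, Measurable fun x => ∫ e, Z n x e ∂(κ n x) := fun n =>
    (StronglyMeasurable.integral_kernel_prod_right' (κ := κ n) (hZ n).stronglyMeasurable).measurable
  have hg : ∀ n, Measurable (Function.uncurry fun x e =>
      ENNReal.ofReal (Real.exp ((∫ e', Z n x e' ∂(κ n x)) / 2 - Z n x e))) := fun n =>
    ((((hm n).comp measurable_fst).div_const 2).sub (hZ n)).exp.ennreal_ofReal
  refine (measure_mono fun x hx => ?_).trans (measure_prod_history_ge_le hg
    (fun n x => lintegral_exp_half_integral_sub_le_one _ ((hZ n).comp measurable_prodMk_left)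
      (hZ01 n x)) N t)
  rw [Set.mem_ofPred_eq] at hx ⊢
  rw [← ENNReal.ofReal_prod_of_nonneg fun _ _ => (Real.exp_pos _).le, ← Real.exp_sum]
  refine ENNReal.ofReal_le_ofReal (Real.exp_le_exp.2 ?_)
  rw [Finset.sum_sub_distrib, ← Finset.sum_div]
  linarith

end SequentialLaw

section Run

variable {H d : ℕ} {W S A : Type*} [MeasurableSpace W] [MeasurableSpace S] [MeasurableSpace A]
  (M : CMDP H W S A) (L : Learner H d W S A) (n : ℕ)

instance : IsProbabilityMeasure M.q := M.q_prob

instance (h : Fin H) : IsMarkovKernel (M.P h) := M.P_markov h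

instance (w : W) (h : Fin H) : IsMarkovKernel (M.transAt w h) := by
  unfold CMDP.transAt; infer_instance

instance (π : Policy H S A) (h : Fin H) : IsMarkovKernel (π.kernel h) := π.markov h

instance (h : Fin H) : IsMarkovKernel (L.kernel n h) := L.markov n h

instance (w : W) (π : Policy H S A) : IsProbabilityMeasure (M.episodeLaw w π) := by
  unfold CMDP.episodeLaw; infer_instance

/-- The law of the trajectory of episode `n + 1`, given the data of the first `n` episodes and the
context. -/
noncomputable def Learner.episodeKernel : Kernel ((Fin n → Episode H W S A) × W) (Traj H S A) :=
  (trajKernel H (fun h => (M.P h).comap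
    (fun p : ((Fin n → Episode H W S A) × W) × S × A => (p.2.1, p.2.2, p.1.2)) (by fun_prop))
    (L.kernel n)).comap (fun p => (p, M.s₁)) (by fun_prop)

instance : IsMarkovKernel (L.episodeKernel M n) := by
  unfold Learner.episodeKernel; infer_instance

lemma Learner.episodeKernel_apply (D : Fin n → Episode H W S A) (w : W) :
    L.episodeKernel M n (D, w) = M.episodeLaw w (L.policy n D w) :=
  trajKernel_apply _ _ _ _

/-- The law of episode `n + 1` given the data of the first `n` episodes. -/
noncomputable def Learner.stepKernel : Kernel (Fin n → Episode H W S A) (Episode H W S A) :=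
  Kernel.const _ M.q ⊗ₖ L.episodeKernel M n

instance : IsMarkovKernel (L.stepKernel M n) := by
  unfold Learner.stepKernel; infer_instance

lemma Learner.lintegral_stepKernel (D : Fin n → Episode H W S A) {F : Episode H W S A → ℝ≥0∞}
    (hF : Measurable F) :
    ∫⁻ e, F e ∂(L.stepKernel M n D) =
      ∫⁻ w, ∫⁻ τ, F (w, τ) ∂(M.episodeLaw w (L.policy n D w)) ∂M.q := by
  simp_rw [← L.episodeKernel_apply]
  exact Kernel.lintegral_compProd _ _ _ hF

lemma Learner.integral_stepKernel (D : Fin n → Episode H W S A) {F : Episode H W S A → ℝ}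
    (hF : Measurable F) {C : ℝ} (hC : ∀ e, |F e| ≤ C) :
    ∫ e, F e ∂(L.stepKernel M n D) =
      ∫ w, ∫ τ, F (w, τ) ∂(M.episodeLaw w (L.policy n D w)) ∂M.q := by
  simp_rw [← L.episodeKernel_apply]
  exact integral_compProd (Integrable.of_bound hF.aestronglyMeasurable C (ae_of_all _ hC))

lemma Learner.measurable_integral_episodeLaw (D : Fin n → Episode H W S A)
    {F : Episode H W S A → ℝ} (hF : Measurable F) :
    Measurable fun w => ∫ τ, F (w, τ) ∂(M.episodeLaw w (L.policy n D w)) := by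
  simp_rw [← L.episodeKernel_apply]
  exact (StronglyMeasurable.integral_kernel_prod_right' (κ := (L.episodeKernel M n).sectR D)
    hF.stronglyMeasurable).measurable

lemma Learner.runLaw_eq_seqLaw : ∀ n, L.runLaw M n = seqLaw (L.stepKernel M) n
  | 0 => rfl
  | n + 1 => by
    have hsnoc : Measurable fun p : (Fin n → Episode H W S A) × Episode H W S A =>
        (Fin.snoc p.1 p.2 : Fin (n + 1) → Episode H W S A) :=
      measurable_fin_snoc measurable_fst measurable_snd
    rw [runLaw, runLaw_eq_seqLaw n, seqLaw, ← bind_map_eq_map_compProd _ _ hsnoc]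
    refine congrArg _ (funext fun D => ?_)
    rw [stepKernel, Kernel.compProd_apply_eq_compProd_sectR, Kernel.const_apply]
    simp_rw [← L.episodeKernel_apply]
    exact bind_map_eq_map_compProd M.q ((L.episodeKernel M n).sectR D)
      (hsnoc.comp measurable_prodMk_left)

instance : IsProbabilityMeasure (L.runLaw M n) := by
  rw [L.runLaw_eq_seqLaw]
  infer_instance

end Run

section Densities

variable {S : Type*} [MeasurableSpace S] {ν : Measure S} {p q : S → ℝ}

lemma sq_integral_mul_le {f g : S → ℝ} (hf0 : 0 ≤ f) (hg0 : 0 ≤ g) (hf : MemLp f 2 ν)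
    (hg : MemLp g 2 ν) : (∫ s, f s * g s ∂ν) ^ 2 ≤ (∫ s, f s ^ 2 ∂ν) * ∫ s, g s ^ 2 ∂ν := by
  have hHolder := integral_mul_le_Lp_mul_Lq_of_nonneg Real.HolderConjugate.two_two
    (ae_of_all ν hf0) (ae_of_all ν hg0) (by simpa using hf) (by simpa using hg)
  simp only [Real.rpow_ofNat, ← Real.sqrt_eq_rpow] at hHolder
  have hnonneg : 0 ≤ ∫ s, f s * g s ∂ν := integral_nonneg fun s => mul_nonneg (hf0 s) (hg0 s)
  refine (pow_le_pow_left₀ hnonneg hHolder 2).trans_eq ?_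
  rw [mul_pow, Real.sq_sqrt (integral_nonneg fun s => sq_nonneg _),
    Real.sq_sqrt (integral_nonneg fun s => sq_nonneg _)]

/-- A probability density with respect to `ν`, everywhere nonnegative. -/
structure IsDensity (ν : Measure S) (p : S → ℝ) : Prop where
  measurable : Measurable p
  nonneg : ∀ s, 0 ≤ p s
  integrable : Integrable p ν
  integral_eq_one : ∫ s, p s ∂ν = 1

/-- The squared Hellinger distance of two densities, normalized as `1 - ∫ √(p q) dν`. -/
noncomputable def hellingerSq (ν : Measure S) (p q : S → ℝ) : ℝ :=
  1 - ∫ s, √(p s) * √(q s) ∂ν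

namespace IsDensity

lemma memLp_sqrt (hp : IsDensity ν p) : MemLp (fun s => √(p s)) 2 ν := by
  rw [memLp_two_iff_integrable_sq hp.measurable.sqrt.aestronglyMeasurable]
  simpa only [Real.sq_sqrt (hp.nonneg _)] using hp.integrable

lemma integral_sqrt_sub_sqrt_sq (hp : IsDensity ν p) (hq : IsDensity ν q) :
    ∫ s, (√(p s) - √(q s)) ^ 2 ∂ν = 2 * hellingerSq ν p q := by
  have hpq : Integrable (fun s => √(p s) * √(q s)) ν := hp.memLp_sqrt.integrable_mul hq.memLp_sqrt
  have hexpand : ∀ s, (√(p s) - √(q s)) ^ 2 = p s + q s - 2 * (√(p s) * √(q s)) := fun s => by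
    rw [sub_sq, Real.sq_sqrt (hp.nonneg s), Real.sq_sqrt (hq.nonneg s)]
    ring
  have hsum : Integrable (fun s => p s + q s) ν := hp.integrable.add hq.integrable
  simp_rw [hexpand]
  rw [integral_sub hsum (hpq.const_mul 2),
    integral_add hp.integrable hq.integrable, integral_const_mul, hp.integral_eq_one,
    hq.integral_eq_one, hellingerSq]
  ring

lemma hellingerSq_nonneg (hp : IsDensity ν p) (hq : IsDensity ν q) : 0 ≤ hellingerSq ν p q := by
  have hint : 0 ≤ ∫ s, (√(p s) - √(q s)) ^ 2 ∂ν := integral_nonneg fun s => sq_nonneg _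
  linarith [hp.integral_sqrt_sub_sqrt_sq hq]

lemma integral_sqrt_add_sqrt_sq_le (hp : IsDensity ν p) (hq : IsDensity ν q) :
    ∫ s, (√(p s) + √(q s)) ^ 2 ∂ν ≤ 4 := by
  calc ∫ s, (√(p s) + √(q s)) ^ 2 ∂ν ≤ ∫ s, 2 * (p s + q s) ∂ν := by
        refine integral_mono (hp.memLp_sqrt.add hq.memLp_sqrt).integrable_sq
          ((hp.integrable.add hq.integrable).const_mul 2) fun s => ?_
        simpa only [Real.sq_sqrt (hp.nonneg s), Real.sq_sqrt (hq.nonneg s)] using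
          add_sq_le (a := √(p s)) (b := √(q s))
    _ = 4 := by
        rw [integral_const_mul, integral_add hp.integrable hq.integrable, hp.integral_eq_one,
          hq.integral_eq_one]
        norm_num

lemma integral_abs_sub_sq_le (hp : IsDensity ν p) (hq : IsDensity ν q) :
    (∫ s, |p s - q s| ∂ν) ^ 2 ≤ 8 * hellingerSq ν p q := by
  have hfactor : ∀ s, |p s - q s| = |√(p s) - √(q s)| * (√(p s) + √(q s)) := fun s => by
    rw [← abs_of_nonneg (add_nonneg (Real.sqrt_nonneg (p s)) (Real.sqrt_nonneg (q s))), ← abs_mul,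
      mul_comm, ← sq_sub_sq, Real.sq_sqrt (hp.nonneg s), Real.sq_sqrt (hq.nonneg s)]
  simp_rw [hfactor]
  calc (∫ s, |√(p s) - √(q s)| * (√(p s) + √(q s)) ∂ν) ^ 2
      ≤ (∫ s, |√(p s) - √(q s)| ^ 2 ∂ν) * ∫ s, (√(p s) + √(q s)) ^ 2 ∂ν :=
        sq_integral_mul_le (fun _ => abs_nonneg _)
          (fun _ => add_nonneg (Real.sqrt_nonneg _) (Real.sqrt_nonneg _))
          (hp.memLp_sqrt.sub hq.memLp_sqrt).abs (hp.memLp_sqrt.add hq.memLp_sqrt)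
    _ ≤ (∫ s, |√(p s) - √(q s)| ^ 2 ∂ν) * 4 := by
        gcongr
        exact hp.integral_sqrt_add_sqrt_sq_le hq
    _ = 8 * hellingerSq ν p q := by
        simp_rw [sq_abs]
        rw [hp.integral_sqrt_sub_sqrt_sq hq]
        ring

lemma integral_sub_mul_sq_le (hp : IsDensity ν p) (hq : IsDensity ν q) {V : S → ℝ} {B : ℝ}
    (hV : ∀ s, |V s| ≤ B) :
    (∫ s, (p s - q s) * V s ∂ν) ^ 2 ≤ B ^ 2 * (8 * hellingerSq ν p q) := by
  have habs : |∫ s, (p s - q s) * V s ∂ν| ≤ B * ∫ s, |p s - q s| ∂ν := by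
    rw [← Real.norm_eq_abs, ← integral_const_mul]
    refine norm_integral_le_of_norm_le ((hp.integrable.sub hq.integrable).abs.const_mul B)
      (ae_of_all _ fun s => ?_)
    rw [norm_mul, Real.norm_eq_abs, Real.norm_eq_abs, mul_comm]
    exact mul_le_mul_of_nonneg_right (hV s) (abs_nonneg _)
  calc (∫ s, (p s - q s) * V s ∂ν) ^ 2 = |∫ s, (p s - q s) * V s ∂ν| ^ 2 := (sq_abs _).symm
    _ ≤ (B * ∫ s, |p s - q s| ∂ν) ^ 2 := by gcongr
    _ = B ^ 2 * (∫ s, |p s - q s| ∂ν) ^ 2 := mul_pow _ _ _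
    _ ≤ B ^ 2 * (8 * hellingerSq ν p q) := by gcongr; exact hp.integral_abs_sub_sq_le hq

lemma ae_withDensity_pos (hp : IsDensity ν p) :
    ∀ᵐ s ∂(ν.withDensity fun s => ENNReal.ofReal (p s)), 0 < p s := by
  rw [ae_withDensity_iff hp.measurable.ennreal_ofReal]
  exact ae_of_all _ fun s hs => by simpa using hs

lemma lintegral_sqrt_likelihood_ratio_le_one (hp : IsDensity ν p) (hq : IsDensity ν q) :
    ∫⁻ s, ENNReal.ofReal (√(q s / p s) * Real.exp (hellingerSq ν p q))
      ∂(ν.withDensity fun s => ENNReal.ofReal (p s)) ≤ 1 := by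
  set c := hellingerSq ν p q with hc
  have hpq : Integrable (fun s => √(p s) * √(q s) * Real.exp c) ν :=
    (hp.memLp_sqrt.integrable_mul hq.memLp_sqrt).mul_const _
  have hle : ∀ s, p s * (√(q s / p s) * Real.exp c) = √(p s) * √(q s) * Real.exp c := fun s => by
    rw [← mul_assoc, Real.sqrt_div (hq.nonneg s), mul_div_left_comm, Real.div_sqrt, mul_comm √(q s)]
  have hmeas : Measurable fun s => ENNReal.ofReal (√(q s / p s) * Real.exp c) :=
    ((hq.measurable.div hp.measurable).sqrt.mul_const _).ennreal_ofReal
  calc ∫⁻ s, ENNReal.ofReal (√(q s / p s) * Real.exp c)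
        ∂(ν.withDensity fun s => ENNReal.ofReal (p s))
      = ∫⁻ s, ENNReal.ofReal (√(p s) * √(q s) * Real.exp c) ∂ν := by
        rw [lintegral_withDensity_eq_lintegral_mul _ hp.measurable.ennreal_ofReal hmeas]
        simp only [Pi.mul_apply, ← ENNReal.ofReal_mul (hp.nonneg _), hle]
    _ = ENNReal.ofReal ((1 - c) * Real.exp c) := by
        rw [← ofReal_integral_eq_lintegral_ofReal hpq (ae_of_all _ fun s => by positivity),
          integral_mul_const, hc, hellingerSq, sub_sub_cancel]
    _ ≤ ENNReal.ofReal (Real.exp (-c) * Real.exp c) := by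
        gcongr
        linarith [Real.add_one_le_exp (-c)]
    _ = 1 := by rw [← Real.exp_add, neg_add_cancel, Real.exp_zero, ENNReal.ofReal_one]

end IsDensity

end Densities

section Weights

variable {d : ℕ} {W S A : Type*} [MeasurableSpace S] {ν : Measure S} {φ : S × A × W → Vec d}
  {m m' : S → Vec d}

namespace IsWeight

lemma isDensity (hm : IsWeight ν φ m) (x : S × A × W) :
    IsDensity ν fun s' => inner ℝ (φ x) (m s') where
  measurable := measurable_const.inner hm.measurable
  nonneg := hm.nonneg x
  integrable := hm.integrable.const_inner _
  integral_eq_one := hm.integral_eq_one x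

variable {V : S → ℝ} {B : ℝ}

lemma integrable_smul (hm : IsWeight ν φ m) (hV : Measurable V) (hB : ∀ s, |V s| ≤ B) :
    Integrable (fun s => V s • m s) ν :=
  hm.integrable.bdd_smul B hV.aestronglyMeasurable (ae_of_all _ hB)

lemma integrable_inner_mul (hm : IsWeight ν φ m) (hV : Measurable V) (hB : ∀ s, |V s| ≤ B)
    (x : Vec d) : Integrable (fun s => inner ℝ x (m s) * V s) ν := by
  simpa only [real_inner_smul_right, mul_comm] using
    (hm.integrable_smul hV hB).const_inner (𝕜 := ℝ) x

lemma inner_integral_smul (hm : IsWeight ν φ m) (hV : Measurable V) (hB : ∀ s, |V s| ≤ B)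
    (x : Vec d) : inner ℝ x (∫ s, V s • m s ∂ν) = ∫ s, inner ℝ x (m s) * V s ∂ν := by
  rw [← integral_inner (hm.integrable_smul hV hB)]
  simp only [real_inner_smul_right, mul_comm]

lemma norm_integral_smul_le (hm : IsWeight ν φ m) (hV : Measurable V) (hB0 : 0 < B)
    (hB : ∀ s, V s ∈ Set.Icc 0 B) : ‖∫ s, V s • m s ∂ν‖ ≤ B * √(d : ℝ) := by
  have hscaled := hm.norm_integral_le (fun s => V s / B) (hV.div_const B) fun s =>
    ⟨div_nonneg (hB s).1 hB0.le, (div_le_one hB0).2 (hB s).2⟩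
  have hscale : ∫ s, V s • m s ∂ν = B • ∫ s, (V s / B) • m s ∂ν := by
    rw [← integral_smul]
    simp only [smul_smul, mul_div_cancel₀ _ hB0.ne']
  rw [hscale, norm_smul, Real.norm_eq_abs, abs_of_pos hB0]
  gcongr

lemma abs_integral_inner_mul_sub_le (hm : IsWeight ν φ m) (hm' : IsWeight ν φ m') {n : ℕ}
    (y : Fin n → S × A × W) {c T : ℝ} (hc : 0 < c) (hT : 0 ≤ T)
    (hy : ∑ τ, hellingerSq ν (fun s => inner ℝ (φ (y τ)) (m s))
      (fun s => inner ℝ (φ (y τ)) (m' s)) ≤ T)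
    (hV : Measurable V) (hB0 : 0 < B) (hB : ∀ s, V s ∈ Set.Icc 0 B) (x : S × A × W) :
    |∫ s, inner ℝ (φ x) (m s) * V s ∂ν - ∫ s, inner ℝ (φ x) (m' s) * V s ∂ν| ≤
      B * √(4 * d * c + 8 * T) * matNorm (gram (fun τ => φ (y τ)) c)⁻¹ (φ x) := by
  have hVB : ∀ s, |V s| ≤ B := fun s => by rw [abs_of_nonneg (hB s).1]; exact (hB s).2
  set θ : Vec d := ∫ s, V s • m s ∂ν - ∫ s, V s • m' s ∂ν with hθ
  have hinner : ∀ x, inner ℝ (φ x) θ =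
      ∫ s, inner ℝ (φ x) (m s) * V s ∂ν - ∫ s, inner ℝ (φ x) (m' s) * V s ∂ν := fun x => by
    rw [hθ, inner_sub_right, hm.inner_integral_smul hV hVB, hm'.inner_integral_smul hV hVB]
  have hnorm : ‖θ‖ ^ 2 ≤ 4 * B ^ 2 * d := by
    have hnorm₁ : ‖θ‖ ≤ 2 * B * √(d : ℝ) := by
      linarith [norm_sub_le (∫ s, V s • m s ∂ν) (∫ s, V s • m' s ∂ν),
        hm.norm_integral_smul_le hV hB0 hB, hm'.norm_integral_smul_le hV hB0 hB]
    refine (pow_le_pow_left₀ (norm_nonneg θ) hnorm₁ 2).trans_eq ?_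
    rw [mul_pow, Real.sq_sqrt d.cast_nonneg]
    ring
  have hdata : ∑ τ, inner ℝ (φ (y τ)) θ ^ 2 ≤ B ^ 2 * (8 * T) := by
    refine (Finset.sum_le_sum fun τ _ => ?_).trans
      (b := ∑ τ, B ^ 2 * (8 * hellingerSq ν (fun s => inner ℝ (φ (y τ)) (m s))
        (fun s => inner ℝ (φ (y τ)) (m' s)))) (by rw [← Finset.mul_sum, ← Finset.mul_sum]; gcongr)
    rw [hinner, ← integral_sub (hm.integrable_inner_mul hV hVB _)
      (hm'.integrable_inner_mul hV hVB _)]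
    simp only [← sub_mul]
    exact (hm.isDensity _).integral_sub_mul_sq_le (hm'.isDensity _) hVB
  rw [← hinner]
  refine abs_inner_le_mul_matNorm_gram_inv _ hc _ _ (by positivity) ?_
  rw [mul_pow, Real.sq_sqrt (by positivity)]
  nlinarith

lemma measurable_hellingerSq [MeasurableSpace W] [MeasurableSpace A] [SFinite ν]
    (hm : IsWeight ν φ m) (hm' : IsWeight ν φ m') (hφ : Measurable φ) :
    Measurable fun x => hellingerSq ν
      (fun s => inner ℝ (φ x) (m s)) (fun s => inner ℝ (φ x) (m' s)) := by
  have hdens : ∀ {u : S → Vec d}, IsWeight ν φ u →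
      Measurable fun y : (S × A × W) × S => √(inner ℝ (φ y.1) (u y.2)) := fun hu =>
    ((hφ.comp measurable_fst).inner (hu.measurable.comp measurable_snd)).sqrt
  exact ((hdens hm).mul (hdens hm')).stronglyMeasurable.integral_prod_right'.measurable.const_sub 1

end IsWeight

end Weights

section Likelihood

lemma logLik_eq_log_prod {H d : ℕ} {W S A : Type*} (φ : Fin H → S × A × W → Vec d) {i : ℕ}
    (D : Fin i → Episode H W S A) (h : Fin H) (m : S → Vec d) :
    logLik φ D h m =
      ENNReal.log (∏ τ, ENNReal.ofReal (inner ℝ (φ h (visit (D τ) h)) (m ((D τ).2 h).2.2))) := by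
  rw [logLik]
  induction (Finset.univ : Finset (Fin i)) using Finset.cons_induction with
  | empty => simp
  | cons a s ha ih => rw [Finset.sum_cons, Finset.prod_cons, ENNReal.log_mul_add, ih]

lemma prod_ite_lt_eq_prod_history {β E : Type*} [CommMonoid β] {N : ℕ} (i : Fin N) (x : Fin N → E)
    (f : E → β) :
    ∏ k : Fin N, (if (k : ℕ) < i then f (x k) else 1) = ∏ τ : Fin i, f (history x i τ) := by
  have hfilter : Finset.univ.filter (fun k : Fin N => (k : ℕ) < i) =
      Finset.univ.map (Fin.castLEEmb i.isLt.le) := by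
    ext k
    simp only [Finset.mem_filter_univ, Finset.mem_map, Finset.mem_univ, true_and]
    exact ⟨fun hk => ⟨⟨k, hk⟩, rfl⟩, by rintro ⟨j, rfl⟩; exact j.isLt⟩
  rw [← Finset.prod_filter, hfilter, Finset.prod_map]
  rfl

lemma exp_sum_le_prod_sqrt_div_mul_exp {n : ℕ} {p q z : Fin n → ℝ} (hp : ∀ i, 0 < p i)
    (hq : ∀ i, 0 ≤ q i) (hpq : ∏ i, ENNReal.ofReal (p i) ≤ ∏ i, ENNReal.ofReal (q i)) :
    ENNReal.ofReal (Real.exp (∑ i, z i)) ≤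
      ∏ i, ENNReal.ofReal (√(q i / p i) * Real.exp (z i)) := by
  have hpq' : ∏ i, p i ≤ ∏ i, q i := by
    rwa [← ENNReal.ofReal_prod_of_nonneg fun i _ => (hp i).le,
      ← ENNReal.ofReal_prod_of_nonneg fun i _ => hq i,
      ENNReal.ofReal_le_ofReal_iff (Finset.prod_nonneg fun i _ => hq i)] at hpq
  have hratio : 1 ≤ ∏ i, √(q i / p i) := by
    rw [← Real.sqrt_prod _ fun i _ => div_nonneg (hq i) (hp i).le, Real.one_le_sqrt,
      Finset.prod_div_distrib, one_le_div (Finset.prod_pos fun i _ => hp i)]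
    exact hpq'
  rw [← ENNReal.ofReal_prod_of_nonneg fun i _ => by positivity, Finset.prod_mul_distrib,
    ← Real.exp_sum]
  exact ENNReal.ofReal_le_ofReal (le_mul_of_one_le_left (Real.exp_pos _).le hratio)

lemma sum_exp_neg_two_mul_log_le {c : ℝ} (hc : 0 < c) (N : ℕ) :
    ∑ i : Fin N, Real.exp (-(2 * Real.log ((i + 1 : ℕ) * c))) ≤ 2 / c ^ 2 := by
  have hterm : ∀ i : ℕ, Real.exp (-(2 * Real.log ((i + 1 : ℕ) * c))) =
      (((i + 1 : ℕ) : ℝ) ^ 2)⁻¹ * (c ^ 2)⁻¹ := fun i => by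
    rw [Real.exp_neg, mul_comm 2, Real.exp_mul, Real.exp_log (by positivity), Real.rpow_ofNat,
      mul_pow, mul_inv]
  have hsum : ∑ i ∈ Finset.range N, (((i + 1 : ℕ) : ℝ) ^ 2)⁻¹ ≤ 2 := by
    have hIoo := sum_Ioo_inv_sq_le (α := ℝ) 0 (N + 1)
    rw [Finset.range_eq_Ico, Finset.sum_Ico_add' (fun i : ℕ => ((i : ℝ) ^ 2)⁻¹), zero_add]
    simpa [← Finset.Ico_add_one_left_eq_Ioo] using hIoo
  simp_rw [hterm]
  rw [Fin.sum_univ_eq_sum_range (fun i : ℕ => (((i + 1 : ℕ) : ℝ) ^ 2)⁻¹ * (c ^ 2)⁻¹),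
    ← Finset.sum_mul, div_eq_mul_inv]
  gcongr

lemma mul_sum_exp_neg_two_mul_log_le {k δ : ℝ} (hδ : 0 < δ) (hk : δ ≤ k) (N : ℕ) :
    k * ∑ i : Fin N, Real.exp (-(2 * Real.log ((i + 1 : ℕ) * (2 * k / δ)))) ≤ δ / 2 := by
  have hk0 : 0 < k := hδ.trans_le hk
  calc k * ∑ i : Fin N, Real.exp (-(2 * Real.log ((i + 1 : ℕ) * (2 * k / δ))))
      ≤ k * (2 / (2 * k / δ) ^ 2) := by
        gcongr
        exact sum_exp_neg_two_mul_log_le (by positivity) N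
    _ = δ / 2 * (δ / k) := by field_simp
    _ ≤ δ / 2 := mul_le_of_le_one_right (by positivity) ((div_le_one hk0).2 hk)

end Likelihood

section MaximumLikelihood

variable {H d : ℕ} {W S A : Type*} [MeasurableSpace W] [MeasurableSpace S] [MeasurableSpace A]

lemma measurable_visit (h : Fin H) : Measurable fun e : Episode H W S A => visit e h := by
  unfold visit
  fun_prop

/-- The accumulated Hellinger error, at step `h`, of the transition model given by `m` on the state
action pairs visited in the data `D`. -/
noncomputable def dataError (ν : Measure S) (φ : Fin H → S × A × W → Vec d)
    (μ : Fin H → S → Vec d) {i : ℕ} (D : Fin i → Episode H W S A) (h : Fin H) (m : S → Vec d) : ℝ :=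
  ∑ τ, hellingerSq ν (fun s => inner ℝ (φ h (visit (D τ) h)) (μ h s))
    (fun s => inner ℝ (φ h (visit (D τ) h)) (m s))

namespace Learner

section Transition

variable (L : Learner H d W S A) (M : CMDP H W S A) {n : ℕ} (D : Fin n → Episode H W S A)
  (h : Fin H)

lemma lintegral_stepKernel_transition_le_one {f : (S × A × W) × S → ℝ≥0∞} (hf : Measurable f)
    (hle : ∀ x, ∫⁻ s', f (x, s') ∂(M.P h x) ≤ 1) :
    ∫⁻ e, f (visit e h, (e.2 h).2.2) ∂(L.stepKernel M n D) ≤ 1 := by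
  rw [L.lintegral_stepKernel M n D (F := fun e => f (visit e h, (e.2 h).2.2))
    (hf.comp ((measurable_visit h).prodMk (by fun_prop)))]
  have hstep : ∀ w, ∫⁻ τ, f (visit (w, τ) h, (τ h).2.2) ∂(M.episodeLaw w (L.policy n D w)) ≤ 1 :=
    fun w => lintegral_trajLaw_step_le_one (M.transAt w) (L.policy n D w).kernel M.s₁ h
      (f := fun y => f ((y.1, y.2.1, w), y.2.2)) (hf.comp (by fun_prop)) fun s a => hle (s, a, w)
  exact (lintegral_mono hstep).trans (by simp)

lemma ae_stepKernel_transition {p : (S × A × W) × S → Prop} (hp : MeasurableSet {y | p y})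
    (hP : ∀ x, ∀ᵐ s' ∂(M.P h x), p (x, s')) :
    ∀ᵐ e ∂(L.stepKernel M n D), p (visit e h, (e.2 h).2.2) := by
  set f : (S × A × W) × S → ℝ≥0∞ := {y | p y}ᶜ.indicator fun _ => ⊤ with hf_def
  have hf : Measurable f := measurable_const.indicator hp.compl
  have hle : ∀ x, ∫⁻ s', f (x, s') ∂(M.P h x) ≤ 1 := fun x => by
    have hzero : (fun s' => f (x, s')) =ᵐ[M.P h x] 0 := by
      filter_upwards [hP x] with s' hs'
      simp [hf_def, hs']
    simp [lintegral_congr_ae hzero]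
  have hfin := ae_lt_top (hf.comp ((measurable_visit h).prodMk (by fun_prop)))
    ((L.lintegral_stepKernel_transition_le_one M D h hf hle).trans_lt ENNReal.one_lt_top).ne
  filter_upwards [hfin] with e he
  by_contra hpe
  simp [hf_def, hpe] at he

lemma measure_prod_transition_ge_le {f : (S × A × W) × S → ℝ≥0∞} (hf : Measurable f)
    (hle : ∀ x, ∫⁻ s', f (x, s') ∂(M.P h x) ≤ 1) {N : ℕ} (i : Fin N) (t : ℝ) :
    L.runLaw M N {x | ENNReal.ofReal (Real.exp t) ≤
      ∏ τ, f (visit (history x i τ) h, ((history x i τ).2 h).2.2)} ≤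
      ENNReal.ofReal (Real.exp (-t)) := by
  set g : Episode H W S A → ℝ≥0∞ := fun e => f (visit e h, (e.2 h).2.2)
  have hg : Measurable g := hf.comp ((measurable_visit h).prodMk (by fun_prop))
  have hbound := measure_prod_history_ge_le (κ := L.stepKernel M)
    (g := fun k _ e => if k < i then g e else 1)
    (fun k => by
      by_cases hk : k < i
      · simp only [hk, if_true]
        exact hg.comp measurable_snd
      · simp only [hk, if_false]
        exact measurable_const)
    (fun k D => by
      by_cases hk : k < i
      · simpa only [hk, if_true] using L.lintegral_stepKernel_transition_le_one M D h hf hle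
      · simp [hk]) N t
  rw [L.runLaw_eq_seqLaw]
  simpa only [prod_ite_lt_eq_prod_history] using hbound

end Transition

variable {M : CMDP H W S A} {ν : Measure S} {φ ψ : Fin H → S × A × W → Vec d}
  {μ : Fin H → S → Vec d} {η : Fin H → Vec d} {Ψ : Finset (S → Vec d)}

lemma ae_runLaw_density_pos (L : Learner H d W S A) (hM : IsModelI M ν φ ψ μ η) (N : ℕ)
    (h : Fin H) :
    ∀ᵐ x ∂(L.runLaw M N), ∀ i, 0 < inner ℝ (φ h (visit (x i) h)) (μ h ((x i).2 h).2.2) := by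
  have hinner : Measurable fun y : (S × A × W) × S => inner ℝ (φ h y.1) (μ h y.2) :=
    ((hM.φ_measurable h).comp measurable_fst).inner ((hM.weight h).measurable.comp measurable_snd)
  have hpos : MeasurableSet {y : (S × A × W) × S | 0 < inner ℝ (φ h y.1) (μ h y.2)} :=
    measurableSet_lt measurable_const hinner
  rw [L.runLaw_eq_seqLaw]
  refine ae_seqLaw_forall (p := fun e => 0 < inner ℝ (φ h (visit e h)) (μ h (e.2 h).2.2))
    (((measurable_visit h).prodMk (by fun_prop)) hpos) (fun n D => ?_) N
  refine L.ae_stepKernel_transition M D h hpos fun x => ?_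
  rw [hM.trans_eq]
  exact ((hM.weight h).isDensity x).ae_withDensity_pos

variable [SFinite ν]

lemma measure_logLik_le_and_lt_dataError_le (L : Learner H d W S A) (hM : IsModelI M ν φ ψ μ η)
    {N : ℕ} (i : Fin N) (h : Fin H) {m : S → Vec d} (hm : IsWeight ν (φ h) m) (t : ℝ) :
    L.runLaw M N {x | logLik φ (history x i) h (μ h) ≤ logLik φ (history x i) h m ∧
      t < dataError ν φ μ (history x i) h m} ≤ ENNReal.ofReal (Real.exp (-t)) := by
  let f : (S × A × W) × S → ℝ≥0∞ := fun y => ENNReal.ofReal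
    (√(inner ℝ (φ h y.1) (m y.2) / inner ℝ (φ h y.1) (μ h y.2)) *
      Real.exp (hellingerSq ν (fun s => inner ℝ (φ h y.1) (μ h s))
        fun s => inner ℝ (φ h y.1) (m s)))
  have hinner : ∀ {u : S → Vec d}, Measurable u →
      Measurable fun y : (S × A × W) × S => inner ℝ (φ h y.1) (u y.2) := fun hu =>
    ((hM.φ_measurable h).comp measurable_fst).inner (hu.comp measurable_snd)
  have hf : Measurable f :=
    (((hinner hm.measurable).div (hinner (hM.weight h).measurable)).sqrt.mul
      (((hM.weight h).measurable_hellingerSq hm (hM.φ_measurable h)).comp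
        measurable_fst).exp).ennreal_ofReal
  have hle : ∀ x, ∫⁻ s', f (x, s') ∂(M.P h x) ≤ 1 := fun x => by
    rw [hM.trans_eq]
    exact ((hM.weight h).isDensity x).lintegral_sqrt_likelihood_ratio_le_one (hm.isDensity x)
  refine (measure_mono_ae ?_).trans (L.measure_prod_transition_ge_le M h hf hle i t)
  filter_upwards [L.ae_runLaw_density_pos hM N h] with x hpos ⟨hlik, hlt⟩
  rw [logLik_eq_log_prod, logLik_eq_log_prod, ENNReal.log_le_log_iff] at hlik
  exact (ENNReal.ofReal_le_ofReal (Real.exp_le_exp.2 hlt.le)).trans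
    (exp_sum_le_prod_sqrt_div_mul_exp (fun τ => hpos (τ.castLE i.isLt.le))
      (fun τ => hm.nonneg _ _) hlik)

lemma measure_exists_logLik_le_and_lt_dataError_le (L : Learner H d W S A)
    (hM : IsModelI M ν φ ψ μ η) (hΨ : IsModelClass ν φ μ Ψ) (hH : 1 ≤ H) {δ : ℝ} (hδ : 0 < δ)
    (hδ1 : δ < 1) (N : ℕ) :
    L.runLaw M N {x | ∃ i : Fin N, ∃ h, ∃ m ∈ Ψ,
      logLik φ (history x i) h (μ h) ≤ logLik φ (history x i) h m ∧
      2 * Real.log (2 * (i + 1 : ℕ) * H * Ψ.card / δ) < dataError ν φ μ (history x i) h m} ≤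
    ENNReal.ofReal (δ / 2) := by
  have hK : 0 < Ψ.card := Finset.card_pos.2 ⟨_, hΨ.realizable ⟨0, hH⟩⟩
  have hHK : (1 : ℝ) ≤ H * Ψ.card := by exact_mod_cast Nat.mul_pos hH hK
  set c : ℝ := 2 * (H * Ψ.card) / δ with hc
  have hlog : ∀ i : ℕ, 2 * Real.log (2 * (i + 1 : ℕ) * H * Ψ.card / δ) =
      2 * Real.log ((i + 1 : ℕ) * c) := fun i => by rw [hc]; congr 2; ring
  let bad (i : Fin N) (h : Fin H) (m : S → Vec d) : Set (Fin N → Episode H W S A) :=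
    {x | logLik φ (history x i) h (μ h) ≤ logLik φ (history x i) h m ∧
      2 * Real.log ((i + 1 : ℕ) * c) < dataError ν φ μ (history x i) h m}
  have hbad : ∀ i h, ∀ m ∈ Ψ, L.runLaw M N (bad i h m) ≤
      ENNReal.ofReal (Real.exp (-(2 * Real.log ((i + 1 : ℕ) * c)))) := fun i h m hm =>
    L.measure_logLik_le_and_lt_dataError_le hM i h (hΨ.admissible m hm h) _
  calc _ ≤ L.runLaw M N (⋃ i, ⋃ h, ⋃ m ∈ Ψ, bad i h m) := by
        refine measure_mono fun x ⟨i, h, m, hm, hx⟩ => ?_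
        rw [hlog] at hx
        exact Set.mem_iUnion₂.2 ⟨i, h, Set.mem_biUnion hm hx⟩
    _ ≤ ∑ i : Fin N, ∑ h : Fin H, ∑ m ∈ Ψ,
        ENNReal.ofReal (Real.exp (-(2 * Real.log ((i + 1 : ℕ) * c)))) := by
        refine (measure_iUnion_fintype_le _ _).trans (Finset.sum_le_sum fun i _ => ?_)
        refine (measure_iUnion_fintype_le _ _).trans (Finset.sum_le_sum fun h _ => ?_)
        exact (measure_biUnion_finset_le _ _).trans (Finset.sum_le_sum (hbad i h))
    _ = ENNReal.ofReal (H * Ψ.card *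
        ∑ i : Fin N, Real.exp (-(2 * Real.log ((i + 1 : ℕ) * c)))) := by
        rw [Finset.mul_sum, ENNReal.ofReal_sum_of_nonneg fun i _ => by positivity]
        refine Finset.sum_congr rfl fun i _ => ?_
        rw [ENNReal.ofReal_mul (by positivity), ENNReal.ofReal_mul (by positivity)]
        simp [mul_assoc]
    _ ≤ ENNReal.ofReal (δ / 2) := by
        exact ENNReal.ofReal_le_ofReal (mul_sum_exp_neg_two_mul_log_le hδ (hδ1.le.trans hHK) N)

end Learner

end MaximumLikelihood

section Planning

lemma integral_mem_Icc {Y : Type*} [MeasurableSpace Y] {P : Measure Y} [IsProbabilityMeasure P]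
    {f : Y → ℝ} (hf : Measurable f) {B : ℝ} (h : ∀ y, f y ∈ Set.Icc 0 B) :
    ∫ y, f y ∂P ∈ Set.Icc 0 B :=
  (convex_Icc 0 B).integral_mem isClosed_Icc (ae_of_all _ h)
    (Integrable.of_mem_Icc 0 B hf.aemeasurable (ae_of_all _ h))

variable {S A : Type*} [MeasurableSpace S] [MeasurableSpace A] {ν : Measure S} {H : ℕ}

lemma IsDensity.integrable_mul {p : S → ℝ} (hp : IsDensity ν p) {V : S → ℝ} (hV : Measurable V)
    {B : ℝ} (hB : ∀ s, V s ∈ Set.Icc 0 B) : Integrable (fun s => p s * V s) ν :=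
  hp.integrable.mul_bdd hV.aestronglyMeasurable <| ae_of_all _ fun s =>
    (abs_of_nonneg (hB s).1).trans_le (hB s).2

section ExpSum

variable (P : Fin H → Kernel (S × A) S) (π : Fin H → Kernel S A) [∀ h, IsMarkovKernel (P h)]
  [∀ h, IsMarkovKernel (π h)] {f g : Fin H → S → A → ℝ} {C C' : ℝ}

lemma expSum_mem_Icc (hf : ∀ h, Measurable (Function.uncurry (f h)))
    (hC : ∀ h s a, f h s a ∈ Set.Icc 0 C) (s : S) : expSum P π f s ∈ Set.Icc 0 (H * C) :=
  integral_mem_Icc (measurable_sum_traj hf) fun τ =>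
    ⟨Finset.sum_nonneg fun h _ => (hC h _ _).1,
      (Finset.sum_le_sum fun h _ => (hC h _ _).2).trans_eq (by simp)⟩

lemma expSum_add (hf : ∀ h, Measurable (Function.uncurry (f h)))
    (hg : ∀ h, Measurable (Function.uncurry (g h))) (hC : ∀ h s a, |f h s a| ≤ C)
    (hC' : ∀ h s a, |g h s a| ≤ C') (s : S) :
    expSum P π (fun h s a => f h s a + g h s a) s = expSum P π f s + expSum P π g s := by
  simp only [expSum, Finset.sum_add_distrib]
  exact integral_add (integrable_sum_traj P π hf hC s) (integrable_sum_traj P π hg hC' s)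

end ExpSum

/-- The step of the recursion for `truncValue`: the truncated action value of a state action pair
for the reward `r`, the transition density `p` and the continuation value `V`. -/
noncomputable def truncBackup (ν : Measure S) (B : ℝ) (r : S → A → ℝ) (p : S → A → S → ℝ)
    (V : S → ℝ) (s : S) (a : A) : ℝ :=
  min B (r s a + ∫ s', p s a s' * V s' ∂ν)

lemma truncValue_succ (ν : Measure S) (B : ℝ) (r : Fin (H + 1) → S → A → ℝ)
    (p : Fin (H + 1) → S → A → S → ℝ) (π : Fin (H + 1) → Kernel S A) (s : S) :
    truncValue ν B (H + 1) r p π s = ∫ a, truncBackup ν B (r 0) (p 0)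
      (truncValue ν B H (fun h => r h.succ) (fun h => p h.succ) (fun h => π h.succ)) s a ∂(π 0 s) :=
  rfl

/-- The data of a Markov decision process given by nonnegative rewards and by transition densities
with respect to `ν`, as produced by the learner's estimates; the rewards may exceed `1`. -/
structure IsDensityMDP (ν : Measure S) (r : Fin H → S → A → ℝ) (p : Fin H → S → A → S → ℝ) :
    Prop where
  measurable_reward : ∀ h, Measurable (Function.uncurry (r h))
  reward_nonneg : ∀ h s a, 0 ≤ r h s a
  measurable_density : ∀ h, Measurable fun y : (S × A) × S => p h y.1.1 y.1.2 y.2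
  isDensity : ∀ h s a, IsDensity ν (p h s a)

namespace IsDensityMDP

lemma tail {r : Fin (H + 1) → S → A → ℝ} {p : Fin (H + 1) → S → A → S → ℝ}
    (hm : IsDensityMDP ν r p) : IsDensityMDP ν (fun h => r h.succ) fun h => p h.succ where
  measurable_reward h := hm.measurable_reward h.succ
  reward_nonneg h := hm.reward_nonneg h.succ
  measurable_density h := hm.measurable_density h.succ
  isDensity h := hm.isDensity h.succ

variable {r : Fin H → S → A → ℝ} {p : Fin H → S → A → S → ℝ} {V : S → ℝ} {B : ℝ}

lemma measurable_truncBackup [SFinite ν] (hm : IsDensityMDP ν r p) (B : ℝ) (hV : Measurable V)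
    (h : Fin H) : Measurable (Function.uncurry (truncBackup ν B (r h) (p h) V)) :=
  measurable_const.min <| (hm.measurable_reward h).add <|
    ((hm.measurable_density h).mul (hV.comp measurable_snd)).stronglyMeasurable
      |>.integral_prod_right'.measurable

lemma truncBackup_mem_Icc (hm : IsDensityMDP ν r p) (hB : 0 ≤ B) (hV : ∀ s, 0 ≤ V s)
    (h : Fin H) (s : S) (a : A) : truncBackup ν B (r h) (p h) V s a ∈ Set.Icc 0 B :=
  ⟨le_min hB (add_nonneg (hm.reward_nonneg h s a)
    (integral_nonneg fun s' => mul_nonneg ((hm.isDensity h s a).nonneg s') (hV s'))),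
    min_le_left _ _⟩

variable [SFinite ν]

lemma measurable_truncValue (B : ℝ) : ∀ {H : ℕ} {r : Fin H → S → A → ℝ}
    {p : Fin H → S → A → S → ℝ} (_ : IsDensityMDP ν r p) (π : Fin H → Kernel S A)
    [∀ h, IsMarkovKernel (π h)], Measurable (truncValue ν B H r p π)
  | 0, _, _, _, _, _ => measurable_const
  | _ + 1, _, _, hm, π, _ =>
    (hm.measurable_truncBackup B (measurable_truncValue B hm.tail _) 0).stronglyMeasurable
      |>.integral_kernel_prod_right' (κ := π 0) |>.measurable

lemma truncValue_mem_Icc (hB : 0 ≤ B) : ∀ {H : ℕ} {r : Fin H → S → A → ℝ}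
    {p : Fin H → S → A → S → ℝ} (_ : IsDensityMDP ν r p) (π : Fin H → Kernel S A)
    [∀ h, IsMarkovKernel (π h)] (s : S), truncValue ν B H r p π s ∈ Set.Icc 0 B
  | 0, _, _, _, _, _, _ => ⟨le_rfl, hB⟩
  | _ + 1, _, _, hm, _, _, _ =>
    integral_mem_Icc
      ((hm.measurable_truncBackup B (hm.tail.measurable_truncValue B _) 0).comp
        measurable_prodMk_left)
      fun a => hm.truncBackup_mem_Icc hB (fun s => (truncValue_mem_Icc hB hm.tail _ s).1) 0 _ a

lemma expSum_le_truncValue {T : ℝ} (hTB : T ≤ B) : ∀ {H : ℕ} {r' : Fin H → S → A → ℝ}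
    {p : Fin H → S → A → S → ℝ} (_ : IsDensityMDP ν r' p) (P : Fin H → Kernel (S × A) S)
    (π : Fin H → Kernel S A) [∀ h, IsMarkovKernel (P h)] [∀ h, IsMarkovKernel (π h)]
    {r : Fin H → S → A → ℝ} (_ : ∀ h, Measurable (Function.uncurry (r h)))
    (_ : ∀ h s a, r h s a ∈ Set.Icc (0 : ℝ) 1) (_ : H ≤ T)
    (_ : ∀ h s a (V : S → ℝ), Measurable V → (∀ s, V s ∈ Set.Icc 0 T) →
      r h s a + ∫ s', V s' ∂(P h (s, a)) ≤ r' h s a + ∫ s', p h s a s' * V s' ∂ν) (s : S),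
    expSum P π r s ≤ truncValue ν B H r' p π s
  | 0, _, _, _, _, _, _, _, _, _, _, _, _, _ => by simp [expSum, truncValue]
  | H + 1, r', p, hm, P, π, _, _, r, hr, hr1, hHT, hle, s => by
    push_cast at hHT
    set V := expSum (fun h => P h.succ) (fun h => π h.succ) (fun h => r h.succ)
    set V' := truncValue ν B H (fun h => r' h.succ) (fun h => p h.succ) (fun h => π h.succ)
    have hV : Measurable V := measurable_expSum _ _ fun h => hr h.succ
    have hVH : ∀ s, V s ∈ Set.Icc (0 : ℝ) H := fun s => by
      simpa only [mul_one] using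
        expSum_mem_Icc _ _ (fun h => hr h.succ) (fun h => hr1 h.succ) s
    have hVT : ∀ s, V s ∈ Set.Icc 0 T := fun s => ⟨(hVH s).1, (hVH s).2.trans (by linarith)⟩
    have hB0 : 0 ≤ B := by linarith [H.cast_nonneg (α := ℝ)]
    have hV' : Measurable V' := hm.tail.measurable_truncValue B _
    have hV'B : ∀ s, V' s ∈ Set.Icc 0 B := hm.tail.truncValue_mem_Icc hB0 _
    have hVV' : ∀ s, V s ≤ V' s := expSum_le_truncValue hTB hm.tail _ _ (fun h => hr h.succ)
      (fun h => hr1 h.succ) (by linarith) fun h => hle h.succ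
    rw [expSum_succ P π hr fun h s a => (abs_of_nonneg (hr1 h s a).1).trans_le (hr1 h s a).2,
      truncValue_succ]
    have hback := hm.truncBackup_mem_Icc hB0 (fun s => (hV'B s).1) 0 s
    refine integral_mono_of_nonneg
      (ae_of_all _ fun a => add_nonneg (hr1 0 s a).1 (integral_nonneg fun s' => (hVH s').1))
      (Integrable.of_mem_Icc 0 B
        ((hm.measurable_truncBackup B hV' 0).comp measurable_prodMk_left).aemeasurable
        (ae_of_all _ hback)) (ae_of_all _ fun a => le_min ?_ ?_)
    · linarith [(integral_mem_Icc (P := P 0 (s, a)) hV hVH).2, (hr1 0 s a).2]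
    · refine (hle 0 s a V hV hVT).trans (add_le_add_right ?_ _)
      have hp := hm.isDensity 0 s a
      exact integral_mono (hp.integrable_mul hV hVT) (hp.integrable_mul hV' hV'B)
        fun s' => mul_le_mul_of_nonneg_left (hVV' s') (hp.nonneg s')

lemma truncValue_le_expSum (hB : 0 ≤ B) {C : ℝ} : ∀ {H : ℕ} {r' : Fin H → S → A → ℝ}
    {p : Fin H → S → A → S → ℝ} (_ : IsDensityMDP ν r' p) (P : Fin H → Kernel (S × A) S)
    (π : Fin H → Kernel S A) [∀ h, IsMarkovKernel (P h)] [∀ h, IsMarkovKernel (π h)]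
    {g : Fin H → S → A → ℝ} (_ : ∀ h, Measurable (Function.uncurry (g h)))
    (_ : ∀ h s a, g h s a ∈ Set.Icc 0 C)
    (_ : ∀ h s a (V : S → ℝ), Measurable V → (∀ s, V s ∈ Set.Icc 0 B) →
      r' h s a + ∫ s', p h s a s' * V s' ∂ν ≤ g h s a + ∫ s', V s' ∂(P h (s, a))) (s : S),
    truncValue ν B H r' p π s ≤ expSum P π g s
  | 0, _, _, _, _, _, _, _, _, _, _, _, _ => by simp [expSum, truncValue]
  | H + 1, r', p, hm, P, π, _, _, g, hg, hgC, hle, s => by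
    set V := expSum (fun h => P h.succ) (fun h => π h.succ) (fun h => g h.succ)
    set V' := truncValue ν B H (fun h => r' h.succ) (fun h => p h.succ) (fun h => π h.succ)
    have hV : Measurable V := measurable_expSum _ _ fun h => hg h.succ
    have hVC : ∀ s, V s ∈ Set.Icc 0 (H * C) :=
      expSum_mem_Icc _ _ (fun h => hg h.succ) fun h => hgC h.succ
    have hV' : Measurable V' := hm.tail.measurable_truncValue B _
    have hV'B : ∀ s, V' s ∈ Set.Icc 0 B := hm.tail.truncValue_mem_Icc hB _
    have hVV' : ∀ s, V' s ≤ V s := truncValue_le_expSum hB hm.tail _ _ (fun h => hg h.succ)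
      (fun h => hgC h.succ) fun h => hle h.succ
    rw [expSum_succ P π hg fun h s a => (abs_of_nonneg (hgC h s a).1).trans_le (hgC h s a).2,
      truncValue_succ]
    have hcont : Measurable fun a => g 0 s a + ∫ s', V s' ∂(P 0 (s, a)) :=
      ((hg 0).comp measurable_prodMk_left).add
        (hV.stronglyMeasurable.integral_kernel.measurable.comp measurable_prodMk_left)
    have hcontC : ∀ a, g 0 s a + ∫ s', V s' ∂(P 0 (s, a)) ∈ Set.Icc 0 (C + H * C) := fun a =>
      have hint := integral_mem_Icc (P := P 0 (s, a)) hV hVC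
      ⟨add_nonneg (hgC 0 s a).1 hint.1, add_le_add (hgC 0 s a).2 hint.2⟩
    refine integral_mono_of_nonneg
      (ae_of_all _ fun a => (hm.truncBackup_mem_Icc hB (fun s => (hV'B s).1) 0 s a).1)
      (Integrable.of_mem_Icc 0 _ hcont.aemeasurable (ae_of_all _ hcontC))
      (ae_of_all _ fun a => (min_le_right _ _).trans ((hle 0 s a V' hV' hV'B).trans ?_))
    exact add_le_add_right (integral_mono (Integrable.of_mem_Icc 0 _ hV'.aemeasurable
      (ae_of_all _ hV'B)) (Integrable.of_mem_Icc 0 _ hV.aemeasurable (ae_of_all _ hVC)) hVV') _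

end IsDensityMDP

end Planning

section Parameters

variable {γ γ₁ δ : ℝ} {d H K n n' : ℕ}

lemma two_le_two_mul_mul_div (hH : 1 ≤ H) (hδ : 0 < δ) (hδ1 : δ < 1) (hn : 1 ≤ n) :
    (2 : ℝ) ≤ 2 * n * H / δ := by
  have hnH : (1 : ℝ) ≤ n * H := by exact_mod_cast Nat.mul_pos hn hH
  rw [le_div_iff₀ hδ]
  nlinarith

lemma half_le_log (hH : 1 ≤ H) (hδ : 0 < δ) (hδ1 : δ < 1) (hn : 1 ≤ n) :
    1 / 2 ≤ Real.log (2 * n * H / δ) := by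
  linarith [Real.log_le_log two_pos (two_le_two_mul_mul_div hH hδ hδ1 hn), Real.log_two_gt_d9]

lemma reg_mono (hγ : 0 ≤ γ) (hH : 1 ≤ H) (hδ : 0 < δ) (hn : 1 ≤ n) (hnn' : n ≤ n') :
    reg γ d H δ n ≤ reg γ d H δ n' := by
  have : (0 : ℝ) < n := by exact_mod_cast hn
  have : (0 : ℝ) < H := by exact_mod_cast hH
  unfold reg
  gcongr

lemma one_le_reg (hγ : 2 ≤ γ) (hd : 1 ≤ d) (hH : 1 ≤ H) (hδ : 0 < δ) (hδ1 : δ < 1)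
    (hn : 1 ≤ n) : 1 ≤ reg γ d H δ n := by
  have hγd : 2 ≤ γ * d := by nlinarith [show (1 : ℝ) ≤ d by exact_mod_cast hd]
  have hlog := half_le_log hH hδ hδ1 hn
  calc (1 : ℝ) = 2 * (1 / 2) := by norm_num
    _ ≤ reg γ d H δ n := by unfold reg; gcongr

lemma beta_mono (hγ : 0 ≤ γ) (hH : 1 ≤ H) (hδ : 0 < δ) (hn : 1 ≤ n) (hnn' : n ≤ n') :
    beta γ d H δ n ≤ beta γ d H δ n' :=
  Real.sqrt_le_sqrt (mul_le_mul_of_nonneg_left (reg_mono hγ hH hδ hn hnn') d.cast_nonneg)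

lemma beta_nonneg : 0 ≤ beta γ d H δ n :=
  Real.sqrt_nonneg _

/-- The confidence radius `√(2 λ_n d + 4 log(2 n H K / δ))` of the estimated transitions, so that
`α_n = 5 H · radius`. -/
noncomputable def radius (γ₁ : ℝ) (d H K : ℕ) (δ : ℝ) (n : ℕ) : ℝ :=
  √(2 * reg γ₁ d H δ n * d + 4 * Real.log (2 * n * H * K / δ))

lemma radius_nonneg : 0 ≤ radius γ₁ d H K δ n :=
  Real.sqrt_nonneg _

lemma radius_mono (hγ : 0 ≤ γ₁) (hK : 1 ≤ K) (hH : 1 ≤ H) (hδ : 0 < δ) (hn : 1 ≤ n)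
    (hnn' : n ≤ n') : radius γ₁ d H K δ n ≤ radius γ₁ d H K δ n' := by
  have hreg := reg_mono (d := d) hγ hH hδ hn hnn'
  have : (0 : ℝ) < n := by exact_mod_cast hn
  have : (0 : ℝ) < H := by exact_mod_cast hH
  have : (0 : ℝ) < K := by exact_mod_cast hK
  unfold radius
  gcongr

lemma alpha_eq : alpha γ₁ d H K δ n = 5 * H * radius γ₁ d H K δ n :=
  rfl

lemma alpha_nonneg : 0 ≤ alpha γ₁ d H K δ n :=
  mul_nonneg (by positivity) radius_nonneg

end Parameters

section FeatureNorm

variable {H d i : ℕ} {W S A : Type*} {v φ ψ : Fin H → S × A × W → Vec d} {c γ₁ γ₂ δ : ℝ} {K : ℕ}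

lemma featNorm_nonneg (D : Fin i → Episode H W S A) (h : Fin H) (x : S × A × W) :
    0 ≤ featNorm v c D h x :=
  matNorm_nonneg _ _

lemma featNorm_le (hv : ∀ h x, ‖v h x‖ ≤ 1) (hc : 0 < c) (D : Fin i → Episode H W S A)
    (h : Fin H) (x : S × A × W) : featNorm v c D h x ≤ 1 / √c :=
  (matNorm_gram_inv_le _ hc _).trans (by gcongr; exact hv h x)

lemma mul_featNorm_sq_mem_Icc (hv : ∀ h x, ‖v h x‖ ≤ 1) (hc : 0 < c)
    (D : Fin i → Episode H W S A) (h : Fin H) (x : S × A × W) :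
    c * featNorm v c D h x ^ 2 ∈ Set.Icc (0 : ℝ) 1 := by
  refine ⟨by positivity, ?_⟩
  calc c * featNorm v c D h x ^ 2 ≤ c * (1 / √c) ^ 2 := by
        have := featNorm_nonneg (v := v) (c := c) D h x
        gcongr
        exact featNorm_le hv hc D h x
    _ = 1 := by rw [div_pow, Real.sq_sqrt hc.le]; field_simp

lemma featNorm_le_one (hv : ∀ h x, ‖v h x‖ ≤ 1) (hc : 1 ≤ c) (D : Fin i → Episode H W S A)
    (h : Fin H) (x : S × A × W) : featNorm v c D h x ≤ 1 :=
  (featNorm_le hv (one_pos.trans_le hc) D h x).trans <|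
    div_le_one_of_le₀ (Real.one_le_sqrt.2 hc) (Real.sqrt_nonneg c)

/-- The exploration bonus of episode `i + 1` that dominates the one-step gap between the optimistic
model and the true one. The constants are `5 + 6` and `1 + 1`: one contribution comes from the
optimistic reward, the other from the estimation error, which for the transitions is
`2 · 3H · radius · ‖φ‖` on continuation values bounded by `3 H`. -/
noncomputable def bonus (φ ψ : Fin H → S × A × W → Vec d) (K : ℕ) (γ₁ γ₂ δ : ℝ)
    (D : Fin i → Episode H W S A) (h : Fin H) (x : S × A × W) : ℝ :=
  11 * H * radius γ₁ d H K δ (i + 1) * featNorm φ (reg γ₁ d H δ (i + 1)) D h x +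
    2 * beta γ₂ d H δ (i + 1) * featNorm ψ (reg γ₂ d H δ (i + 1)) D h x

lemma bonus_nonneg (D : Fin i → Episode H W S A) (h : Fin H) (x : S × A × W) :
    0 ≤ bonus φ ψ K γ₁ γ₂ δ D h x :=
  add_nonneg (mul_nonneg (mul_nonneg (by positivity) radius_nonneg) (featNorm_nonneg _ _ _))
    (mul_nonneg (mul_nonneg zero_le_two beta_nonneg) (featNorm_nonneg _ _ _))

lemma bonus_le (hφ : ∀ h x, ‖φ h x‖ ≤ 1) (hψ : ∀ h x, ‖ψ h x‖ ≤ 1)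
    (h₁ : 1 ≤ reg γ₁ d H δ (i + 1)) (h₂ : 1 ≤ reg γ₂ d H δ (i + 1))
    (D : Fin i → Episode H W S A) (h : Fin H) (x : S × A × W) :
    bonus φ ψ K γ₁ γ₂ δ D h x ≤
      11 * H * radius γ₁ d H K δ (i + 1) + 2 * beta γ₂ d H δ (i + 1) :=
  add_le_add
    (mul_le_of_le_one_right (mul_nonneg (by positivity) radius_nonneg)
      (featNorm_le_one hφ h₁ D h x))
    (mul_le_of_le_one_right (mul_nonneg zero_le_two beta_nonneg) (featNorm_le_one hψ h₂ D h x))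

variable [MeasurableSpace W] [MeasurableSpace S] [MeasurableSpace A]

lemma measurable_featNorm (hv : ∀ h, Measurable (v h)) (c : ℝ) (h : Fin H) :
    Measurable fun p : (Fin i → Episode H W S A) × (S × A × W) => featNorm v c p.1 h p.2 := by
  refine (measurable_matNorm_gram_inv c).comp
    (f := fun p : (Fin i → Episode H W S A) × (S × A × W) =>
      ((fun τ => v h (visit (p.1 τ) h)), v h p.2)) (Measurable.prodMk ?_ ?_)
  · exact measurable_pi_iff.2 fun τ => (hv h).comp ((measurable_visit h).comp
      ((measurable_pi_apply τ).comp measurable_fst))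
  · exact (hv h).comp measurable_snd

lemma measurable_bonus (hφ : ∀ h, Measurable (φ h)) (hψ : ∀ h, Measurable (ψ h))
    (D : Fin i → Episode H W S A) (h : Fin H) : Measurable (bonus φ ψ K γ₁ γ₂ δ D h) :=
  (((measurable_featNorm hφ _ h).comp measurable_prodMk_left).const_mul _).add
    (((measurable_featNorm hψ _ h).comp measurable_prodMk_left).const_mul _)

end FeatureNorm

section Value

variable {H d i : ℕ} {W S A : Type*} [MeasurableSpace W] [MeasurableSpace S] [MeasurableSpace A]

lemma measurable_uncurry_of_context {f : S × A × W → ℝ} (hf : Measurable f) (w : W) :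
    Measurable (Function.uncurry fun (s : S) (a : A) => f (s, a, w)) :=
  hf.comp (f := fun p : S × A => (p.1, p.2, w)) (by fun_prop)

lemma CMDP.value_eq_expSum (M : CMDP H W S A) (w : W) (π : Policy H S A) :
    M.value w π = expSum (M.transAt w) π.kernel (fun h s a => M.r h (s, a, w)) M.s₁ :=
  rfl

lemma CMDP.value_mem_Icc (M : CMDP H W S A) (w : W) (π : Policy H S A) :
    M.value w π ∈ Set.Icc (0 : ℝ) H := by
  rw [M.value_eq_expSum, ← mul_one (H : ℝ)]
  exact expSum_mem_Icc (M.transAt w) π.kernel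
    (fun h => measurable_uncurry_of_context (M.r_measurable h) w)
    (fun h s a => M.r_mem h (s, a, w)) M.s₁

lemma CMDP.value_le_optValue (M : CMDP H W S A) (w : W) (π : Policy H S A) :
    M.value w π ≤ M.optValue w :=
  le_ciSup (f := M.value w) ⟨H, by rintro _ ⟨π, rfl⟩; exact (M.value_mem_Icc w π).2⟩ π

lemma Learner.integral_gap_le_horizon (L : Learner H d W S A) (M : CMDP H W S A)
    (D : Fin i → Episode H W S A) :
    ∫ w, (M.optValue w - M.value w (L.policy i D w)) ∂M.q ≤ H := by
  have hgap : ∀ w, M.optValue w - M.value w (L.policy i D w) ≤ H := fun w => by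
    have : Nonempty (Policy H S A) := ⟨L.policy i D w⟩
    have hopt : M.optValue w ≤ H := ciSup_le fun π => (M.value_mem_Icc w π).2
    linarith [(M.value_mem_Icc w (L.policy i D w)).1]
  simpa using integral_mono_of_nonneg (μ := M.q)
    (ae_of_all _ fun w => sub_nonneg.2 (M.value_le_optValue w _))
    (integrable_const (H : ℝ)) (ae_of_all _ hgap)

end Value

section Accuracy

variable {H d i K : ℕ} {W S A : Type*} [MeasurableSpace S] {ν : Measure S}
  {φ : Fin H → S × A × W → Vec d} {μ m : Fin H → S → Vec d} {γ₁ δ : ℝ}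
  {D : Fin i → Episode H W S A} {V : S → ℝ}

/-- The Hellinger error of the transition model given by the weights `m` on the data `D` is within
the confidence level that a maximum likelihood estimate satisfies with high probability. -/
def IsAccurate (ν : Measure S) (φ : Fin H → S × A × W → Vec d) (μ : Fin H → S → Vec d) (K : ℕ)
    (δ : ℝ) (D : Fin i → Episode H W S A) (m : Fin H → S → Vec d) : Prop :=
  ∀ h, dataError ν φ μ D h (m h) ≤ 2 * Real.log (2 * (i + 1 : ℕ) * H * K / δ)

lemma IsAccurate.abs_integral_sub_le (hD : IsAccurate ν φ μ K δ D m)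
    (hμ : ∀ h, IsWeight ν (φ h) (μ h)) (hm : ∀ h, IsWeight ν (φ h) (m h))
    (hreg : 0 < reg γ₁ d H δ (i + 1)) (hV : Measurable V) {B : ℝ} (hB0 : 0 < B)
    (hB : ∀ s, V s ∈ Set.Icc 0 B) (h : Fin H) (x : S × A × W) :
    |∫ s, inner ℝ (φ h x) (μ h s) * V s ∂ν - ∫ s, inner ℝ (φ h x) (m h s) * V s ∂ν| ≤
      2 * B * radius γ₁ d H K δ (i + 1) * featNorm φ (reg γ₁ d H δ (i + 1)) D h x := by
  set T := 2 * Real.log (2 * (i + 1 : ℕ) * H * K / δ)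
  have hT0 : 0 ≤ T := (Finset.sum_nonneg fun τ _ =>
    ((hμ h).isDensity _).hellingerSq_nonneg ((hm h).isDensity _)).trans (hD h)
  have hsqrt : √(4 * d * reg γ₁ d H δ (i + 1) + 8 * T) ≤ 2 * radius γ₁ d H K δ (i + 1) := by
    have hdreg : 0 ≤ d * reg γ₁ d H δ (i + 1) := by positivity
    rw [← Real.sqrt_sq zero_le_two, radius, ← Real.sqrt_mul (sq_nonneg 2)]
    exact Real.sqrt_le_sqrt (by linarith)
  refine ((hμ h).abs_integral_inner_mul_sub_le (hm h) (fun τ => visit (D τ) h) hreg hT0 (hD h) hV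
    hB0 hB x).trans (mul_le_mul_of_nonneg_right ?_ (matNorm_nonneg _ _))
  calc B * √(4 * d * reg γ₁ d H δ (i + 1) + 8 * T) ≤ B * (2 * radius γ₁ d H K δ (i + 1)) := by
        gcongr
    _ = 2 * B * radius γ₁ d H K δ (i + 1) := by ring

end Accuracy

section Optimism

variable {H d i K : ℕ} {W S A : Type*} [MeasurableSpace W] [MeasurableSpace S] [MeasurableSpace A]
  {M : CMDP H W S A} {ν : Measure S} {φ ψ : Fin H → S × A × W → Vec d}
  {μ m : Fin H → S → Vec d} {η : Fin H → Vec d} {Ψ : Finset (S → Vec d)} {γ₁ γ₂ δ : ℝ}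
  {D : Fin i → Episode H W S A} {V : S → ℝ}

lemma IsModelI.integral_trans (hM : IsModelI M ν φ ψ μ η) (h : Fin H) (x : S × A × W)
    (V : S → ℝ) : ∫ s, V s ∂(M.P h x) = ∫ s, inner ℝ (φ h x) (μ h s) * V s ∂ν := by
  rw [hM.trans_eq, integral_withDensity_eq_integral_toReal_smul
    ((hM.weight h).isDensity x).measurable.ennreal_ofReal (ae_of_all _ fun _ => by simp)]
  simp_rw [ENNReal.toReal_ofReal ((hM.weight h).nonneg x _), smul_eq_mul]

lemma abs_max_zero_min_one_sub_le {y r : ℝ} (hr : r ∈ Set.Icc (0 : ℝ) 1) :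
    |max 0 (min 1 y) - r| ≤ |y - r| := by
  simpa [Set.coe_projIcc, Set.projIcc_of_mem zero_le_one hr] using
    Set.abs_projIcc_sub_projIcc (h := zero_le_one) (c := y) (d := r)

lemma IsModelI.abs_clip_ridge_sub_le (hM : IsModelI M ν φ ψ μ η)
    (hreg : 0 < reg γ₂ d H δ (i + 1)) (D : Fin i → Episode H W S A) (h : Fin H)
    (x : S × A × W) :
    |max 0 (min 1 (inner ℝ (ridge M ψ (reg γ₂ d H δ (i + 1)) D h) (ψ h x))) - M.r h x| ≤
      beta γ₂ d H δ (i + 1) * featNorm ψ (reg γ₂ d H δ (i + 1)) D h x := by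
  have hridge := abs_inner_ridge_sub_le (fun τ => ψ h (visit (D τ) h)) hreg (η h) (ψ h x)
  simp only [← hM.reward_eq] at hridge
  refine (abs_max_zero_min_one_sub_le (M.r_mem h x)).trans (hridge.trans ?_)
  refine mul_le_mul_of_nonneg_right ?_ (matNorm_nonneg _ _)
  rw [beta, mul_comm (d : ℝ), Real.sqrt_mul hreg.le]
  gcongr
  exact hM.η_norm_le h

namespace IsAccurate

lemma reward_add_integral_le (hD : IsAccurate ν φ μ K δ D m) (hM : IsModelI M ν φ ψ μ η)
    (hm : ∀ h, IsWeight ν (φ h) (m h)) (h₁ : 0 < reg γ₁ d H δ (i + 1))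
    (h₂ : 0 < reg γ₂ d H δ (i + 1)) (hV : Measurable V) (hVH : ∀ s, V s ∈ Set.Icc (0 : ℝ) H)
    (h : Fin H) (x : S × A × W) :
    M.r h x + ∫ s, V s ∂(M.P h x) ≤
      optReward M φ ψ K γ₁ γ₂ δ D h x + ∫ s, inner ℝ (φ h x) (m h s) * V s ∂ν := by
  set f := max 0 (min 1 (inner ℝ (ridge M ψ (reg γ₂ d H δ (i + 1)) D h) (ψ h x))) with hf
  have hH : (0 : ℝ) < H := Nat.cast_pos.2 h.pos
  have hreward : M.r h x ≤
      f + min (beta γ₂ d H δ (i + 1) * featNorm ψ (reg γ₂ d H δ (i + 1)) D h x) 1 := by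
    rw [← sub_le_iff_le_add']
    refine le_min ?_ (by linarith [(M.r_mem h x).2, le_max_left 0 _ |>.trans_eq hf.symm])
    linarith [neg_le_of_abs_le (hM.abs_clip_ridge_sub_le h₂ D h x)]
  have htrans : ∫ s, V s ∂(M.P h x) ≤ ∫ s, inner ℝ (φ h x) (m h s) * V s ∂ν +
      min (alpha γ₁ d H K δ (i + 1) * featNorm φ (reg γ₁ d H δ (i + 1)) D h x) H := by
    have herr := le_of_abs_le (hD.abs_integral_sub_le hM.weight hm h₁ hV hH hVH h x)
    have hint : 0 ≤ ∫ s, inner ℝ (φ h x) (m h s) * V s ∂ν :=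
      integral_nonneg fun s => mul_nonneg ((hm h).nonneg x s) (hVH s).1
    rw [← sub_le_iff_le_add']
    refine le_min ?_ (by linarith [(integral_mem_Icc (P := M.P h x) hV hVH).2])
    rw [hM.integral_trans, alpha_eq]
    refine herr.trans ?_
    have := featNorm_nonneg (v := φ) (c := reg γ₁ d H δ (i + 1)) D h x
    have := radius_nonneg (γ₁ := γ₁) (d := d) (H := H) (K := K) (δ := δ) (n := i + 1)
    gcongr
    norm_num
  unfold optReward
  linarith

lemma optReward_add_integral_le (hD : IsAccurate ν φ μ K δ D m) (hM : IsModelI M ν φ ψ μ η)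
    (hm : ∀ h, IsWeight ν (φ h) (m h)) (h₁ : 0 < reg γ₁ d H δ (i + 1))
    (h₂ : 0 < reg γ₂ d H δ (i + 1)) (hV : Measurable V)
    (hVH : ∀ s, V s ∈ Set.Icc (0 : ℝ) (3 * H)) (h : Fin H) (x : S × A × W) :
    optReward M φ ψ K γ₁ γ₂ δ D h x + ∫ s, inner ℝ (φ h x) (m h s) * V s ∂ν ≤
      M.r h x + bonus φ ψ K γ₁ γ₂ δ D h x + ∫ s, V s ∂(M.P h x) := by
  have hH : (0 : ℝ) < 3 * H := mul_pos three_pos (Nat.cast_pos.2 h.pos)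
  have htrans := neg_le_of_abs_le (hD.abs_integral_sub_le hM.weight hm h₁ hV hH hVH h x)
  have hreward := le_of_abs_le (hM.abs_clip_ridge_sub_le h₂ D h x)
  have hα := min_le_left (alpha γ₁ d H K δ (i + 1) * featNorm φ (reg γ₁ d H δ (i + 1)) D h x) H
  have hβ := min_le_left (beta γ₂ d H δ (i + 1) * featNorm ψ (reg γ₂ d H δ (i + 1)) D h x) 1
  rw [alpha_eq] at hα
  rw [hM.integral_trans]
  unfold optReward bonus
  rw [alpha_eq]
  linarith

end IsAccurate

lemma optReward_nonneg (D : Fin i → Episode H W S A) (h : Fin H) (x : S × A × W) :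
    0 ≤ optReward M φ ψ K γ₁ γ₂ δ D h x :=
  add_nonneg (add_nonneg (le_max_left _ _)
    (le_min (mul_nonneg alpha_nonneg (featNorm_nonneg _ _ _)) H.cast_nonneg))
    (le_min (mul_nonneg beta_nonneg (featNorm_nonneg _ _ _)) zero_le_one)

lemma measurable_optReward (hφ : ∀ h, Measurable (φ h)) (hψ : ∀ h, Measurable (ψ h))
    (D : Fin i → Episode H W S A) (h : Fin H) :
    Measurable (optReward M φ ψ K γ₁ γ₂ δ D h) :=
  ((measurable_const.max (measurable_const.min (measurable_const.inner (hψ h)))).add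
    ((((measurable_featNorm hφ _ h).comp measurable_prodMk_left).const_mul _).min
      measurable_const)).add
    ((((measurable_featNorm hψ _ h).comp measurable_prodMk_left).const_mul _).min measurable_const)

lemma isDensityMDP_optReward (hφ : ∀ h, Measurable (φ h)) (hψ : ∀ h, Measurable (ψ h))
    (hm : ∀ h, IsWeight ν (φ h) (m h)) (D : Fin i → Episode H W S A) (w : W) :
    IsDensityMDP ν (fun h s a => optReward M φ ψ K γ₁ γ₂ δ D h (s, a, w))
      fun h s a s' => inner ℝ (φ h (s, a, w)) (m h s') where
  measurable_reward h := measurable_uncurry_of_context (measurable_optReward hφ hψ D h) w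
  reward_nonneg h s a := optReward_nonneg D h (s, a, w)
  measurable_density h :=
    ((hφ h).comp (f := fun y : (S × A) × S => (y.1.1, y.1.2, w)) (by fun_prop)).inner
      ((hm h).measurable.comp measurable_snd)
  isDensity h s a := (hm h).isDensity (s, a, w)

namespace IsAccurate

variable [SFinite ν]

lemma value_le_plannedValue (hD : IsAccurate ν φ μ K δ D m) (hM : IsModelI M ν φ ψ μ η)
    (hm : ∀ h, IsWeight ν (φ h) (m h)) (h₁ : 0 < reg γ₁ d H δ (i + 1))
    (h₂ : 0 < reg γ₂ d H δ (i + 1)) (w : W) (π : Policy H S A) :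
    M.value w π ≤ plannedValue M ν φ ψ K γ₁ γ₂ δ D m w π :=
  (isDensityMDP_optReward hM.φ_measurable hM.ψ_measurable hm D w).expSum_le_truncValue
    (by linarith [H.cast_nonneg (α := ℝ)]) (M.transAt w) π.kernel
    (fun h => measurable_uncurry_of_context (M.r_measurable h) w) (fun h s a => M.r_mem h (s, a, w))
    le_rfl (fun h s a _ hV hVH => hD.reward_add_integral_le hM hm h₁ h₂ hV hVH h (s, a, w)) M.s₁

lemma plannedValue_le_value_add (hD : IsAccurate ν φ μ K δ D m) (hM : IsModelI M ν φ ψ μ η)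
    (hm : ∀ h, IsWeight ν (φ h) (m h)) (h₁ : 1 ≤ reg γ₁ d H δ (i + 1))
    (h₂ : 1 ≤ reg γ₂ d H δ (i + 1)) (w : W) (π : Policy H S A) :
    plannedValue M ν φ ψ K γ₁ γ₂ δ D m w π ≤ M.value w π +
      expSum (M.transAt w) π.kernel (fun h s a => bonus φ ψ K γ₁ γ₂ δ D h (s, a, w)) M.s₁ := by
  have hr : ∀ h, Measurable (Function.uncurry fun s a => M.r h (s, a, w)) := fun h =>
    measurable_uncurry_of_context (M.r_measurable h) w
  have hb : ∀ h, Measurable (Function.uncurry fun s a => bonus φ ψ K γ₁ γ₂ δ D h (s, a, w)) :=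
    fun h => measurable_uncurry_of_context (measurable_bonus hM.φ_measurable hM.ψ_measurable D h) w
  have hb0 : ∀ h x, 0 ≤ bonus φ ψ K γ₁ γ₂ δ D h x := bonus_nonneg D
  have hbC := bonus_le (K := K) hM.φ_norm_le hM.ψ_norm_le h₁ h₂ D
  have hrb : ∀ h, Measurable (Function.uncurry fun s a =>
      M.r h (s, a, w) + bonus φ ψ K γ₁ γ₂ δ D h (s, a, w)) := fun h => (hr h).add (hb h)
  rw [M.value_eq_expSum, ← expSum_add (M.transAt w) π.kernel hr hb
    (fun h s a => (abs_of_nonneg (M.r_mem h (s, a, w)).1).trans_le (M.r_mem h (s, a, w)).2)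
    fun h s a => (abs_of_nonneg (hb0 h (s, a, w))).trans_le (hbC h (s, a, w))]
  exact (isDensityMDP_optReward hM.φ_measurable hM.ψ_measurable hm D w).truncValue_le_expSum
    (by positivity) (M.transAt w) π.kernel hrb
    (fun h s a => ⟨add_nonneg (M.r_mem h (s, a, w)).1 (hb0 h (s, a, w)),
      add_le_add (M.r_mem h (s, a, w)).2 (hbC h (s, a, w))⟩)
    (fun h s a _ hV hVH => hD.optReward_add_integral_le hM hm (one_pos.trans_le h₁)
      (one_pos.trans_le h₂) hV hVH h (s, a, w)) M.s₁

end IsAccurate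

variable [SFinite ν]

lemma Learner.RunsUCB.gap_le_expSum_bonus {L : Learner H d W S A}
    (hL : L.RunsUCB M ν φ ψ Ψ γ₁ γ₂ δ) (hM : IsModelI M ν φ ψ μ η) (hΨ : IsModelClass ν φ μ Ψ)
    (hi : 1 ≤ i) (h₁ : 1 ≤ reg γ₁ d H δ (i + 1)) (h₂ : 1 ≤ reg γ₂ d H δ (i + 1))
    (hD : IsAccurate ν φ μ Ψ.card δ D (L.muHat i D)) (w : W) :
    M.optValue w - M.value w (L.policy i D w) ≤
      expSum (M.transAt w) (L.policy i D w).kernel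
        (fun h s a => bonus φ ψ Ψ.card γ₁ γ₂ δ D h (s, a, w)) M.s₁ := by
  have hm : ∀ h, IsWeight ν (φ h) (L.muHat i D h) := fun h =>
    hΨ.admissible _ (hL.mle_mem i hi D h) h
  have : Nonempty (Policy H S A) := ⟨L.policy i D w⟩
  have hopt : M.optValue w ≤
      plannedValue M ν φ ψ Ψ.card γ₁ γ₂ δ D (L.muHat i D) w (L.policy i D w) :=
    ciSup_le fun π => (hD.value_le_plannedValue hM hm (one_pos.trans_le h₁) (one_pos.trans_le h₂) w
      π).trans (hL.planning i hi D w π)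
  linarith [hD.plannedValue_le_value_add hM hm h₁ h₂ w (L.policy i D w)]

lemma Learner.RunsUCB.integral_gap_le {L : Learner H d W S A}
    (hL : L.RunsUCB M ν φ ψ Ψ γ₁ γ₂ δ) (hM : IsModelI M ν φ ψ μ η) (hΨ : IsModelClass ν φ μ Ψ)
    (hi : 1 ≤ i) (h₁ : 1 ≤ reg γ₁ d H δ (i + 1)) (h₂ : 1 ≤ reg γ₂ d H δ (i + 1))
    (hD : IsAccurate ν φ μ Ψ.card δ D (L.muHat i D)) :
    ∫ w, (M.optValue w - M.value w (L.policy i D w)) ∂M.q ≤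
      ∫ e, ∑ h, bonus φ ψ Ψ.card γ₁ γ₂ δ D h (visit e h) ∂(L.stepKernel M i D) := by
  set C := 11 * H * radius γ₁ d H Ψ.card δ (i + 1) + 2 * beta γ₂ d H δ (i + 1)
  have hmeas : Measurable fun e : Episode H W S A =>
      ∑ h, bonus φ ψ Ψ.card γ₁ γ₂ δ D h (visit e h) :=
    Finset.measurable_sum _ fun h _ =>
      (measurable_bonus hM.φ_measurable hM.ψ_measurable D h).comp (measurable_visit h)
  have hbound : ∀ e : Episode H W S A,
      ∑ h, bonus φ ψ Ψ.card γ₁ γ₂ δ D h (visit e h) ∈ Set.Icc 0 (H * C) := fun e =>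
    ⟨Finset.sum_nonneg fun h _ => bonus_nonneg D h _, (Finset.sum_le_sum fun h _ =>
      bonus_le hM.φ_norm_le hM.ψ_norm_le h₁ h₂ D h _).trans_eq (by simp [C, mul_add])⟩
  rw [L.integral_stepKernel M i D hmeas fun e =>
    (abs_of_nonneg (hbound e).1).trans_le (hbound e).2]
  refine integral_mono_of_nonneg (ae_of_all _ fun w => sub_nonneg.2 (M.value_le_optValue w _)) ?_
    (ae_of_all _ fun w => hL.gap_le_expSum_bonus hM hΨ hi h₁ h₂ hD w)
  exact Integrable.of_mem_Icc 0 (H * C)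
    (L.measurable_integral_episodeLaw M i D hmeas).aemeasurable
    (ae_of_all _ fun w =>
      integral_mem_Icc (hmeas.comp measurable_prodMk_left) fun τ => hbound (w, τ))

end Optimism

lemma integral_le_sqrt_integral_sq {Y : Type*} [MeasurableSpace Y] {μ : Measure Y}
    [IsProbabilityMeasure μ] {f : Y → ℝ} (hf : MemLp f 2 μ) :
    ∫ y, f y ∂μ ≤ √(∫ y, f y ^ 2 ∂μ) := by
  have hvar := variance_nonneg f μ
  rw [variance_eq_sub hf] at hvar
  exact Real.le_sqrt_of_sq_le (sub_nonneg.1 hvar)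

lemma sum_sqrt_le_sqrt_card_mul {ι : Type*} (s : Finset ι) {E : ι → ℝ} (hE : ∀ i, 0 ≤ E i) :
    ∑ i ∈ s, √(E i) ≤ √(s.card * ∑ i ∈ s, E i) := by
  have hsq := sq_sum_le_card_mul_sum_sq (s := s) (f := fun i => √(E i))
  simp only [Real.sq_sqrt (hE _)] at hsq
  exact Real.le_sqrt_of_sq_le hsq

section Potential

variable {H d i : ℕ} {W S A : Type*} [MeasurableSpace W] [MeasurableSpace S] [MeasurableSpace A]
  (L : Learner H d W S A) (M : CMDP H W S A) {v : Fin H → S × A × W → Vec d} {c c' δ : ℝ}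

/-- The conditional mean, given the data `D`, of the squared feature norm `‖v_h‖²` of the next
episode at step `h`. -/
noncomputable def Learner.meanSqFeatNorm (v : Fin H → S × A × W → Vec d) (c : ℝ)
    (D : Fin i → Episode H W S A) (h : Fin H) : ℝ :=
  ∫ e, featNorm v c D h (visit e h) ^ 2 ∂(L.stepKernel M i D)

lemma Learner.meanSqFeatNorm_nonneg (D : Fin i → Episode H W S A) (h : Fin H) :
    0 ≤ L.meanSqFeatNorm M v c D h :=
  integral_nonneg fun _ => sq_nonneg _

lemma Learner.memLp_featNorm_visit (hv : ∀ h, Measurable (v h)) (hv1 : ∀ h x, ‖v h x‖ ≤ 1)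
    (hc : 0 < c) (D : Fin i → Episode H W S A) (h : Fin H) (p : ℝ≥0∞) :
    MemLp (fun e => featNorm v c D h (visit e h)) p (L.stepKernel M i D) :=
  memLp_of_bounded (ae_of_all _ fun _ => ⟨featNorm_nonneg D h _, featNorm_le hv1 hc D h _⟩)
    ((measurable_featNorm hv c h).comp
      (measurable_prodMk_left.comp (measurable_visit h))).aestronglyMeasurable p

lemma Learner.integral_featNorm_le (hv : ∀ h, Measurable (v h)) (hv1 : ∀ h x, ‖v h x‖ ≤ 1)
    (hc : 0 < c) (hcc' : c ≤ c') (D : Fin i → Episode H W S A) (h : Fin H) :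
    ∫ e, featNorm v c' D h (visit e h) ∂(L.stepKernel M i D) ≤ √(L.meanSqFeatNorm M v c D h) :=
  calc ∫ e, featNorm v c' D h (visit e h) ∂(L.stepKernel M i D)
      ≤ ∫ e, featNorm v c D h (visit e h) ∂(L.stepKernel M i D) :=
        integral_mono_of_nonneg (ae_of_all _ fun _ => featNorm_nonneg D h _)
          ((L.memLp_featNorm_visit M hv hv1 hc D h 1).integrable le_rfl)
          (ae_of_all _ fun _ => matNorm_gram_inv_anti _ hc hcc' _)
    _ ≤ √(L.meanSqFeatNorm M v c D h) :=
        integral_le_sqrt_integral_sq (L.memLp_featNorm_visit M hv hv1 hc D h 2)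

/-- The high-probability bound on the sum over `N` episodes of the conditional mean squared feature
norms with regularizer `c`: twice the elliptic potential, plus the deviation term. -/
noncomputable def potentialBound (d H : ℕ) (c δ : ℝ) (N : ℕ) : ℝ :=
  4 * d * Real.log (1 + N / (d * c)) + 2 * Real.log (2 * H / δ) / c

lemma Learner.sum_meanSqFeatNorm_le_potentialBound (hv1 : ∀ h x, ‖v h x‖ ≤ 1) (hc : 1 ≤ c)
    (hd : 1 ≤ d) {N : ℕ} {x : Fin N → Episode H W S A} {h : Fin H}
    (hx : ∑ i : Fin N, ∫ e, c * featNorm v c (history x i) h (visit e h) ^ 2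
        ∂(L.stepKernel M i (history x i)) ≤
      2 * (∑ i : Fin N, c * featNorm v c (history x i) h (visit (x i) h) ^ 2 +
        Real.log (2 * H / δ))) :
    ∑ i : Fin N, L.meanSqFeatNorm M v c (history x i) h ≤ potentialBound d H c δ N := by
  have hc0 : 0 < c := one_pos.trans_le hc
  have hpotential : ∑ i : Fin N, featNorm v c (history x i) h (visit (x i) h) ^ 2 ≤
      2 * d * Real.log (1 + N / (d * c)) :=
    elliptical_potential_le hc hd (fun τ => v h (visit (x τ) h)) fun τ => hv1 h _
  simp only [integral_const_mul, ← Finset.mul_sum] at hx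
  rw [← le_div_iff₀' hc0] at hx
  calc _ ≤ 2 * (c * ∑ i : Fin N, featNorm v c (history x i) h (visit (x i) h) ^ 2 +
        Real.log (2 * H / δ)) / c := hx
    _ = 2 * ∑ i : Fin N, featNorm v c (history x i) h (visit (x i) h) ^ 2 +
        2 * Real.log (2 * H / δ) / c := by field_simp
    _ ≤ potentialBound d H c δ N := by unfold potentialBound; linarith

lemma Learner.measure_exists_potentialBound_lt_le (hv : ∀ h, Measurable (v h))
    (hv1 : ∀ h x, ‖v h x‖ ≤ 1) (hc : 1 ≤ c) (hd : 1 ≤ d) (hH : 1 ≤ H) (hδ : 0 < δ) (N : ℕ) :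
    L.runLaw M N {x | ∃ h, potentialBound d H c δ N <
      ∑ i : Fin N, L.meanSqFeatNorm M v c (history x i) h} ≤ ENNReal.ofReal (δ / 2) := by
  have : (0 : ℝ) < H := by exact_mod_cast hH
  have hmeas : ∀ h i, Measurable (Function.uncurry fun (D : Fin i → Episode H W S A) e =>
      c * featNorm v c D h (visit e h) ^ 2) := fun h i =>
    (((measurable_featNorm hv c h).comp (measurable_fst.prodMk
      ((measurable_visit h).comp measurable_snd))).pow_const 2).const_mul c
  let bad (h : Fin H) : Set (Fin N → Episode H W S A) :=
    {x | 2 * (∑ i : Fin N, c * featNorm v c (history x i) h (visit (x i) h) ^ 2 +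
        Real.log (2 * H / δ)) <
      ∑ i : Fin N, ∫ e, c * featNorm v c (history x i) h (visit e h) ^ 2
        ∂(L.stepKernel M i (history x i))}
  have hbad : ∀ h, L.runLaw M N (bad h) ≤ ENNReal.ofReal (δ / (2 * H)) := fun h => by
    refine (L.runLaw_eq_seqLaw M N ▸ measure_sum_integral_gt_le (hmeas h) (fun _ D _ =>
      mul_featNorm_sq_mem_Icc hv1 (one_pos.trans_le hc) D h _) N _).trans_eq ?_
    rw [Real.exp_neg, Real.exp_log (by positivity), inv_div]
  calc _ ≤ L.runLaw M N (⋃ h, bad h) := by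
        refine measure_mono fun x ⟨h, hx⟩ => Set.mem_iUnion.2 ⟨h, ?_⟩
        by_contra hgood
        exact hx.not_ge (L.sum_meanSqFeatNorm_le_potentialBound M hv1 hc hd (not_lt.1 hgood))
    _ ≤ ∑ _h : Fin H, ENNReal.ofReal (δ / (2 * H)) :=
        (measure_iUnion_fintype_le _ _).trans (Finset.sum_le_sum fun h _ => hbad h)
    _ = ENNReal.ofReal (δ / 2) := by
        rw [Finset.sum_const, Finset.card_univ, Fintype.card_fin, nsmul_eq_mul,
          ← ENNReal.ofReal_natCast, ← ENNReal.ofReal_mul (by positivity)]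
        congr 1
        field_simp

end Potential

section RegretBound

variable {γ γ₁ γ₂ δ : ℝ} {d H K N : ℕ}

/-- The right-hand side of the regret bound, for a model class of cardinality `K`. -/
noncomputable def regretBound (γ₁ γ₂ δ : ℝ) (d H K N : ℕ) : ℝ :=
  (42 * H * √(2 * d * reg γ₁ d H δ N + 4 * Real.log (2 * H * N * K / δ))
      + 6 * √(d * reg γ₂ d H δ N))
    * (H * √(2 * d / N))
    * √(Real.log (1 + N / (d * min (reg γ₁ d H δ 1) (reg γ₂ d H δ 1))))

lemma regretBound_eq : regretBound γ₁ γ₂ δ d H K N =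
    (42 * H * radius γ₁ d H K δ N + 6 * beta γ₂ d H δ N) * (H * √(2 * d / N)) *
      √(Real.log (1 + N / (d * min (reg γ₁ d H δ 1) (reg γ₂ d H δ 1)))) := by
  unfold regretBound radius beta
  rw [mul_right_comm 2 (d : ℝ), mul_right_comm 2 (H : ℝ)]

lemma mul_regretBound (hN : 1 ≤ N) : N * regretBound γ₁ γ₂ δ d H K N =
    (42 * H * radius γ₁ d H K δ N + 6 * beta γ₂ d H δ N) * H *
      √(2 * d * N * Real.log (1 + N / (d * min (reg γ₁ d H δ 1) (reg γ₂ d H δ 1)))) := by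
  have hN0 : (0 : ℝ) < N := by exact_mod_cast hN
  have hsqrt : √(2 * d * N) = N * √(2 * d / N) := by
    rw [show 2 * (d : ℝ) * N = N ^ 2 * (2 * d / N) by field_simp, Real.sqrt_mul (by positivity),
      Real.sqrt_sq hN0.le]
  rw [regretBound_eq, Real.sqrt_mul (by positivity), hsqrt]
  ring

lemma log_mul_card_nonneg (hK : 1 ≤ K) (hH : 1 ≤ H) (hδ : 0 < δ) (hδ1 : δ < 1) (hN : 1 ≤ N) :
    0 ≤ Real.log (2 * N * H * K / δ) := by
  have hlog := half_le_log (mul_le_mul' hH hK) hδ hδ1 hN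
  rw [Nat.cast_mul, ← mul_assoc] at hlog
  linarith

lemma two_mul_reg_le_radius_sq (hK : 1 ≤ K) (hH : 1 ≤ H) (hδ : 0 < δ) (hδ1 : δ < 1) (hN : 1 ≤ N) :
    2 * reg γ₁ d H δ N * d ≤ radius γ₁ d H K δ N ^ 2 := by
  rw [radius, Real.sq_sqrt']
  exact le_max_of_le_left (by linarith [log_mul_card_nonneg hK hH hδ hδ1 hN])

lemma one_le_radius (hγ₁ : 2 ≤ γ₁) (hd : 1 ≤ d) (hK : 1 ≤ K) (hH : 1 ≤ H) (hδ : 0 < δ)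
    (hδ1 : δ < 1) (hN : 1 ≤ N) : 1 ≤ radius γ₁ d H K δ N := by
  have hreg := one_le_reg hγ₁ hd hH hδ hδ1 hN
  have hd1 : (1 : ℝ) ≤ d := by exact_mod_cast hd
  exact (one_le_sq_iff₀ radius_nonneg).1 (le_trans (by nlinarith)
    (two_mul_reg_le_radius_sq (d := d) hK hH hδ hδ1 hN))

lemma horizon_le_regretBound (hK : 1 ≤ K) (hH : 1 ≤ H) (hd : 1 ≤ d) (hδ : 0 < δ) (hδ1 : δ < 1)
    (hN : 1 ≤ N) (hγ₁ : 2 ≤ γ₁) (hγ₂ : 2 ≤ γ₂)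
    (hNd : (N : ℝ) ≤ d * min (reg γ₁ d H δ 1) (reg γ₂ d H δ 1)) :
    (H : ℝ) ≤ regretBound γ₁ γ₂ δ d H K N := by
  have hlam1 : 1 ≤ min (reg γ₁ d H δ 1) (reg γ₂ d H δ 1) :=
    le_min (one_le_reg hγ₁ hd hH hδ hδ1 le_rfl) (one_le_reg hγ₂ hd hH hδ hδ1 le_rfl)
  have hlamN : min (reg γ₁ d H δ 1) (reg γ₂ d H δ 1) ≤ reg γ₁ d H δ N :=
    (min_le_left _ _).trans (reg_mono (by linarith) hH hδ le_rfl hN)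
  rw [regretBound_eq]
  set lam := min (reg γ₁ d H δ 1) (reg γ₂ d H δ 1)
  set Y := radius γ₁ d H K δ N
  set l := Real.log (1 + N / (d * lam))
  have : (0 : ℝ) < N := by exact_mod_cast hN
  have hd1 : (1 : ℝ) ≤ d := by exact_mod_cast hd
  have hH1 : (1 : ℝ) ≤ H := by exact_mod_cast hH
  have hY0 : 0 ≤ Y := radius_nonneg
  have hY : 2 * lam * d ≤ Y ^ 2 :=
    le_trans (by gcongr) (two_mul_reg_le_radius_sq hK hH hδ hδ1 hN)
  have hl : N / (d * lam) / 2 ≤ l := by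
    have hle : N / (d * lam) ≤ 2 := (div_le_one₀ (by positivity)).2 hNd |>.trans one_le_two
    linarith [le_two_mul_log_one_add (by positivity) hle]
  have hone : 1 ≤ Y * √(2 * d / N) * √l := by
    refine (one_le_sq_iff₀ (by positivity)).1 ?_
    rw [mul_pow, mul_pow, Real.sq_sqrt (by positivity),
      Real.sq_sqrt (hl.trans' (by positivity))]
    calc (1 : ℝ) ≤ 2 * d := by linarith
      _ = (2 * lam * d) * (2 * d / N) * (N / (d * lam) / 2) := by field_simp
      _ ≤ Y ^ 2 * (2 * d / N) * l := by gcongr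
  calc (H : ℝ) ≤ 42 * H * H * 1 := by nlinarith
    _ ≤ 42 * H * H * (Y * √(2 * d / N) * √l) := by gcongr
    _ = (42 * H * Y) * (H * √(2 * d / N)) * √l := by ring
    _ ≤ (42 * H * Y + 6 * beta γ₂ d H δ N) * (H * √(2 * d / N)) * √l := by
      gcongr
      linarith [beta_nonneg (γ := γ₂) (d := d) (H := H) (δ := δ) (n := N)]

lemma two_mul_log_div_reg_le_one (hγ : 2 ≤ γ) (hd : 1 ≤ d) (hH : 1 ≤ H) (hδ : 0 < δ)
    (hδ1 : δ < 1) : 2 * Real.log (2 * H / δ) / reg γ d H δ 1 ≤ 1 := by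
  have hγd : 2 ≤ γ * d := by nlinarith [show (1 : ℝ) ≤ d by exact_mod_cast hd]
  have hlog := half_le_log hH hδ hδ1 le_rfl
  rw [div_le_one (one_pos.trans_le (one_le_reg hγ hd hH hδ hδ1 le_rfl)), reg, Nat.cast_one,
    mul_one] at *
  gcongr

lemma half_le_log_one_add {x : ℝ} (hx : 1 ≤ x) : 1 / 2 ≤ Real.log (1 + x) := by
  linarith [Real.log_le_log two_pos (show (2 : ℝ) ≤ 1 + x by linarith), Real.log_two_gt_d9]

lemma potentialBound_le {lam : ℝ} (hγ : 2 ≤ γ) (hd : 1 ≤ d) (hH : 1 ≤ H) (hδ : 0 < δ)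
    (hδ1 : δ < 1) (hlam : 0 < lam) (hle : lam ≤ reg γ d H δ 1)
    (hl : 1 / 2 ≤ Real.log (1 + N / (d * lam))) :
    potentialBound d H (reg γ d H δ 1) δ N ≤ 6 * d * Real.log (1 + N / (d * lam)) := by
  have hd1 : (1 : ℝ) ≤ d := by exact_mod_cast hd
  have hreg := hlam.trans_le hle
  have hlog : Real.log (1 + N / (d * reg γ d H δ 1)) ≤ Real.log (1 + N / (d * lam)) := by gcongr
  calc potentialBound d H (reg γ d H δ 1) δ N
      ≤ 4 * d * Real.log (1 + N / (d * lam)) + 1 := by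
        unfold potentialBound
        gcongr
        exact two_mul_log_div_reg_le_one hγ hd hH hδ hδ1
    _ ≤ 6 * d * Real.log (1 + N / (d * lam)) := by nlinarith

end RegretBound

section Regret

variable {H d : ℕ} {W S A : Type*} [MeasurableSpace W] [MeasurableSpace S] [MeasurableSpace A]
  {M : CMDP H W S A} {ν : Measure S} {φ ψ : Fin H → S × A × W → Vec d}
  {μ : Fin H → S → Vec d} {η : Fin H → Vec d} {Ψ : Finset (S → Vec d)} {γ₁ γ₂ δ : ℝ}

lemma Learner.integral_sum_bonus_le (L : Learner H d W S A) (hM : IsModelI M ν φ ψ μ η) {K : ℕ}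
    (hK : 1 ≤ K) (hH : 1 ≤ H) (hd : 1 ≤ d) (hδ : 0 < δ) (hδ1 : δ < 1) (hγ₁ : 2 ≤ γ₁)
    (hγ₂ : 2 ≤ γ₂) {i N : ℕ} (hi : i < N) (D : Fin i → Episode H W S A) :
    ∫ e, ∑ h, bonus φ ψ K γ₁ γ₂ δ D h (visit e h) ∂(L.stepKernel M i D) ≤
      ∑ h, (11 * H * radius γ₁ d H K δ N * √(L.meanSqFeatNorm M φ (reg γ₁ d H δ 1) D h) +
        2 * beta γ₂ d H δ N * √(L.meanSqFeatNorm M ψ (reg γ₂ d H δ 1) D h)) := by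
  have hi1 : 1 ≤ i + 1 := Nat.le_add_left 1 i
  have hc : ∀ {γ}, 2 ≤ γ → ∀ {n}, 1 ≤ n → 0 < reg γ d H δ n := fun hγ _ hn =>
    one_pos.trans_le (one_le_reg hγ hd hH hδ hδ1 hn)
  have hφ : ∀ h, Integrable (fun e => featNorm φ (reg γ₁ d H δ (i + 1)) D h (visit e h))
      (L.stepKernel M i D) := fun h => (L.memLp_featNorm_visit M hM.φ_measurable hM.φ_norm_le
    (hc hγ₁ hi1) D h 1).integrable le_rfl
  have hψ : ∀ h, Integrable (fun e => featNorm ψ (reg γ₂ d H δ (i + 1)) D h (visit e h))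
      (L.stepKernel M i D) := fun h => (L.memLp_featNorm_visit M hM.ψ_measurable hM.ψ_norm_le
    (hc hγ₂ hi1) D h 1).integrable le_rfl
  rw [integral_finsetSum (f := fun h e => bonus φ ψ K γ₁ γ₂ δ D h (visit e h)) _ fun h _ =>
    ((hφ h).const_mul _).add ((hψ h).const_mul _)]
  refine Finset.sum_le_sum fun h _ => ?_
  unfold bonus
  rw [integral_add ((hφ h).const_mul _) ((hψ h).const_mul _), integral_const_mul,
    integral_const_mul]
  have hγ₁0 : 0 ≤ γ₁ := zero_le_two.trans hγ₁
  have hγ₂0 : 0 ≤ γ₂ := zero_le_two.trans hγ₂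
  have hφh := L.integral_featNorm_le M hM.φ_measurable hM.φ_norm_le (hc hγ₁ le_rfl)
    (reg_mono hγ₁0 hH hδ le_rfl hi1) D h
  have hψh := L.integral_featNorm_le M hM.ψ_measurable hM.ψ_norm_le (hc hγ₂ le_rfl)
    (reg_mono hγ₂0 hH hδ le_rfl hi1) D h
  gcongr
  · exact integral_nonneg fun _ => featNorm_nonneg D h _
  · exact mul_nonneg (by positivity) radius_nonneg
  · exact radius_mono hγ₁0 hK hH hδ hi1 hi
  · exact integral_nonneg fun _ => featNorm_nonneg D h _
  · exact mul_nonneg zero_le_two beta_nonneg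
  · exact beta_mono hγ₂0 hH hδ hi1 hi

lemma Learner.avgGap_eq (L : Learner H d W S A) (M : CMDP H W S A) {N : ℕ}
    (x : Fin N → Episode H W S A) : L.avgGap M x = (1 / N : ℝ) *
      ∑ i : Fin N, ∫ w, (M.optValue w - M.value w (L.policy i (history x i) w)) ∂M.q :=
  rfl

lemma Learner.avgGap_le_horizon (L : Learner H d W S A) (M : CMDP H W S A) {N : ℕ} (hN : 1 ≤ N)
    (x : Fin N → Episode H W S A) : L.avgGap M x ≤ H := by
  have hN0 : (0 : ℝ) < N := by exact_mod_cast hN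
  rw [L.avgGap_eq, one_div, inv_mul_le_iff₀ hN0]
  exact (Finset.sum_le_sum fun (i : Fin N) _ =>
    L.integral_gap_le_horizon M (history x i)).trans (by simp)

/-- The good event of the analysis: every maximum likelihood estimate along the run `x` is accurate,
and the conditional mean squared feature norms of the visited points sum to at most the elliptic
potential bound. The run `x` is indexed from `0`, so episode `0` carries no estimate. -/
structure Learner.IsTypical (L : Learner H d W S A) (M : CMDP H W S A) (ν : Measure S)
    (φ ψ : Fin H → S × A × W → Vec d) (μ : Fin H → S → Vec d) (K : ℕ) (γ₁ γ₂ δ : ℝ) {N : ℕ}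
    (x : Fin N → Episode H W S A) : Prop where
  isAccurate : ∀ i : Fin N, 1 ≤ (i : ℕ) →
    IsAccurate ν φ μ K δ (history x i) (L.muHat i (history x i))
  sum_φ_le : ∀ h, ∑ i : Fin N, L.meanSqFeatNorm M φ (reg γ₁ d H δ 1) (history x i) h ≤
    potentialBound d H (reg γ₁ d H δ 1) δ N
  sum_ψ_le : ∀ h, ∑ i : Fin N, L.meanSqFeatNorm M ψ (reg γ₂ d H δ 1) (history x i) h ≤
    potentialBound d H (reg γ₂ d H δ 1) δ N

variable {L : Learner H d W S A} {N : ℕ} {x : Fin N → Episode H W S A}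

lemma Learner.sum_sqrt_meanSqFeatNorm_le {v : Fin H → S × A × W → Vec d} {c B : ℝ} {h : Fin H}
    (hB : ∑ i : Fin N, L.meanSqFeatNorm M v c (history x i) h ≤ B) :
    ∑ i : Fin N, √(L.meanSqFeatNorm M v c (history x i) h) ≤ √(N * B) :=
  (sum_sqrt_le_sqrt_card_mul Finset.univ fun i : Fin N =>
    L.meanSqFeatNorm_nonneg M (history x i) h).trans
    (Real.sqrt_le_sqrt (by simpa using mul_le_mul_of_nonneg_left hB N.cast_nonneg))

variable [SFinite ν]

lemma Learner.IsTypical.integral_gap_le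
    (hx : L.IsTypical M ν φ ψ μ Ψ.card γ₁ γ₂ δ x) (hM : IsModelI M ν φ ψ μ η)
    (hΨ : IsModelClass ν φ μ Ψ) (hL : L.RunsUCB M ν φ ψ Ψ γ₁ γ₂ δ) (hH : 1 ≤ H) (hd : 1 ≤ d)
    (hδ : 0 < δ) (hδ1 : δ < 1) (hγ₁ : 2 ≤ γ₁) (hγ₂ : 2 ≤ γ₂) (hN : 1 ≤ N) (i : Fin N) :
    ∫ w, (M.optValue w - M.value w (L.policy i (history x i) w)) ∂M.q ≤
      (if i = ⟨0, hN⟩ then (H : ℝ) else 0) + ∑ h, (11 * H * radius γ₁ d H Ψ.card δ N *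
          √(L.meanSqFeatNorm M φ (reg γ₁ d H δ 1) (history x i) h) +
        2 * beta γ₂ d H δ N * √(L.meanSqFeatNorm M ψ (reg γ₂ d H δ 1) (history x i) h)) := by
  split_ifs with hi
  · have := radius_nonneg (γ₁ := γ₁) (d := d) (H := H) (K := Ψ.card) (δ := δ) (n := N)
    have := beta_nonneg (γ := γ₂) (d := d) (H := H) (δ := δ) (n := N)
    exact (L.integral_gap_le_horizon M _).trans (le_add_of_nonneg_right (by positivity))
  · have hK : 1 ≤ Ψ.card := Finset.card_pos.2 ⟨_, hΨ.realizable ⟨0, hH⟩⟩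
    have hi1 : 1 ≤ (i : ℕ) := Nat.one_le_iff_ne_zero.2 fun h0 => hi (Fin.ext h0)
    rw [zero_add]
    exact (hL.integral_gap_le hM hΨ hi1 (one_le_reg hγ₁ hd hH hδ hδ1 (by omega))
      (one_le_reg hγ₂ hd hH hδ hδ1 (by omega)) (hx.isAccurate i hi1)).trans
      (L.integral_sum_bonus_le hM hK hH hd hδ hδ1 hγ₁ hγ₂ i.isLt _)

lemma Learner.IsTypical.sum_integral_gap_le
    (hx : L.IsTypical M ν φ ψ μ Ψ.card γ₁ γ₂ δ x) (hM : IsModelI M ν φ ψ μ η)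
    (hΨ : IsModelClass ν φ μ Ψ) (hL : L.RunsUCB M ν φ ψ Ψ γ₁ γ₂ δ) (hH : 1 ≤ H) (hd : 1 ≤ d)
    (hδ : 0 < δ) (hδ1 : δ < 1) (hγ₁ : 2 ≤ γ₁) (hγ₂ : 2 ≤ γ₂) (hN : 1 ≤ N) :
    ∑ i : Fin N, ∫ w, (M.optValue w - M.value w (L.policy i (history x i) w)) ∂M.q ≤
      H + H * (11 * H * radius γ₁ d H Ψ.card δ N *
          √(N * potentialBound d H (reg γ₁ d H δ 1) δ N) +
        2 * beta γ₂ d H δ N * √(N * potentialBound d H (reg γ₂ d H δ 1) δ N)) := by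
  refine (Finset.sum_le_sum fun i _ =>
    hx.integral_gap_le hM hΨ hL hH hd hδ hδ1 hγ₁ hγ₂ hN i).trans ?_
  rw [Finset.sum_add_distrib, Finset.sum_ite_eq' Finset.univ, if_pos (Finset.mem_univ _),
    Finset.sum_comm]
  set Y := radius γ₁ d H Ψ.card δ N
  set β := beta γ₂ d H δ N
  have hY : 0 ≤ Y := radius_nonneg
  have hβ : 0 ≤ β := beta_nonneg
  gcongr
  calc _ ≤ ∑ _h : Fin H, (11 * H * Y * √(N * potentialBound d H (reg γ₁ d H δ 1) δ N) +
          2 * β * √(N * potentialBound d H (reg γ₂ d H δ 1) δ N)) := by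
        refine Finset.sum_le_sum fun h _ => ?_
        rw [Finset.sum_add_distrib, ← Finset.mul_sum, ← Finset.mul_sum]
        gcongr
        exacts [L.sum_sqrt_meanSqFeatNorm_le (hx.sum_φ_le h),
          L.sum_sqrt_meanSqFeatNorm_le (hx.sum_ψ_le h)]
    _ = H * (11 * H * Y * √(N * potentialBound d H (reg γ₁ d H δ 1) δ N) +
          2 * β * √(N * potentialBound d H (reg γ₂ d H δ 1) δ N)) := by
        rw [Finset.sum_const, Finset.card_univ, Fintype.card_fin, nsmul_eq_mul]

lemma Learner.IsTypical.avgGap_le_regretBound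
    (hx : L.IsTypical M ν φ ψ μ Ψ.card γ₁ γ₂ δ x) (hM : IsModelI M ν φ ψ μ η)
    (hΨ : IsModelClass ν φ μ Ψ) (hL : L.RunsUCB M ν φ ψ Ψ γ₁ γ₂ δ) (hH : 1 ≤ H) (hd : 1 ≤ d)
    (hδ : 0 < δ) (hδ1 : δ < 1) (hγ₁ : 2 ≤ γ₁) (hγ₂ : 2 ≤ γ₂) (hN : 1 ≤ N) :
    L.avgGap M x ≤ regretBound γ₁ γ₂ δ d H Ψ.card N := by
  have hK : 1 ≤ Ψ.card := Finset.card_pos.2 ⟨_, hΨ.realizable ⟨0, hH⟩⟩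
  set lam := min (reg γ₁ d H δ 1) (reg γ₂ d H δ 1)
  rcases le_or_gt (N : ℝ) (d * lam) with hNd | hNd
  · exact (L.avgGap_le_horizon M hN x).trans
      (horizon_le_regretBound hK hH hd hδ hδ1 hN hγ₁ hγ₂ hNd)
  have hlam0 : 0 < lam := one_pos.trans_le
    (le_min (one_le_reg hγ₁ hd hH hδ hδ1 le_rfl) (one_le_reg hγ₂ hd hH hδ hδ1 le_rfl))
  have hN1 : (1 : ℝ) ≤ N := by exact_mod_cast hN
  have hd1 : (1 : ℝ) ≤ d := by exact_mod_cast hd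
  have hH1 : (1 : ℝ) ≤ H := by exact_mod_cast hH
  set l := Real.log (1 + N / (d * lam))
  have hl : 1 / 2 ≤ l :=
    half_le_log_one_add ((one_le_div (mul_pos (one_pos.trans_le hd1) hlam0)).2 hNd.le)
  rw [L.avgGap_eq, one_div, inv_mul_le_iff₀ (one_pos.trans_le hN1), mul_regretBound hN]
  set Y := radius γ₁ d H Ψ.card δ N
  set β := beta γ₂ d H δ N
  set Q := √(2 * d * N * l)
  have hY : 1 ≤ Y := one_le_radius hγ₁ hd hK hH hδ hδ1 hN
  have hβ : 0 ≤ β := beta_nonneg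
  have hQ : 1 ≤ Q := Real.one_le_sqrt.2 (by nlinarith [one_le_mul_of_one_le_of_one_le hd1 hN1])
  have hsqrt : ∀ {γ}, 2 ≤ γ → lam ≤ reg γ d H δ 1 →
      √(N * potentialBound d H (reg γ d H δ 1) δ N) ≤ 2 * Q := fun hγ hle => by
    rw [← Real.sqrt_sq zero_le_two, ← Real.sqrt_mul (sq_nonneg 2)]
    refine Real.sqrt_le_sqrt ?_
    calc _ ≤ N * (6 * d * l) := by gcongr; exact potentialBound_le hγ hd hH hδ hδ1 hlam0 hle hl
      _ ≤ 2 ^ 2 * (2 * d * N * l) := by nlinarith [show 0 ≤ d * N * l by positivity]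
  refine (hx.sum_integral_gap_le hM hΨ hL hH hd hδ hδ1 hγ₁ hγ₂ hN).trans ?_
  calc _ ≤ H * (H * Y * Q) + H * (11 * H * Y * (2 * Q) + 2 * β * (2 * Q)) := by
        gcongr
        · exact le_mul_of_one_le_right (by positivity) (one_le_mul_of_one_le_of_one_le
            (one_le_mul_of_one_le_of_one_le hH1 hY) hQ)
        · exact hsqrt hγ₁ (min_le_left _ _)
        · exact hsqrt hγ₂ (min_le_right _ _)
    _ = (23 * H * Y + 4 * β) * H * Q := by ring
    _ ≤ (42 * H * Y + 6 * β) * H * Q := by gcongr <;> norm_num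

lemma Learner.RunsUCB.measure_not_isTypical_le (hL : L.RunsUCB M ν φ ψ Ψ γ₁ γ₂ δ)
    (hM : IsModelI M ν φ ψ μ η) (hΨ : IsModelClass ν φ μ Ψ) (hH : 1 ≤ H) (hd : 1 ≤ d)
    (hδ : 0 < δ) (hδ1 : δ < 1) (hγ₁ : 2 ≤ γ₁) (hγ₂ : 2 ≤ γ₂) (N : ℕ) :
    L.runLaw M N {x | ¬ L.IsTypical M ν φ ψ μ Ψ.card γ₁ γ₂ δ x} ≤
      ENNReal.ofReal (3 * δ / 2) := by
  have hmle := L.measure_exists_logLik_le_and_lt_dataError_le hM hΨ hH hδ hδ1 N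
  have hφ := L.measure_exists_potentialBound_lt_le M hM.φ_measurable hM.φ_norm_le
    (one_le_reg hγ₁ hd hH hδ hδ1 le_rfl) hd hH hδ N
  have hψ := L.measure_exists_potentialBound_lt_le M hM.ψ_measurable hM.ψ_norm_le
    (one_le_reg hγ₂ hd hH hδ hδ1 le_rfl) hd hH hδ N
  rw [show 3 * δ / 2 = δ / 2 + δ / 2 + δ / 2 by ring, ENNReal.ofReal_add (by positivity)
    (by positivity), ENNReal.ofReal_add (by positivity) (by positivity)]
  refine (measure_mono ?_).trans ((measure_union_le _ _).trans
    (add_le_add ((measure_union_le _ _).trans (add_le_add hmle hφ)) hψ))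
  intro x hx
  by_contra hgood
  simp only [Set.mem_union, Set.mem_ofPred_eq, not_or, not_exists, not_and, not_lt] at hgood
  obtain ⟨⟨hmle, hφ⟩, hψ⟩ := hgood
  exact hx ⟨fun i hi h => hmle i h _ (hL.mle_mem i hi _ h)
    (hL.mle_max i hi _ h _ (hΨ.realizable h)), hφ, hψ⟩

lemma Learner.RunsUCB.measure_avgGap_le_regretBound (hL : L.RunsUCB M ν φ ψ Ψ γ₁ γ₂ δ)
    (hM : IsModelI M ν φ ψ μ η) (hΨ : IsModelClass ν φ μ Ψ) (hH : 1 ≤ H) (hd : 1 ≤ d)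
    (hδ : 0 < δ) (hδ1 : δ < 1) (hγ₁ : 2 ≤ γ₁) (hγ₂ : 2 ≤ γ₂) (hN : 1 ≤ N) :
    ENNReal.ofReal (1 - 3 * δ / 2) ≤
      L.runLaw M N {x | L.avgGap M x ≤ regretBound γ₁ γ₂ δ d H Ψ.card N} := by
  let good : Set (Fin N → Episode H W S A) :=
    {x | L.avgGap M x ≤ regretBound γ₁ γ₂ δ d H Ψ.card N}
  have hbad : L.runLaw M N goodᶜ ≤ ENNReal.ofReal (3 * δ / 2) :=
    (measure_mono <| Set.compl_subset_compl.2 fun _ htyp =>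
      Learner.IsTypical.avgGap_le_regretBound htyp hM hΨ hL hH hd hδ hδ1 hγ₁ hγ₂ hN).trans
      (hL.measure_not_isTypical_le hM hΨ hH hd hδ hδ1 hγ₁ hγ₂ N)
  rw [ENNReal.ofReal_sub _ (by positivity), ENNReal.ofReal_one, tsub_le_iff_right]
  calc (1 : ℝ≥0∞) = L.runLaw M N (good ∪ goodᶜ) := by
        rw [Set.union_compl_self, measure_univ]
    _ ≤ L.runLaw M N good + ENNReal.ofReal (3 * δ / 2) :=
        (measure_union_le _ _).trans (by gcongr)

end Regret

section RegretConst

variable {γ₁ γ₂ δ : ℝ} {d H K N : ℕ}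

lemma log_le_log_mul_card (hK : 1 ≤ K) (hH : 1 ≤ H) (hδ : 0 < δ) (hN : 1 ≤ N) :
    Real.log (2 * N * H / δ) ≤ Real.log (2 * N * H * K / δ) := by
  have : (0 : ℝ) < N := by exact_mod_cast hN
  have : (0 : ℝ) < H := by exact_mod_cast hH
  refine Real.log_le_log (by positivity) (div_le_div_of_nonneg_right ?_ hδ.le)
  exact le_mul_of_one_le_right (by positivity) (by exact_mod_cast hK)

lemma radius_sq_le (hγ₁ : 0 ≤ γ₁) (hd : 1 ≤ d) (hK : 1 ≤ K) (hH : 1 ≤ H) (hδ : 0 < δ)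
    (hδ1 : δ < 1) (hN : 1 ≤ N) :
    radius γ₁ d H K δ N ^ 2 ≤ (2 * γ₁ + 4) * d ^ 2 * Real.log (2 * N * H * K / δ) := by
  have hd1 : (1 : ℝ) ≤ d ^ 2 := one_le_pow₀ (by exact_mod_cast hd)
  have hlog := log_mul_card_nonneg hK hH hδ hδ1 hN
  have hreg : reg γ₁ d H δ N ≤ γ₁ * d * Real.log (2 * N * H * K / δ) :=
    mul_le_mul_of_nonneg_left (log_le_log_mul_card hK hH hδ hN) (by positivity)
  rw [radius, Real.sq_sqrt', max_le_iff]
  refine ⟨?_, by positivity⟩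
  calc 2 * reg γ₁ d H δ N * d + 4 * Real.log (2 * N * H * K / δ)
      ≤ 2 * (γ₁ * d * Real.log (2 * N * H * K / δ)) * d +
          4 * (d ^ 2 * Real.log (2 * N * H * K / δ)) := by
        gcongr
        exact le_mul_of_one_le_left hlog hd1
    _ = (2 * γ₁ + 4) * d ^ 2 * Real.log (2 * N * H * K / δ) := by ring

lemma beta_sq_le (hγ₂ : 0 ≤ γ₂) (hK : 1 ≤ K) (hH : 1 ≤ H) (hδ : 0 < δ) (hδ1 : δ < 1)
    (hN : 1 ≤ N) :
    beta γ₂ d H δ N ^ 2 ≤ γ₂ * d ^ 2 * Real.log (2 * N * H * K / δ) := by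
  have := log_mul_card_nonneg hK hH hδ hδ1 hN
  have hreg : reg γ₂ d H δ N ≤ γ₂ * d * Real.log (2 * N * H * K / δ) :=
    mul_le_mul_of_nonneg_left (log_le_log_mul_card hK hH hδ hN) (by positivity)
  rw [beta, Real.sq_sqrt', max_le_iff]
  refine ⟨?_, by positivity⟩
  calc d * reg γ₂ d H δ N ≤ d * (γ₂ * d * Real.log (2 * N * H * K / δ)) := by
        gcongr
    _ = γ₂ * d ^ 2 * Real.log (2 * N * H * K / δ) := by ring

/-- The constant of the squared regret bound once all logarithms are collected: it comes from
`(42 H · radius + 6 β)² ≤ 2 ((42 H · radius)² + (6 β)²)`. -/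
noncomputable def regretConst (γ₁ γ₂ : ℝ) : ℝ :=
  2 * (1764 * (2 * γ₁ + 4) + 36 * γ₂)

lemma regretConst_pos (hγ₁ : 0 ≤ γ₁) (hγ₂ : 0 ≤ γ₂) : 0 < regretConst γ₁ γ₂ := by
  unfold regretConst
  positivity

lemma radius_add_beta_sq_le (hγ₁ : 0 ≤ γ₁) (hγ₂ : 0 ≤ γ₂) (hd : 1 ≤ d) (hK : 1 ≤ K)
    (hH : 1 ≤ H) (hδ : 0 < δ) (hδ1 : δ < 1) (hN : 1 ≤ N) :
    (42 * H * radius γ₁ d H K δ N + 6 * beta γ₂ d H δ N) ^ 2 ≤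
      regretConst γ₁ γ₂ * (H ^ 2 * d ^ 2 * Real.log (2 * N * H * K / δ)) := by
  have hH1 : (1 : ℝ) ≤ H ^ 2 := one_le_pow₀ (by exact_mod_cast hH)
  have := log_mul_card_nonneg hK hH hδ hδ1 hN
  calc (42 * H * radius γ₁ d H K δ N + 6 * beta γ₂ d H δ N) ^ 2
      ≤ 2 * ((42 * H * radius γ₁ d H K δ N) ^ 2 + (6 * beta γ₂ d H δ N) ^ 2) := add_sq_le
    _ = 2 * (1764 * H ^ 2 * radius γ₁ d H K δ N ^ 2 + 36 * (1 * beta γ₂ d H δ N ^ 2)) := by ring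
    _ ≤ 2 * (1764 * H ^ 2 * ((2 * γ₁ + 4) * d ^ 2 * Real.log (2 * N * H * K / δ)) +
          36 * (H ^ 2 * (γ₂ * d ^ 2 * Real.log (2 * N * H * K / δ)))) := by
        gcongr
        exacts [radius_sq_le hγ₁ hd hK hH hδ hδ1 hN, beta_sq_le hγ₂ hK hH hδ hδ1 hN]
    _ = regretConst γ₁ γ₂ * (H ^ 2 * d ^ 2 * Real.log (2 * N * H * K / δ)) := by
        unfold regretConst
        ring

lemma regretBound_sq_le (hγ₁ : 2 ≤ γ₁) (hγ₂ : 2 ≤ γ₂) (hd : 1 ≤ d) (hK : 1 ≤ K) (hH : 1 ≤ H)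
    (hδ : 0 < δ) (hδ1 : δ < 1) (hN : 1 ≤ N) :
    regretBound γ₁ γ₂ δ d H K N ^ 2 ≤ 2 * regretConst γ₁ γ₂ * (H ^ 4 * d ^ 3) *
      Real.log (2 * N * H * K / δ) * Real.log (1 + N) / N := by
  have hγ₁0 : 0 ≤ γ₁ := zero_le_two.trans hγ₁
  have hγ₂0 : 0 ≤ γ₂ := zero_le_two.trans hγ₂
  have hN0 : (0 : ℝ) < N := by exact_mod_cast hN
  have hlam : (1 : ℝ) ≤ d * min (reg γ₁ d H δ 1) (reg γ₂ d H δ 1) :=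
    one_le_mul_of_one_le_of_one_le (by exact_mod_cast hd)
      (le_min (one_le_reg hγ₁ hd hH hδ hδ1 le_rfl) (one_le_reg hγ₂ hd hH hδ hδ1 le_rfl))
  have hsq := radius_add_beta_sq_le hγ₁0 hγ₂0 hd hK hH hδ hδ1 hN
  rw [regretBound_eq]
  set lam := min (reg γ₁ d H δ 1) (reg γ₂ d H δ 1)
  set B := 42 * H * radius γ₁ d H K δ N + 6 * beta γ₂ d H δ N
  set G := Real.log (2 * N * H * K / δ)
  have hlog : 0 ≤ Real.log (1 + N / (d * lam)) := Real.log_nonneg (by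
    rw [le_add_iff_nonneg_right]; positivity)
  rw [mul_pow, mul_pow, mul_pow, Real.sq_sqrt (by positivity), Real.sq_sqrt hlog]
  calc B ^ 2 * (H ^ 2 * (2 * d / N)) * Real.log (1 + N / (d * lam))
      ≤ regretConst γ₁ γ₂ * (H ^ 2 * d ^ 2 * G) * (H ^ 2 * (2 * d / N)) * Real.log (1 + N) := by
        gcongr
        · exact (sq_nonneg B).trans hsq |> (mul_nonneg · (by positivity))
        · exact div_le_self hN0.le hlam
    _ = 2 * regretConst γ₁ γ₂ * (H ^ 4 * d ^ 3) * G * Real.log (1 + N) / N := by field_simp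

end RegretConst

section Logarithms

lemma one_add_log_sq_le {t : ℝ} (ht : 1 ≤ t) : (1 + Real.log t) ^ 2 ≤ 16 * √t := by
  have hsqrt : 0 < √t := Real.sqrt_pos.2 (one_pos.trans_le ht)
  have hlog : Real.log t = 4 * Real.log √√t := by
    rw [Real.log_sqrt hsqrt.le, Real.log_sqrt (zero_le_one.trans ht)]
    ring
  have hle : 1 + Real.log t ≤ 4 * √√t := by
    linarith [Real.log_le_sub_one_of_pos (Real.sqrt_pos.2 hsqrt)]
  calc (1 + Real.log t) ^ 2 ≤ (4 * √√t) ^ 2 := by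
        have := Real.log_nonneg ht
        gcongr
    _ = 16 * √t := by
        rw [mul_pow, Real.sq_sqrt hsqrt.le]
        norm_num

lemma log_one_add_mul_log_sq_le {X t : ℝ} (hX : 0 < X) (ht : 1 ≤ t) :
    Real.log (1 + t * (X * Real.log (2 + X) ^ 2)) ≤ Real.log t + 4 * Real.log (2 + X) := by
  have hlog0 : 0 ≤ Real.log (2 + X) := Real.log_nonneg (by linarith)
  have hlog : Real.log (2 + X) ≤ 2 + X :=
    (Real.log_le_sub_one_of_pos (by linarith)).trans (by linarith)
  have hpoly : 1 + t * (X * Real.log (2 + X) ^ 2) ≤ t * (2 + X) ^ 4 :=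
    calc 1 + t * (X * Real.log (2 + X) ^ 2) ≤ t * 1 + t * (X * (2 + X) ^ 2) := by
          gcongr
          linarith
      _ ≤ t * (2 + X) ^ 4 := by
          rw [← mul_add]
          gcongr
          have hcube : 1 ≤ (2 + X) ^ 3 := one_le_pow₀ (by linarith)
          nlinarith [mul_le_mul_of_nonneg_left hcube hX.le]
  calc Real.log (1 + t * (X * Real.log (2 + X) ^ 2)) ≤ Real.log (t * (2 + X) ^ 4) :=
        Real.log_le_log (by positivity) hpoly
    _ = Real.log t + 4 * Real.log (2 + X) := by
        rw [Real.log_mul (by positivity) (by positivity), Real.log_pow]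
        norm_cast

lemma log_poly_le {L u y : ℝ} (hL : 1 / 2 ≤ L) (hy : 0 ≤ y) (hu : 0 ≤ u) (huy : u ≤ y + 4 * L) :
    (8 * L + 3 * u) * u ≤ 80 * L ^ 2 * (1 + y) ^ 2 := by
  have huL : u ≤ L * (4 + 2 * y) := by
    nlinarith [mul_le_mul_of_nonneg_right hL hy]
  calc (8 * L + 3 * u) * u ≤ (8 * L + 3 * (L * (4 + 2 * y))) * (L * (4 + 2 * y)) := by gcongr
    _ = L ^ 2 * ((20 + 6 * y) * (4 + 2 * y)) := by ring
    _ ≤ L ^ 2 * (80 * (1 + y) ^ 2) := mul_le_mul_of_nonneg_left (by nlinarith) (sq_nonneg L)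
    _ = 80 * L ^ 2 * (1 + y) ^ 2 := by ring

end Logarithms

section SampleComplexity

variable {γ₁ γ₂ δ ε X t : ℝ} {d H K N : ℕ}

/-- The constant `C` of the sample complexity bound, large enough that every `t ≥ C` satisfies
`160 · regretConst · (1 + log t)² < t`. -/
noncomputable def sampleConst (γ₁ γ₂ : ℝ) : ℝ :=
  (2560 * regretConst γ₁ γ₂) ^ 2 + 1

lemma one_le_sampleConst : 1 ≤ sampleConst γ₁ γ₂ :=
  le_add_of_nonneg_left (sq_nonneg _)

lemma mul_one_add_log_sq_lt (hγ₁ : 0 ≤ γ₁) (hγ₂ : 0 ≤ γ₂) (ht : sampleConst γ₁ γ₂ ≤ t) :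
    160 * regretConst γ₁ γ₂ * (1 + Real.log t) ^ 2 < t := by
  have hC := regretConst_pos hγ₁ hγ₂
  have ht1 : 1 ≤ t := one_le_sampleConst.trans ht
  have hsqrt : 2560 * regretConst γ₁ γ₂ < √t :=
    Real.lt_sqrt_of_sq_lt ((lt_add_one _).trans_le ht)
  calc 160 * regretConst γ₁ γ₂ * (1 + Real.log t) ^ 2
      ≤ 160 * regretConst γ₁ γ₂ * (16 * √t) := by
        gcongr
        exact one_add_log_sq_le ht1
    _ = 2560 * regretConst γ₁ γ₂ * √t := by ring
    _ < √t * √t := by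
        have : 0 < √t := Real.sqrt_pos.2 (one_pos.trans_le ht1)
        gcongr
    _ = t := Real.mul_self_sqrt (zero_le_one.trans ht1)

lemma one_third_le_log_card_div (hK : 1 ≤ K) (hδ : 0 < δ) (hδ23 : δ < 2 / 3) :
    1 / 3 ≤ Real.log (K / δ) := by
  have hK1 : (1 : ℝ) ≤ K := by exact_mod_cast hK
  have hle : (3 / 2 : ℝ) ≤ K / δ := by
    rw [le_div_iff₀ hδ]
    linarith
  calc (1 / 3 : ℝ) = 1 - (3 / 2)⁻¹ := by norm_num
    _ ≤ Real.log (3 / 2) := Real.one_sub_inv_le_log_of_pos (by norm_num)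
    _ ≤ Real.log (K / δ) := Real.log_le_log (by norm_num) hle

lemma horizon_sq_le {l : ℝ} (hd : 1 ≤ d) (hl : 1 / 3 ≤ l) (hε : 0 < ε) (hεH : ε ≤ H) :
    (H : ℝ) ^ 2 ≤ 3 * (H ^ 4 * d ^ 3 * l / ε ^ 2) := by
  have hd1 : (1 : ℝ) ≤ d ^ 3 := one_le_pow₀ (by exact_mod_cast hd)
  rw [← mul_div_assoc, le_div_iff₀ (by positivity)]
  calc (H : ℝ) ^ 2 * ε ^ 2 ≤ H ^ 2 * H ^ 2 := by gcongr
    _ = 3 * ((H : ℝ) ^ 4 * 1 * (1 / 3)) := by ring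
    _ ≤ 3 * (H ^ 4 * d ^ 3 * l) := by gcongr

lemma log_two_mul_horizon_le (hH : 1 ≤ H) (hX : (H : ℝ) ^ 2 ≤ 3 * X) :
    Real.log (2 * H) ≤ 2 * Real.log (2 + X) := by
  have hH1 : (1 : ℝ) ≤ H := by exact_mod_cast hH
  calc Real.log (2 * H) ≤ Real.log ((2 + X) ^ 2) :=
        Real.log_le_log (by positivity) (by nlinarith [sq_nonneg ((H : ℝ) - 1)])
    _ = 2 * Real.log (2 + X) := by rw [Real.log_pow, Nat.cast_ofNat]

lemma log_mul_card_div_le (hH : 1 ≤ H) (hN : 1 ≤ N) (hX : (H : ℝ) ^ 2 ≤ 3 * X) (hK : 1 ≤ K)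
    (hδ : 0 < δ) (hδ23 : δ < 2 / 3) (hL : 1 / 2 ≤ Real.log (2 + X)) :
    Real.log (2 * N * H * K / δ) ≤
      Real.log (K / δ) * (8 * Real.log (2 + X) + 3 * Real.log (1 + N)) := by
  have : (0 : ℝ) < H := by exact_mod_cast hH
  have hN0 : (0 : ℝ) < N := by exact_mod_cast hN
  have : (0 : ℝ) < K := by exact_mod_cast hK
  have hl := one_third_le_log_card_div hK hδ hδ23
  have hlogN : Real.log N ≤ Real.log (1 + N) := Real.log_le_log hN0 (by linarith)
  have hlogN0 : 0 ≤ Real.log (1 + N) := Real.log_nonneg (by linarith)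
  have hlogH := log_two_mul_horizon_le hH hX
  rw [show 2 * (N : ℝ) * H * K / δ = (2 * H) * N * (K / δ) by ring,
    Real.log_mul (by positivity) (by positivity), Real.log_mul (by positivity) (by positivity)]
  nlinarith [mul_le_mul_of_nonneg_right hl (show 0 ≤ 2 * Real.log (2 + X) + Real.log (1 + N) by
    linarith), mul_le_mul_of_nonneg_left hL (show 0 ≤ Real.log (K / δ) by linarith)]

lemma log_mul_log_lt (hγ₁ : 0 ≤ γ₁) (hγ₂ : 0 ≤ γ₂) (hX : 0 < X)
    (hCN : sampleConst γ₁ γ₂ * X * Real.log (2 + X) ^ 2 ≤ N) :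
    2 * regretConst γ₁ γ₂ * X *
      ((8 * Real.log (2 + X) + 3 * Real.log (1 + N)) * Real.log (1 + N)) < N := by
  have hL : 1 / 2 ≤ Real.log (2 + X) := by
    linarith [Real.log_le_log two_pos (le_add_of_nonneg_right hX.le), Real.log_two_gt_d9]
  have hC := regretConst_pos hγ₁ hγ₂
  set t := N / (X * Real.log (2 + X) ^ 2)
  have hNt : (N : ℝ) = t * (X * Real.log (2 + X) ^ 2) :=
    (div_mul_cancel₀ _ (by positivity)).symm
  have ht : sampleConst γ₁ γ₂ ≤ t := by
    rw [le_div_iff₀ (by positivity), ← mul_assoc]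
    exact hCN
  have ht1 : 1 ≤ t := one_le_sampleConst.trans ht
  have hlogN : Real.log (1 + N) ≤ Real.log t + 4 * Real.log (2 + X) :=
    hNt ▸ log_one_add_mul_log_sq_le hX ht1
  have hlogN0 : 0 ≤ Real.log (1 + N) := Real.log_nonneg (by simp)
  calc _ ≤ 2 * regretConst γ₁ γ₂ * X *
        (80 * Real.log (2 + X) ^ 2 * (1 + Real.log t) ^ 2) := by
        gcongr ?_ * ?_
        exact log_poly_le hL (Real.log_nonneg ht1) hlogN0 hlogN
    _ = 160 * regretConst γ₁ γ₂ * (1 + Real.log t) ^ 2 * (X * Real.log (2 + X) ^ 2) := by ring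
    _ < t * (X * Real.log (2 + X) ^ 2) := by
        gcongr
        exact mul_one_add_log_sq_lt hγ₁ hγ₂ ht
    _ = N := hNt.symm

lemma regretBound_lt (hγ₁ : 2 ≤ γ₁) (hγ₂ : 2 ≤ γ₂) (hd : 1 ≤ d) (hK : 1 ≤ K) (hH : 1 ≤ H)
    (hδ : 0 < δ) (hδ23 : δ < 2 / 3) (hε : 0 < ε) (hεH : ε ≤ H) (hN : 1 ≤ N)
    (hCN : sampleConst γ₁ γ₂ * (H ^ 4 * d ^ 3 * Real.log (K / δ) / ε ^ 2) *
      Real.log (2 + H ^ 4 * d ^ 3 * Real.log (K / δ) / ε ^ 2) ^ 2 ≤ N) :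
    regretBound γ₁ γ₂ δ d H K N < ε := by
  have hγ₁0 : 0 ≤ γ₁ := zero_le_two.trans hγ₁
  have hγ₂0 : 0 ≤ γ₂ := zero_le_two.trans hγ₂
  have hH1 : (1 : ℝ) ≤ H := by exact_mod_cast hH
  have hN0 : (0 : ℝ) < N := by exact_mod_cast hN
  have hHX := horizon_sq_le hd (one_third_le_log_card_div hK hδ hδ23) hε hεH
  set X := H ^ 4 * d ^ 3 * Real.log (K / δ) / ε ^ 2 with hX
  have hX0 : 0 < X := by nlinarith
  have hL : 1 / 2 ≤ Real.log (2 + X) := by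
    linarith [Real.log_le_log two_pos (le_add_of_nonneg_right hX0.le), Real.log_two_gt_d9]
  have hlogN : 0 ≤ Real.log (1 + N) := Real.log_nonneg (by linarith)
  have hC := regretConst_pos hγ₁0 hγ₂0
  refine lt_of_pow_lt_pow_left₀ 2 hε.le ((regretBound_sq_le hγ₁ hγ₂ hd hK hH hδ
    (by linarith) hN).trans_lt ((div_lt_iff₀ hN0).2 ?_))
  calc 2 * regretConst γ₁ γ₂ * (H ^ 4 * d ^ 3) * Real.log (2 * N * H * K / δ) * Real.log (1 + N)
      ≤ 2 * regretConst γ₁ γ₂ * (H ^ 4 * d ^ 3) *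
          (Real.log (K / δ) * (8 * Real.log (2 + X) + 3 * Real.log (1 + N))) *
          Real.log (1 + N) := by
        gcongr
        exact log_mul_card_div_le hH hN hHX hK hδ hδ23 hL
    _ = ε ^ 2 * (2 * regretConst γ₁ γ₂ * X *
          ((8 * Real.log (2 + X) + 3 * Real.log (1 + N)) * Real.log (1 + N))) := by
        rw [hX]
        field_simp
    _ < ε ^ 2 * N := by
        gcongr
        exact log_mul_log_lt hγ₁0 hγ₂0 hX0 hCN

end SampleComplexity

section Nonempty

variable {H d : ℕ} {W S A : Type*} [MeasurableSpace W] [MeasurableSpace S] [MeasurableSpace A]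
  {M : CMDP H W S A} {ν : Measure S} {φ ψ : Fin H → S × A × W → Vec d}
  {μ : Fin H → S → Vec d} {η : Fin H → Vec d}

lemma Learner.nonempty_action (L : Learner H d W S A) (M : CMDP H W S A) (h : Fin H) :
    Nonempty A := by
  obtain ⟨w⟩ : Nonempty W := nonempty_of_isProbabilityMeasure M.q
  have := L.markov 0 h
  exact nonempty_of_isProbabilityMeasure (L.kernel 0 h ((Fin.elim0, w), M.s₁))

lemma IsModelI.one_le_dim (hM : IsModelI M ν φ ψ μ η) [Nonempty A] (h : Fin H) : 1 ≤ d := by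
  by_contra hd
  obtain rfl : d = 0 := by omega
  obtain ⟨a⟩ := ‹Nonempty A›
  obtain ⟨w⟩ : Nonempty W := nonempty_of_isProbabilityMeasure M.q
  have hint := (hM.weight h).integral_eq_one (M.s₁, a, w)
  simp [Subsingleton.elim (φ h (M.s₁, a, w)) 0] at hint

end Nonempty

end CMDPModelI

open CMDPModelI in
theorem theorem1_general {H d : ℕ} {W S A : Type*} [MeasurableSpace W] [MeasurableSpace S]
    [MeasurableSpace A] {M : CMDP H W S A} {ν : Measure S} [SFinite ν]
    {φ ψ : Fin H → S × A × W → Vec d} {μ : Fin H → S → Vec d} {η : Fin H → Vec d}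
    {Ψ : Finset (S → Vec d)} {γ₁ γ₂ δ : ℝ} {L : Learner H d W S A}
    (hγ₁ : 2 ≤ γ₁) (hγ₂ : 2 ≤ γ₂) (hH : 1 ≤ H)
    (hM : IsModelI M ν φ ψ μ η) (hΨ : IsModelClass ν φ μ Ψ) (hδ : 0 < δ) (hδ1 : δ < 1)
    (hL : L.RunsUCB M ν φ ψ Ψ γ₁ γ₂ δ) :
    (∀ N : ℕ, 1 ≤ N → ENNReal.ofReal (1 - 3 * δ / 2) ≤
      L.runLaw M N {x | L.avgGap M x ≤ regretBound γ₁ γ₂ δ d H Ψ.card N}) ∧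
    (∀ ε : ℝ, 0 < ε → ∀ N : ℕ, 1 ≤ N →
      sampleConst γ₁ γ₂ * (H ^ 4 * d ^ 3 * Real.log (Ψ.card / δ) / ε ^ 2) *
        Real.log (2 + H ^ 4 * d ^ 3 * Real.log (Ψ.card / δ) / ε ^ 2) ^ 2 ≤ N →
      ENNReal.ofReal (1 - 3 * δ / 2) ≤ L.runLaw M N {x | L.avgGap M x < ε}) := by
  have := L.nonempty_action M ⟨0, hH⟩
  have hd := hM.one_le_dim ⟨0, hH⟩
  have hK : 1 ≤ Ψ.card := Finset.card_pos.2 ⟨_, hΨ.realizable ⟨0, hH⟩⟩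
  have hregret := fun (N : ℕ) (hN : 1 ≤ N) =>
    hL.measure_avgGap_le_regretBound hM hΨ hH hd hδ hδ1 hγ₁ hγ₂ hN
  refine ⟨hregret, fun ε hε N hN hCN => ?_⟩
  rcases le_or_gt (2 / 3) δ with hδ23 | hδ23
  · rw [ENNReal.ofReal_of_nonpos (by linarith)]
    exact zero_le
  rcases le_or_gt ε H with hεH | hεH
  · exact (hregret N hN).trans (measure_mono fun x hx => lt_of_le_of_lt hx
      (regretBound_lt hγ₁ hγ₂ hd hK hH hδ hδ23 hε hεH hN hCN))
  · have huniv : {x : Fin N → Episode H W S A | L.avgGap M x < ε} = Set.univ :=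
      Set.eq_univ_of_forall fun x => (L.avgGap_le_horizon M hN x).trans_lt hεH
    rw [huniv, measure_univ, ENNReal.ofReal_le_one]
    linarith

open CMDPModelI in
theorem theorem1 :
    ∃ γ₀ : ℝ, 0 < γ₀ ∧ ∀ γ₁ γ₂ : ℝ, γ₀ ≤ γ₁ → γ₀ ≤ γ₂ → ∃ C : ℝ, 0 < C ∧
      ∀ (W S A : Type*) [MeasurableSpace W] [MeasurableSpace S] [MeasurableSpace A]
        [Fintype A] [Nonempty A] [MeasurableSingletonClass A]
        (H d : ℕ) (_ : 1 ≤ H) (M : CMDP H W S A)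
        (ν : MeasureTheory.Measure S) [MeasureTheory.SigmaFinite ν]
        (φ ψ : Fin H → S × A × W → Vec d) (μ : Fin H → S → Vec d) (η : Fin H → Vec d)
        (Ψ : Finset (S → Vec d)) (δ : ℝ) (L : Learner H d W S A),
        IsModelI M ν φ ψ μ η → IsModelClass ν φ μ Ψ → 0 < δ → δ < 1 →
        L.RunsUCB M ν φ ψ Ψ γ₁ γ₂ δ →
        (∀ N : ℕ, 1 ≤ N →
          ENNReal.ofReal (1 - 3 * δ / 2) ≤ L.runLaw M N {x | L.avgGap M x ≤
            (42 * H * √(2 * d * reg γ₁ d H δ N + 4 * Real.log (2 * H * N * Ψ.card / δ))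
                + 6 * √(d * reg γ₂ d H δ N))
              * (H * √(2 * d / N))
              * √(Real.log (1 + N / (d * min (reg γ₁ d H δ 1) (reg γ₂ d H δ 1))))}) ∧
        (∀ ε : ℝ, 0 < ε → ∀ N : ℕ, 1 ≤ N →
          C * (H ^ 4 * d ^ 3 * Real.log (Ψ.card / δ) / ε ^ 2)
              * Real.log (2 + H ^ 4 * d ^ 3 * Real.log (Ψ.card / δ) / ε ^ 2) ^ 2 ≤ N →
          ENNReal.ofReal (1 - 3 * δ / 2) ≤ L.runLaw M N {x | L.avgGap M x < ε}) := by
  refine ⟨2, two_pos, fun γ₁ γ₂ hγ₁ hγ₂ =>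
    ⟨sampleConst γ₁ γ₂, one_pos.trans_le one_le_sampleConst, ?_⟩⟩
  intro W S A _ _ _ _ _ _ H d hH M ν _ φ ψ μ η Ψ δ L hM hΨ hδ hδ1 hL
  exact theorem1_general hγ₁ hγ₂ hH hM hΨ hδ hδ1 hL
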